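/- Let $A$ and $B$ be rings and $M$ an $(A,B)$-bimodule. Let $\mathrm{Rep}(A,M,B)$ be the abelian category whose objects are the triples $\begin{bmatrix}X\\Y\end{bmatrix}_{\varphi}$ with $X$ a left $A$-module, $Y$ a left $B$-module and $\varphi\colon M\otimes_B Y\to X$ an $A$-homomorphism, and whose morphisms are the pairs $(f,g)$ of an $A$-homomorphism $f$ and a $B$-homomorphism $g$ such that $f\varphi=\varphi'(1_M\otimes g)$. Let $\mathcal X\subseteq A\text{-Mod}$ and $\mathcal Y\subseteq B\text{-Mod}$ be full subcategories closed under isomorphisms and containing the zero module, and let $\mathcal M=\mathcal M(\mathcal X,M,\mathcal Y)$ be the full subcategory of $\mathrm{Rep}(A,M,B)$ of all triples with $Y\in\mathcal Y$, $\mathrm{Coker}(\varphi)\in\mathcal X$ and $\varphi$ injective. For an extension-closed full subcategory $\mathcal C$ of an abelian category, with its canonical exact structure, let $\mathcal P(\mathcal C)$ and $\mathcal I(\mathcal C)$ be its classes of projective and injective objects. $\mathcal C$ is a Frobenius category if it has enough projective and enough injective objects and $\mathcal P(\mathcal C)=\mathcal I(\mathcal C)$. Its stable category $\mathrm{St}\,\mathcal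 C$ has the same objects, and its morphisms are those of $\mathcal C$ modulo those that factor through a projective object. It is triangulated in the standard way: the suspension $TX$ is given by short exact sequences $0\to X\to I(X)\to TX\to 0$ in $\mathcal C$ with $I(X)$ injective, and the distinguished triangles are those isomorphic to a triangle $X\xrightarrow{f}Y\xrightarrow{g}Z\xrightarrow{h}TX$ obtained from a morphism, which is the identity on $X$, from a short exact sequence $0\to X\xrightarrow{f}Y\xrightarrow{g}Z\to0$ of $\mathcal C$ to $0\to X\to I(X)\to TX\to0$, with $h$ the induced map. Assume that $\mathcal M$ is a resolving subcategory of $\mathrm{Rep}(A,M,B)$ (it contains all projective objects and is closed under direct summands, extensions and kernels of epimorphisms), that $M\otimes_B Y\in\mathcal X$ for all $Y\in\mathcal Y$, and that one of the following (equivalent) statements holds: (1) $\mathcal M$ is a Frobenius category; (2) $\mathcal X$ and $\mathcal Y$ are Frobenius categories and $M\otimes_B\mathcal I(\mathcal Y)\subseteq\mathcal I(\mathcal X)$; (3) $\mathcal X$ and $\mathcal Y$ are Frobenius categories and $M\otimes_B\mathcal P(\mathcal Y)\subseteq\mathcal P(\mathcal X)$. Then $\mathcal X$, $\mathcal M$ and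 $\mathcal Y$ are Frobenius categories, and there is a recollement of triangulated categories (in the sense of Beilinson, Bernstein and Deligne), with the standard triangulated structures on the stable categories, $$\mathrm{St}\,\mathcal X\ \longrightarrow\ \mathrm{St}\,\mathcal M\ \longrightarrow\ \mathrm{St}\,\mathcal Y ,$$ in which, writing $i_*\colon\mathrm{St}\,\mathcal X\to\mathrm{St}\,\mathcal M$ with left adjoint $i^*$ and right adjoint $i^!$, and $j^*\colon\mathrm{St}\,\mathcal M\to\mathrm{St}\,\mathcal Y$ with left adjoint $j_!$ and right adjoint $j_*$, - $i^*$ is induced by $\mathcal M\to\mathcal X$, $\begin{bmatrix}X\\Y\end{bmatrix}_{\varphi}\mapsto\mathrm{Coker}(\varphi)$; - $i_*$ is induced by $\mathcal X\to\mathcal M$, $X\mapsto\begin{bmatrix}X\\0\end{bmatrix}_{0}$; - $i^!$ is induced by $\mathcal M\to\mathcal X$, $\begin{bmatrix}X\\Y\end{bmatrix}_{\varphi}\mapsto X$ (which does take values in $\mathcal X$); - $j^*$ is induced by $\mathcal M\to\mathcal Y$, $\begin{bmatrix}X\\Y\end{bmatrix}_{\varphi}\mapsto Y$; - $j_!$ is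 induced by $\mathcal Y\to\mathcal M$, $Y\mapsto\begin{bmatrix}M\otimes_B Y\\Y\end{bmatrix}_{1}$. -/

import Mathlib

open CategoryTheory CategoryTheory.Limits CategoryTheory.Pretriangulated
open scoped TensorProduct

set_option linter.unusedSectionVars false

universe v u v₁ u₁ v₂ u₂ v₃ u₃

/-! ## Exact categories given by full subcategories, Frobenius categories -/

section Exact

variable {𝒜 : Type u} [Category.{v} 𝒜] [Preadditive 𝒜]

/-- A short exact sequence in the full subcategory `P` of `𝒜`: a short exact sequence of `𝒜`
whose three terms belong to `P`. -/
def IsConflation {P : ObjectProperty 𝒜} (S : ShortComplex P.FullSubcategory) : Prop :=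
  (S.map P.ι).ShortExact

/-- The class of projective objects of `P`: those `X` in `P` such that `Hom(X, -)` takes short
exact sequences in `P` to short exact sequences. As `Hom(X, -)` is left exact, only the
surjectivity on the right is recorded. -/
def relProjective (P : ObjectProperty 𝒜) : ObjectProperty 𝒜 := fun X =>
  P X ∧ ∀ S : ShortComplex 𝒜, S.ShortExact → P S.X₁ → P S.X₂ → P S.X₃ →
    Function.Surjective (fun f : X ⟶ S.X₂ => f ≫ S.g)

/-- The class of injective objects of `P`. -/
def relInjective (P : ObjectProperty 𝒜) : ObjectProperty 𝒜 := fun X =>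
  P X ∧ ∀ S : ShortComplex 𝒜, S.ShortExact → P S.X₁ → P S.X₂ → P S.X₃ →
    Function.Surjective (fun f : S.X₂ ⟶ X => S.f ≫ f)

/-- The full subcategory `P`, with its canonical exact structure, is a Frobenius category. -/
structure IsFrobenius (P : ObjectProperty 𝒜) : Prop where
  closedUnderExtensions : P.IsClosedUnderExtensions
  enoughProjectives : ∀ X, P X → ∃ (K Q : 𝒜) (i : K ⟶ Q) (p : Q ⟶ X) (w : i ≫ p = 0),
    (ShortComplex.mk i p w).ShortExact ∧ P K ∧ relProjective P Q
  enoughInjectives : ∀ X, P X → ∃ (I C : 𝒜) (i : X ⟶ I) (p : I ⟶ C) (w : i ≫ p = 0),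
    (ShortComplex.mk i p w).ShortExact ∧ relInjective P I ∧ P C
  injective_iff_projective : ∀ X, relInjective P X ↔ relProjective P X

/-- `P` is a resolving subcategory of `𝒜`: it contains the projective objects of `𝒜` and is
closed under direct summands, extensions and kernels of epimorphisms. -/
structure IsResolving (P : ObjectProperty 𝒜) : Prop where
  projective : ∀ X, Projective X → P X
  retracts : P.IsStableUnderRetracts
  extensions : P.IsClosedUnderExtensions
  kernels : ∀ S : ShortComplex 𝒜, S.ShortExact → P S.X₂ → P S.X₃ → P S.X₁

/-! ## The stable category -/

/-- The subgroup of morphisms `X ⟶ Y` of `P` generated by those that factor through a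
projective object of `P`. Such a morphism itself factors through a projective object as soon as
`P` has biproducts, see `mem_stableIdeal_iff`. -/
def stableIdeal (P : ObjectProperty 𝒜) (X Y : P.FullSubcategory) : AddSubgroup (X ⟶ Y) :=
  AddSubgroup.closure {f | ∃ (Q : P.FullSubcategory) (a : X ⟶ Q) (b : Q ⟶ Y),
    relProjective P Q.obj ∧ a ≫ b = f}

theorem stableIdeal_comp_left (P : ObjectProperty 𝒜) {X Y Z : P.FullSubcategory} (f : X ⟶ Y)
    {g : Y ⟶ Z} (hg : g ∈ stableIdeal P Y Z) : f ≫ g ∈ stableIdeal P X Z := by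
  refine AddSubgroup.closure_induction (p := fun g _ => f ≫ g ∈ stableIdeal P X Z)
    ?_ ?_ ?_ ?_ hg
  · rintro _ ⟨Q, a, b, hQ, rfl⟩
    exact AddSubgroup.subset_closure ⟨Q, f ≫ a, b, hQ, by simp⟩
  · simp [zero_mem]
  · intro x y _ _ hx hy
    simpa using add_mem hx hy
  · intro x _ hx
    simpa using neg_mem hx

theorem stableIdeal_comp_right (P : ObjectProperty 𝒜) {X Y Z : P.FullSubcategory} {f : X ⟶ Y}
    (g : Y ⟶ Z) (hf : f ∈ stableIdeal P X Y) : f ≫ g ∈ stableIdeal P X Z := by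
  refine AddSubgroup.closure_induction (p := fun f _ => f ≫ g ∈ stableIdeal P X Z)
    ?_ ?_ ?_ ?_ hf
  · rintro _ ⟨Q, a, b, hQ, rfl⟩
    exact AddSubgroup.subset_closure ⟨Q, a, b ≫ g, hQ, by simp⟩
  · simp [zero_mem]
  · intro x y _ _ hx hy
    simpa using add_mem hx hy
  · intro x _ hx
    simpa using neg_mem hx

theorem mem_stableIdeal_iff [HasBinaryBiproducts 𝒜] [HasZeroObject 𝒜] (P : ObjectProperty 𝒜)
    [P.IsClosedUnderExtensions] [P.ContainsZero] {X Y : P.FullSubcategory} (f : X ⟶ Y) :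
    f ∈ stableIdeal P X Y ↔ ∃ (Q : P.FullSubcategory) (a : X ⟶ Q) (b : Q ⟶ Y),
      relProjective P Q.obj ∧ a ≫ b = f := by
  refine ⟨fun hf => ?_, fun hf => AddSubgroup.subset_closure hf⟩
  refine AddSubgroup.closure_induction (p := fun f _ => ∃ (Q : P.FullSubcategory)
    (a : X ⟶ Q) (b : Q ⟶ Y), relProjective P Q.obj ∧ a ≫ b = f) (fun _ h => h) ?_ ?_ ?_ hf
  · obtain ⟨Z, hZ, hPZ⟩ := P.exists_prop_of_containsZero
    exact ⟨⟨Z, hPZ⟩, 0, 0, ⟨hPZ, fun S _ _ _ _ g => ⟨0, hZ.eq_of_src _ _⟩⟩, by simp⟩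
  · rintro _ _ _ _ ⟨Q, a, b, hQ, rfl⟩ ⟨Q', a', b', hQ', rfl⟩
    refine ⟨⟨Q.obj ⊞ Q'.obj, P.prop_biprod Q.property Q'.property⟩,
      ObjectProperty.homMk (biprod.lift a.hom a'.hom),
      ObjectProperty.homMk (biprod.desc b.hom b'.hom),
      ⟨P.prop_biprod Q.property Q'.property, fun S hS h₁ h₂ h₃ g => ?_⟩, ?_⟩
    · obtain ⟨s, hs⟩ := hQ.2 S hS h₁ h₂ h₃ (biprod.inl ≫ g)
      obtain ⟨t, ht⟩ := hQ'.2 S hS h₁ h₂ h₃ (biprod.inr ≫ g)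
      refine ⟨biprod.desc s t, ?_⟩
      dsimp only at hs ht ⊢
      ext <;> simp [hs, ht]
    · ext
      exact biprod.lift_desc
  · rintro _ _ ⟨Q, a, b, hQ, rfl⟩
    exact ⟨Q, -a, b, hQ, by simp⟩

/-- Two parallel morphisms of `P` are identified in the stable category when their difference
belongs to the ideal of morphisms factoring through projective objects. -/
def stableRel (P : ObjectProperty 𝒜) : HomRel P.FullSubcategory :=
  fun X Y f g => f - g ∈ stableIdeal P X Y

instance stableRel_congruence (P : ObjectProperty 𝒜) : Congruence (stableRel P) where
  equivalence :=
    { refl := fun f => by simp [stableRel, zero_mem]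
      symm := fun {f g} h => by simpa [stableRel] using neg_mem h
      trans := fun {f g k} h h' => by simpa [stableRel] using add_mem h h' }
  comp_left f g g' h := by
    simpa [stableRel, Preadditive.comp_sub] using stableIdeal_comp_left P f h
  comp_right g h := by
    simpa [stableRel, Preadditive.sub_comp] using stableIdeal_comp_right P g h

/-- The stable category `St P`. -/
abbrev StableCategory (P : ObjectProperty 𝒜) := CategoryTheory.Quotient (stableRel P)

/-- The projection `P ⥤ St P`. -/
abbrev toStable (P : ObjectProperty 𝒜) : P.FullSubcategory ⥤ StableCategory P :=
  CategoryTheory.Quotient.functor (stableRel P)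

instance stableCategory_preadditive (P : ObjectProperty 𝒜) : Preadditive (StableCategory P) :=
  CategoryTheory.Quotient.preadditive (stableRel P) (by
    intro X Y f₁ f₂ g₁ g₂ h h'
    have := add_mem h h'
    rwa [← add_sub_add_comm] at this)

/-- The standard triangulated structure on the stable category of the Frobenius category `P`:
* the suspension of `X` is (naturally isomorphic to) the cokernel `T` in any short exact sequence
  `0 ⟶ X ⟶ I ⟶ T ⟶ 0` of `P` with `I` injective;
* the distinguished triangles are those isomorphic to a standard triangle
  `X ⟶ Y ⟶ Z ⟶ T ≅ X⟦1⟧`, that is, to the image in `St P` of the sequence `(f, g, h)` obtained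
  from a morphism
  ```
  0 ⟶ X --f--> Y --g--> Z ⟶ 0
      ‖        |a       |h
  0 ⟶ X --i--> I --p--> T ⟶ 0
  ```
  of short exact sequences of `P` with `I` injective. -/
class StableTriangulation (P : ObjectProperty 𝒜) where
  [hasShift : HasShift (StableCategory P) ℤ]
  [hasZeroObject : HasZeroObject (StableCategory P)]
  [shift_additive : ∀ n : ℤ, (shiftFunctor (StableCategory P) n).Additive]
  [pretriangulated : Pretriangulated (StableCategory P)]
  [isTriangulated : IsTriangulated (StableCategory P)]
  suspensionIso (S : ShortComplex P.FullSubcategory) (hS : IsConflation S)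
    (hI : relInjective P S.X₂.obj) :
    (toStable P).obj S.X₃ ≅ ((toStable P).obj S.X₁)⟦(1 : ℤ)⟧
  suspensionIso_naturality {S S' : ShortComplex P.FullSubcategory} (φ : S ⟶ S')
    (hS : IsConflation S) (hI : relInjective P S.X₂.obj)
    (hS' : IsConflation S') (hI' : relInjective P S'.X₂.obj) :
    (toStable P).map φ.τ₃ ≫ (suspensionIso S' hS' hI').hom =
      (suspensionIso S hS hI).hom ≫ ((toStable P).map φ.τ₁)⟦(1 : ℤ)⟧'
  distinguished_iff (Δ : Triangle (StableCategory P)) :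
    Δ ∈ distTriang (StableCategory P) ↔
      ∃ (X Y Z : P.FullSubcategory) (f : X ⟶ Y) (g : Y ⟶ Z) (w : f ≫ g = 0)
        (_ : IsConflation (ShortComplex.mk f g w))
        (I T : P.FullSubcategory) (i : X ⟶ I) (p : I ⟶ T) (w' : i ≫ p = 0)
        (hE : IsConflation (ShortComplex.mk i p w')) (hI : relInjective P I.obj)
        (a : Y ⟶ I) (h : Z ⟶ T),
        f ≫ a = i ∧ g ≫ h = a ≫ p ∧
        Nonempty (Δ ≅ Triangle.mk ((toStable P).map f) ((toStable P).map g)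
          ((toStable P).map h ≫ (suspensionIso (ShortComplex.mk i p w') hE hI).hom))

attribute [reducible] StableTriangulation.hasShift StableTriangulation.pretriangulated

attribute [instance] StableTriangulation.hasShift StableTriangulation.hasZeroObject
  StableTriangulation.shift_additive StableTriangulation.pretriangulated
  StableTriangulation.isTriangulated

end Exact

/-- The functor `F'` between stable categories is induced by the functor `F`. -/
def IsInducedBy {𝒜 : Type u₁} [Category.{v₁} 𝒜] [Preadditive 𝒜]
    {ℬ : Type u₂} [Category.{v₂} ℬ] [Preadditive ℬ]
    {P : ObjectProperty 𝒜} {Q : ObjectProperty ℬ}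
    (F' : StableCategory P ⥤ StableCategory Q) (F : P.FullSubcategory ⥤ Q.FullSubcategory) :
    Prop :=
  toStable P ⋙ F' = F ⋙ toStable Q

/-! ## Recollements -/

section Recollement

variable {𝒯₁ : Type u₁} [Category.{v₁} 𝒯₁] [Preadditive 𝒯₁] [HasZeroObject 𝒯₁] [HasShift 𝒯₁ ℤ]
  [∀ n : ℤ, (shiftFunctor 𝒯₁ n).Additive] [Pretriangulated 𝒯₁]
variable {𝒯₂ : Type u₂} [Category.{v₂} 𝒯₂] [Preadditive 𝒯₂] [HasZeroObject 𝒯₂] [HasShift 𝒯₂ ℤ]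
  [∀ n : ℤ, (shiftFunctor 𝒯₂ n).Additive] [Pretriangulated 𝒯₂]

/-- `F` is a triangulated functor: it commutes with the shifts and preserves distinguished
triangles. -/
def IsTriangleFunctor (F : 𝒯₁ ⥤ 𝒯₂) : Prop :=
  ∃ _ : F.CommShift ℤ, F.IsTriangulated

variable (𝒯₁ 𝒯₂)
variable (𝒯₃ : Type u₃) [Category.{v₃} 𝒯₃] [Preadditive 𝒯₃] [HasZeroObject 𝒯₃] [HasShift 𝒯₃ ℤ]
  [∀ n : ℤ, (shiftFunctor 𝒯₃ n).Additive] [Pretriangulated 𝒯₃]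

/-- A recollement of the triangulated category `𝒯₂` relative to `𝒯₁` (on the left) and `𝒯₃`
(on the right), in the sense of Beilinson, Bernstein and Deligne:
```
      <-- i^* --        <-- j_! --
  𝒯₁  --- i_* -->  𝒯₂  --- j^* -->  𝒯₃
      <-- i^! --        <-- j_* --
```
Here `iUpper = i^*`, `iLower = i_*`, `iShriek = i^!`, `jShriek = j_!`, `jUpper = j^*` and
`jLower = j_*`. -/
structure Recollement where
  iUpper : 𝒯₂ ⥤ 𝒯₁
  iLower : 𝒯₁ ⥤ 𝒯₂
  iShriek : 𝒯₂ ⥤ 𝒯₁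
  jShriek : 𝒯₃ ⥤ 𝒯₂
  jUpper : 𝒯₂ ⥤ 𝒯₃
  jLower : 𝒯₃ ⥤ 𝒯₂
  iUpper_triangle : IsTriangleFunctor iUpper
  iLower_triangle : IsTriangleFunctor iLower
  iShriek_triangle : IsTriangleFunctor iShriek
  jShriek_triangle : IsTriangleFunctor jShriek
  jUpper_triangle : IsTriangleFunctor jUpper
  jLower_triangle : IsTriangleFunctor jLower
  adj_iUpper_iLower : iUpper ⊣ iLower
  adj_iLower_iShriek : iLower ⊣ iShriek
  adj_jShriek_jUpper : jShriek ⊣ jUpper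
  adj_jUpper_jLower : jUpper ⊣ jLower
  iLower_full : iLower.Full
  iLower_faithful : iLower.Faithful
  jShriek_full : jShriek.Full
  jShriek_faithful : jShriek.Faithful
  jLower_full : jLower.Full
  jLower_faithful : jLower.Faithful
  isZero_jUpper_iLower : ∀ X : 𝒯₁, IsZero (jUpper.obj (iLower.obj X))
  triangle_iShriek_jUpper : ∀ X : 𝒯₂,
    ∃ δ : jLower.obj (jUpper.obj X) ⟶ (iLower.obj (iShriek.obj X))⟦(1 : ℤ)⟧,
      Triangle.mk (adj_iLower_iShriek.counit.app X) (adj_jUpper_jLower.unit.app X) δ ∈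
        distTriang 𝒯₂
  triangle_jUpper_iUpper : ∀ X : 𝒯₂,
    ∃ δ : iLower.obj (iUpper.obj X) ⟶ (jShriek.obj (jUpper.obj X))⟦(1 : ℤ)⟧,
      Triangle.mk (adj_jShriek_jUpper.counit.app X) (adj_iUpper_iLower.unit.app X) δ ∈
        distTriang 𝒯₂

end Recollement

/-! ## Tensor product with a bimodule -/

section Tensor

variable (A B : Type u) [Ring A] [Ring B] (M : Type u) [AddCommGroup M] [Module A M]
  [Module Bᵐᵒᵖ M] [SMulCommClass A Bᵐᵒᵖ M]

/-- The relations `(m b) ⊗ y = m ⊗ (b y)`. For an `(A, B)`-bimodule `M`, the `A`-submodule that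
they generate is also the subgroup that they generate. -/
def balancedRelations (Y : Type u) [AddCommGroup Y] [Module B Y] : Submodule A (M ⊗[ℤ] Y) :=
  Submodule.span A {z | ∃ (m : M) (b : B) (y : Y),
    z = (MulOpposite.op b • m) ⊗ₜ[ℤ] y - m ⊗ₜ[ℤ] (b • y)}

/-- The left `A`-module `M ⊗_B Y`, for an `(A, B)`-bimodule `M` and a left `B`-module `Y`. -/
abbrev BimoduleTensor (Y : Type u) [AddCommGroup Y] [Module B Y] : Type u :=
  (M ⊗[ℤ] Y) ⧸ balancedRelations A B M Y

/-- The map `M ⊗_B g`. -/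
def BimoduleTensor.map {Y Y' : Type u} [AddCommGroup Y] [Module B Y] [AddCommGroup Y']
    [Module B Y'] (g : Y →ₗ[B] Y') : BimoduleTensor A B M Y →ₗ[A] BimoduleTensor A B M Y' :=
  Submodule.mapQ _ _
    (TensorProduct.AlgebraTensorModule.map (LinearMap.id : M →ₗ[A] M) g.toAddMonoidHom.toIntLinearMap)
    (by
      rw [balancedRelations, Submodule.span_le]
      rintro _ ⟨m, b, y, rfl⟩
      refine Submodule.subset_span ⟨m, b, g y, ?_⟩
      simp)

theorem BimoduleTensor.map_mk_tmul {Y Y' : Type u} [AddCommGroup Y] [Module B Y] [AddCommGroup Y']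
    [Module B Y'] (g : Y →ₗ[B] Y') (m : M) (y : Y) :
    BimoduleTensor.map A B M g (Submodule.Quotient.mk (m ⊗ₜ[ℤ] y)) =
      Submodule.Quotient.mk (m ⊗ₜ[ℤ] g y) := by
  simp [BimoduleTensor.map]

theorem BimoduleTensor.hom_ext {Y Z : Type u} [AddCommGroup Y] [Module B Y] [AddCommGroup Z]
    [Module A Z] {f g : BimoduleTensor A B M Y →ₗ[A] Z}
    (h : ∀ (m : M) (y : Y), f (Submodule.Quotient.mk (m ⊗ₜ[ℤ] y)) =
      g (Submodule.Quotient.mk (m ⊗ₜ[ℤ] y))) : f = g := by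
  refine LinearMap.ext fun x => ?_
  obtain ⟨x, rfl⟩ := Submodule.Quotient.mk_surjective _ x
  induction x with
  | zero => simp
  | tmul m y => exact h m y
  | add x y hx hy => simp only [Submodule.Quotient.mk_add, map_add, hx, hy]

/-- The functor `M ⊗_B - : B-Mod ⥤ A-Mod`. -/
def tensorFunctor : ModuleCat.{u} B ⥤ ModuleCat.{u} A where
  obj Y := ModuleCat.of A (BimoduleTensor A B M Y)
  map g := ModuleCat.ofHom (BimoduleTensor.map A B M g.hom)
  map_id Y := by
    apply ModuleCat.hom_ext
    refine BimoduleTensor.hom_ext A B M fun m y => ?_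
    simp [BimoduleTensor.map_mk_tmul]
  map_comp f g := by
    apply ModuleCat.hom_ext
    refine BimoduleTensor.hom_ext A B M fun m y => ?_
    simp [BimoduleTensor.map_mk_tmul]

theorem BimoduleTensor.map_add {Y Y' : Type u} [AddCommGroup Y] [Module B Y] [AddCommGroup Y']
    [Module B Y'] (f g : Y →ₗ[B] Y') : BimoduleTensor.map A B M (f + g) =
      BimoduleTensor.map A B M f + BimoduleTensor.map A B M g := by
  refine BimoduleTensor.hom_ext A B M fun m y => ?_
  rw [LinearMap.add_apply]
  simp [BimoduleTensor.map_mk_tmul, TensorProduct.tmul_add]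

instance tensorFunctor_additive : (tensorFunctor A B M).Additive where
  map_add {_ _ f g} := ModuleCat.hom_ext (BimoduleTensor.map_add A B M f.hom g.hom)

/-! ## The category of triples and its subcategory of monic representations -/

/-- The category `Rep(A, M, B)` of triples `(X, Y, φ)` with `X` a left `A`-module, `Y` a left
`B`-module and `φ : M ⊗_B Y ⟶ X` an `A`-homomorphism. In terms of the comma category, `Y` is the
component `left`, `X` is the component `right` and `φ` is the component `hom`. -/
abbrev TripleRep := Comma (tensorFunctor A B M) (𝟭 (ModuleCat.{u} A))

/-- The functor `(X, Y, φ) ↦ Coker φ`. -/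
noncomputable def tripleCoker : TripleRep A B M ⥤ ModuleCat.{u} A where
  obj U := cokernel U.hom
  map {U V} f := cokernel.map U.hom V.hom ((tensorFunctor A B M).map f.left) f.right f.w.symm
  map_id U := by
    rw [← cancel_epi (cokernel.π U.hom)]
    simp
  map_comp f g := by
    rw [← cancel_epi (cokernel.π _)]
    simp

/-- The functor `X ↦ (X, 0, 0)`. -/
def tripleZero : ModuleCat.{u} A ⥤ TripleRep A B M where
  obj X := { left := ModuleCat.of B PUnit, right := X, hom := 0 }
  map f := { left := 𝟙 _, right := f, w := by simp }

/-- The functor `Y ↦ (M ⊗_B Y, Y, 1)`. -/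
def tripleTensor : ModuleCat.{u} B ⥤ TripleRep A B M where
  obj Y := { left := Y, right := (tensorFunctor A B M).obj Y, hom := 𝟙 _ }
  map g := { left := g, right := (tensorFunctor A B M).map g, w := by simp }

variable {A B} (𝒳 : ObjectProperty (ModuleCat.{u} A)) (𝒴 : ObjectProperty (ModuleCat.{u} B))

/-- The full subcategory `ℳ(𝒳, M, 𝒴)` of `Rep(A, M, B)`: triples `(X, Y, φ)` with `Y` in `𝒴`,
`Coker φ` in `𝒳` and `φ` injective. -/
def monoRep : ObjectProperty (TripleRep A B M) := fun U =>
  𝒴 U.left ∧ 𝒳 (cokernel U.hom) ∧ Function.Injective U.hom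

/-- `ℙ_M : ℳ(𝒳, M, 𝒴) ⥤ 𝒳`, `(X, Y, φ) ↦ Coker φ`. -/
noncomputable def monoCoker : (monoRep M 𝒳 𝒴).FullSubcategory ⥤ 𝒳.FullSubcategory :=
  𝒳.lift ((monoRep M 𝒳 𝒴).ι ⋙ tripleCoker A B M) (fun U => U.property.2.1)

/-- `P_M : ℳ(𝒳, M, 𝒴) ⥤ 𝒳`, `(X, Y, φ) ↦ X`, when all these `X` belong to `𝒳`. -/
def monoFst (h : ∀ U, monoRep M 𝒳 𝒴 U → 𝒳 U.right) :
    (monoRep M 𝒳 𝒴).FullSubcategory ⥤ 𝒳.FullSubcategory :=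
  𝒳.lift ((monoRep M 𝒳 𝒴).ι ⋙ Comma.snd _ _) (fun U => h U.obj U.property)

/-- `Q_M : ℳ(𝒳, M, 𝒴) ⥤ 𝒴`, `(X, Y, φ) ↦ Y`. -/
def monoSnd : (monoRep M 𝒳 𝒴).FullSubcategory ⥤ 𝒴.FullSubcategory :=
  𝒴.lift ((monoRep M 𝒳 𝒴).ι ⋙ Comma.fst _ _) (fun U => U.property.1)

theorem bimoduleTensor_subsingleton (Y : Type u) [AddCommGroup Y] [Module B Y] [Subsingleton Y] :
    Subsingleton (BimoduleTensor A B M Y) := by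
  have : Subsingleton (M ⊗[ℤ] Y) := by
    refine ⟨fun a b => ?_⟩
    have key : ∀ z : M ⊗[ℤ] Y, z = 0 := fun z => by
      induction z with
      | zero => rfl
      | tmul m y => rw [Subsingleton.elim y 0, TensorProduct.tmul_zero]
      | add x y hx hy => rw [hx, hy, add_zero]
    rw [key a, key b]
  infer_instance

theorem tripleZero_mem [𝒳.IsClosedUnderIsomorphisms] [𝒴.IsClosedUnderIsomorphisms]
    [𝒴.ContainsZero] {X : ModuleCat.{u} A} (hX : 𝒳 X) :
    monoRep M 𝒳 𝒴 ((tripleZero A B M).obj X) := by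
  refine ⟨?_, ?_, ?_⟩
  · obtain ⟨Z, hZ, hPZ⟩ := 𝒴.exists_prop_of_containsZero
    exact 𝒴.prop_of_iso (hZ.iso (ModuleCat.isZero_of_subsingleton (ModuleCat.of B PUnit))) hPZ
  · exact 𝒳.prop_of_iso (cokernelZeroIsoTarget
      (X := (tensorFunctor A B M).obj (ModuleCat.of B PUnit)) (Y := X)).symm hX
  · intro a b _
    have := bimoduleTensor_subsingleton (A := A) (B := B) M PUnit.{u + 1}
    exact Subsingleton.elim (α := BimoduleTensor A B M PUnit.{u + 1}) a b

theorem tripleTensor_mem [𝒳.IsClosedUnderIsomorphisms] [𝒳.ContainsZero]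
    {Y : ModuleCat.{u} B} (hY : 𝒴 Y) : monoRep M 𝒳 𝒴 ((tripleTensor A B M).obj Y) := by
  refine ⟨hY, ?_, fun a b h => h⟩
  obtain ⟨Z, hZ, hPZ⟩ := 𝒳.exists_prop_of_containsZero
  exact 𝒳.prop_of_iso (hZ.iso
    (isZero_cokernel_of_epi (𝟙 ((tensorFunctor A B M).obj Y)))) hPZ

/-- `p_M : 𝒳 ⥤ ℳ(𝒳, M, 𝒴)`, `X ↦ (X, 0, 0)`. -/
def monoZero [𝒳.IsClosedUnderIsomorphisms] [𝒴.IsClosedUnderIsomorphisms] [𝒴.ContainsZero] :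
    𝒳.FullSubcategory ⥤ (monoRep M 𝒳 𝒴).FullSubcategory :=
  (monoRep M 𝒳 𝒴).lift (𝒳.ι ⋙ tripleZero A B M) (fun X => tripleZero_mem M 𝒳 𝒴 X.property)

/-- `q_M : 𝒴 ⥤ ℳ(𝒳, M, 𝒴)`, `Y ↦ (M ⊗_B Y, Y, 1)`. -/
def monoTensor [𝒳.IsClosedUnderIsomorphisms] [𝒳.ContainsZero] :
    𝒴.FullSubcategory ⥤ (monoRep M 𝒳 𝒴).FullSubcategory :=
  (monoRep M 𝒳 𝒴).lift (𝒴.ι ⋙ tripleTensor A B M)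
    (fun Y => tripleTensor_mem M 𝒳 𝒴 Y.property)

end Tensor

/-! ## Shifts by the integers from a single autoequivalence -/

theorem Int.induction_of_iff {p : ℤ → Prop} (h₀ : p 0) (h : ∀ n, p n ↔ p (n + 1)) (n : ℤ) :
    p n := by
  induction n using Int.induction_on with
  | zero => exact h₀
  | succ i hi => exact (h _).1 hi
  | pred i hi => exact (h _).2 (by simpa using hi)

/-- A family indexed by `ℤ` that is compatible with given bijections `P n → P (n + 1)`. -/
theorem Int.exists_section {P : ℤ → Type*} (e : ∀ n, P n ≃ P (n + 1)) (p₀ : P 0) :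
    ∃ s : ∀ n, P n, s 0 = p₀ ∧ ∀ n, s (n + 1) = e n (s n) := by
  let pos : ∀ k : ℕ, P (Int.ofNat k) := fun k =>
    Nat.rec (motive := fun k => P (Int.ofNat k)) p₀ (fun k x => e (Int.ofNat k) x) k
  let neg : ∀ k : ℕ, P (Int.negSucc k) := fun k =>
    Nat.rec (motive := fun k => P (Int.negSucc k)) ((e (Int.negSucc 0)).symm p₀)
      (fun k x => (e (Int.negSucc (k + 1))).symm x) k
  refine ⟨fun n => match n with
    | Int.ofNat k => pos k
    | Int.negSucc k => neg k, rfl, fun n => ?_⟩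
  match n with
  | Int.ofNat k => rfl
  | Int.negSucc 0 => exact ((e (Int.negSucc 0)).apply_symm_apply p₀).symm
  | Int.negSucc (k + 1) => exact ((e (Int.negSucc (k + 1))).apply_symm_apply (neg k)).symm

namespace CategoryTheory.Equivalence

variable {C : Type u} [Category.{v} C]

/-- The iterates of an endofunctor. -/
def iter (G : C ⥤ C) : ℕ → (C ⥤ C)
  | 0 => 𝟭 C
  | k + 1 => iter G k ⋙ G

variable (E : C ≌ C)

/-- The iterates of an autoequivalence, indexed by the integers. -/
def zpow : ℤ → (C ⥤ C)
  | Int.ofNat k => iter E.functor k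
  | Int.negSucc k => iter E.inverse (k + 1)

/-- The isomorphisms `Eⁿ ⋙ E ≅ Eⁿ⁺¹`. -/
def zpowSucc : ∀ n : ℤ, E.zpow n ⋙ E.functor ≅ E.zpow (n + 1)
  | Int.ofNat _ => Iso.refl _
  | Int.negSucc 0 => E.counitIso
  | Int.negSucc (k + 1) => Functor.isoWhiskerLeft (iter E.inverse (k + 1)) E.counitIso

/-- The isomorphisms `Eⁿ ⋙ E ≅ Eᵐ` for `n + 1 = m`. -/
def zpowSucc' (n m : ℤ) (h : n + 1 = m) : E.zpow n ⋙ E.functor ≅ E.zpow m :=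
  E.zpowSucc n ≪≫ eqToIso (by rw [h])

/-- The bijection between isomorphisms `Eᵃ ⋙ Eᵇ ≅ Eᵃ⁺ᵇ` and `Eᵃ ⋙ Eᵇ⁺¹ ≅ Eᵃ⁺ᵇ⁺¹`. -/
noncomputable def zpowAddEquiv (a b : ℤ) : (E.zpow a ⋙ E.zpow b ≅ E.zpow (a + b)) ≃
    (E.zpow a ⋙ E.zpow (b + 1) ≅ E.zpow (a + (b + 1))) :=
  (((Functor.FullyFaithful.ofFullyFaithful E.functor).whiskeringRight C).isoEquiv).trans
    (Iso.isoCongr (Functor.isoWhiskerLeft (E.zpow a) (E.zpowSucc b))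
      (E.zpowSucc' (a + b) (a + (b + 1)) (by omega)))

theorem exists_zpowAdd (a : ℤ) : ∃ s : ∀ b, (E.zpow a ⋙ E.zpow b ≅ E.zpow (a + b)),
    s 0 = eqToIso (by rw [add_zero]; rfl) ∧ ∀ b, s (b + 1) = E.zpowAddEquiv a b (s b) :=
  Int.exists_section _ _

/-- The isomorphisms `Eᵃ ⋙ Eᵇ ≅ Eᶜ` for `a + b = c`. -/
noncomputable def zpowAdd (a b c : ℤ) (h : a + b = c) : E.zpow a ⋙ E.zpow b ≅ E.zpow c :=
  (E.exists_zpowAdd a).choose b ≪≫ eqToIso (by rw [h])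

theorem zpowAdd_zero (a : ℤ) (X : C) :
    (E.zpowAdd a 0 a (add_zero a)).hom.app X = 𝟙 _ := by
  simp [zpowAdd, (E.exists_zpowAdd a).choose_spec.1]
  rfl

theorem zpowSucc'_app_zpowAdd (a b c b' c' : ℤ) (h : a + b = c) (hb : b + 1 = b')
    (hc : c + 1 = c') (X : C) :
    (E.zpowSucc' b b' hb).hom.app ((E.zpow a).obj X) ≫
        (E.zpowAdd a b' c' (by omega)).hom.app X =
      E.functor.map ((E.zpowAdd a b c h).hom.app X) ≫ (E.zpowSucc' c c' hc).hom.app X := by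
  subst h hb
  obtain rfl : c' = a + (b + 1) := by omega
  have key : ((E.exists_zpowAdd a).choose (b + 1)).hom.app X =
      (E.zpowSucc b).inv.app ((E.zpow a).obj X) ≫
        E.functor.map (((E.exists_zpowAdd a).choose b).hom.app X) ≫
          (E.zpowSucc' (a + b) (a + (b + 1)) hc).hom.app X := by
    rw [(E.exists_zpowAdd a).choose_spec.2 b]
    rfl
  simp [zpowAdd, key, zpowSucc']

theorem zpowSucc'_naturality (n m : ℤ) (h : n + 1 = m) {X Y : C} (f : X ⟶ Y) :
    (E.zpowSucc' n m h).hom.app X ≫ (E.zpow m).map f =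
      E.functor.map ((E.zpow n).map f) ≫ (E.zpowSucc' n m h).hom.app Y :=
  ((E.zpowSucc' n m h).hom.naturality f).symm

theorem zpowAdd_assoc (a b c ab bc abc : ℤ) (hab : a + b = ab) (hbc : b + c = bc)
    (h : ab + c = abc) (X : C) :
    (E.zpow c).map ((E.zpowAdd a b ab hab).hom.app X) ≫ (E.zpowAdd ab c abc h).hom.app X =
      (E.zpowAdd b c bc hbc).hom.app ((E.zpow a).obj X) ≫
        (E.zpowAdd a bc abc (by omega)).hom.app X := by
  revert bc abc
  induction c using Int.induction_of_iff with
  | h₀ => 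
    intro bc abc hbc h
    obtain rfl : b = bc := by omega
    obtain rfl : ab = abc := by omega
    erw [zpowAdd_zero, zpowAdd_zero, Category.id_comp, Category.comp_id]
    rfl
  | h c =>
    have key : ∀ bc abc hbc h, 
      ((E.zpow c).map ((E.zpowAdd a b ab hab).hom.app X) ≫ (E.zpowAdd ab c abc h).hom.app X =
      (E.zpowAdd b c bc hbc).hom.app ((E.zpow a).obj X) ≫
        (E.zpowAdd a bc abc (by omega)).hom.app X ↔
      (E.zpow (c+1)).map ((E.zpowAdd a b ab hab).hom.app X) ≫ 
        (E.zpowAdd ab (c+1) (abc + 1) (by omega)).hom.app X =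
      (E.zpowAdd b (c+1) (bc+1) (by omega)).hom.app ((E.zpow a).obj X) ≫
        (E.zpowAdd a (bc+1) (abc+1) (by omega)).hom.app X) := by
      intro bc abc hbc h
      rw [← cancel_epi ((E.zpowSucc' c (c+1) rfl).hom.app ((E.zpow b).obj ((E.zpow a).obj X))),
        ← Category.assoc, ← Category.assoc]
      erw [E.zpowSucc'_naturality, E.zpowSucc'_app_zpowAdd b c bc _ _ hbc rfl rfl]
      rw [Category.assoc, Category.assoc]
      erw [E.zpowSucc'_app_zpowAdd ab c abc _ _ h rfl rfl,
        E.zpowSucc'_app_zpowAdd a bc abc _ _ (by omega) rfl rfl]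
      rw [← Category.assoc, ← Category.assoc, ← Functor.map_comp]
      erw [← Functor.map_comp]
      rw [cancel_mono]
      exact E.functor.map_injective.eq_iff.symm
    constructor
    · intro H bc abc hbc h
      obtain ⟨bc, rfl⟩ : ∃ k, bc = k + 1 := ⟨bc - 1, by omega⟩
      obtain ⟨abc, rfl⟩ : ∃ k, abc = k + 1 := ⟨abc - 1, by omega⟩
      exact (key bc abc (by omega) (by omega)).1 (H _ _ _ _)
    · intro H bc abc hbc h
      exact (key bc abc (by omega) (by omega)).2 (H _ _ _ _)

/-- The isomorphism `E⁰ ≅ 𝟭`. -/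
def zpowZero : E.zpow 0 ≅ 𝟭 C := Iso.refl _

theorem zpowAdd_zero_left (n : ℤ) (X : C) :
    (E.zpowAdd 0 n n (zero_add n)).hom.app X = (E.zpow n).map (E.zpowZero.hom.app X) := by
  induction n using Int.induction_of_iff with
  | h₀ => exact E.zpowAdd_zero 0 X
  | h n =>
    rw [← cancel_epi ((E.zpowSucc' n (n + 1) rfl).hom.app ((E.zpow 0).obj X)),
      E.zpowSucc'_naturality,
      E.zpowSucc'_app_zpowAdd 0 n n _ _ (by omega) rfl rfl]
    erw [cancel_mono]
    exact E.functor.map_injective.eq_iff.symm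

theorem zpowAdd_eqToHom (a b c d : ℤ) (h : a + b = c) (hd : c = d) (X : C) :
    (E.zpowAdd a b c h).hom.app X ≫ eqToHom (by rw [hd]) =
      (E.zpowAdd a b d (by omega)).hom.app X := by
  subst hd
  simp

/-- The shift by `ℤ` such that the shift by `1` is a given autoequivalence. -/
noncomputable def shiftMkCore : ShiftMkCore C ℤ where
  F := E.zpow
  zero := E.zpowZero
  add a b := (E.zpowAdd a b (a + b) rfl).symm
  assoc_hom_app a b c X := by
    have h₁ := E.zpowAdd_assoc a b c _ _ _ rfl rfl rfl X
    have h₂ := E.zpowAdd_eqToHom a (b + c) (a + (b + c)) (a + b + c) rfl (by omega) X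
    dsimp only [Iso.symm_hom]
    rw [← cancel_epi ((E.zpow c).map ((E.zpowAdd a b (a + b) rfl).hom.app X) ≫
      (E.zpowAdd (a + b) c _ rfl).hom.app X)]
    nth_rw 2 [h₁]
    rw [← h₂]
    simp [← Functor.map_comp]
  zero_add_hom_app n X := by
    have h₁ := E.zpowAdd_eqToHom 0 n (0 + n) n rfl (by omega) X
    rw [E.zpowAdd_zero_left] at h₁
    dsimp only [Iso.symm_hom]
    rw [← cancel_epi ((E.zpowAdd 0 n (0 + n) rfl).hom.app X), reassoc_of% h₁, ← Functor.map_comp]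
    simp
  add_zero_hom_app n X := by
    have h₁ := E.zpowAdd_eqToHom n 0 (n + 0) n rfl (by omega) X
    rw [E.zpowAdd_zero] at h₁
    dsimp only [Iso.symm_hom]
    rw [← cancel_epi ((E.zpowAdd n 0 (n + 0) rfl).hom.app X), reassoc_of% h₁]
    simp [zpowZero]
    exact (Category.id_comp _).symm

theorem iter_additive [Preadditive C] (G : C ⥤ C) [G.Additive] : ∀ k : ℕ, (iter G k).Additive
  | 0 => inferInstanceAs (𝟭 C).Additive
  | k + 1 =>
    have := iter_additive G k
    inferInstanceAs (iter G k ⋙ G).Additive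

theorem zpow_additive [Preadditive C] [E.functor.Additive] : ∀ n : ℤ, (E.zpow n).Additive
  | Int.ofNat k => iter_additive E.functor k
  | Int.negSucc k => iter_additive E.inverse (k + 1)

end CategoryTheory.Equivalence

namespace CategoryTheory.Functor.CommShift

variable {C : Type u₁} [Category.{v₁} C] [HasShift C ℤ] {D : Type u₂} [Category.{v₂} D]
  [HasShift D ℤ] (F : C ⥤ D)

theorem isoAdd'_bijective {a b c : ℤ} (h : a + b = c)
    (e₂ : shiftFunctor C b ⋙ F ≅ F ⋙ shiftFunctor D b) :
    Function.Bijective (fun e₁ : shiftFunctor C a ⋙ F ≅ F ⋙ shiftFunctor D a =>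
      isoAdd' h e₁ e₂) := by
  let left : shiftFunctor C c ⋙ F ≅ (shiftFunctor C a ⋙ F) ⋙ shiftFunctor D b :=
    isoWhiskerRight (shiftFunctorAdd' C _ _ _ h) F ≪≫ Functor.associator _ _ _ ≪≫
      isoWhiskerLeft _ e₂ ≪≫ (Functor.associator _ _ _).symm
  let right : (F ⋙ shiftFunctor D a) ⋙ shiftFunctor D b ≅ F ⋙ shiftFunctor D c :=
    Functor.associator _ _ _ ≪≫ isoWhiskerLeft _ (shiftFunctorAdd' D _ _ _ h).symm
  convert ((((FullyFaithful.ofFullyFaithful (shiftFunctor D b)).whiskeringRight C).isoEquiv).trans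
    (Iso.isoCongr left.symm right)).bijective using 1
  ext e X
  simp [left, right]
  rfl

/-- A functor that commutes with the shift by `1` commutes with the shifts by all integers. -/
theorem exists_of_one (e : shiftFunctor C (1 : ℤ) ⋙ F ≅ F ⋙ shiftFunctor D (1 : ℤ)) :
    ∃ h : F.CommShift ℤ, h.commShiftIso (1 : ℤ) = e := by
  obtain ⟨s, hs₀, hs⟩ := Int.exists_section
    (fun n => Equiv.ofBijective _ (isoAdd'_bijective F (rfl : n + 1 = _) e)) (isoZero F ℤ)
  replace hs : ∀ n m (h : n + 1 = m), s m = isoAdd' h (s n) e := by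
    rintro n _ rfl
    exact hs n
  have hs₁ : s 1 = e := by rw [hs 0 1 rfl, hs₀, isoZero_isoAdd'_]
  have add (a b : ℤ) : ∀ c (h : a + b = c), s c = isoAdd' h (s a) (s b) := by
    induction b using Int.induction_of_iff with
    | h₀ =>
      intro c h
      obtain rfl : a = c := by omega
      rw [hs₀, isoAdd'_isoZero]
    | h b =>
      have key (c : ℤ) (h : a + b = c) : s (c + 1) = isoAdd' (by omega) (s a) (s (b + 1)) ↔
          s c = isoAdd' h (s a) (s b) := by
        rw [hs b _ rfl, hs c _ rfl, ← isoAdd'_assoc _ _ _ h rfl (by omega)]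
        exact (isoAdd'_bijective F rfl e).1.eq_iff
      refine ⟨fun H c h => ?_, fun H c h => (key c h).1 (H _ _)⟩
      obtain ⟨c, rfl⟩ : ∃ k, c = k + 1 := ⟨c - 1, by omega⟩
      exact (key c (by omega)).2 (H _ _)
  exact ⟨⟨s, hs₀, fun a b => add a b _ rfl⟩, hs₁⟩

end CategoryTheory.Functor.CommShift

instance toStable_additive {𝒜 : Type u} [Category.{v} 𝒜] [Preadditive 𝒜] (P : ObjectProperty 𝒜) :
    (toStable P).Additive where

section

variable {𝒜 : Type u} [Category.{v} 𝒜] [Abelian 𝒜]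

namespace CategoryTheory.ShortComplex.ShortExact

variable {X Y Z : 𝒜} {f : X ⟶ Y} {g : Y ⟶ Z}

theorem of_desc (w : f ≫ g = 0) [Mono f] [Epi g]
    (h : ∀ {D : 𝒜} (k : Y ⟶ D), f ≫ k = 0 → ∃ l : Z ⟶ D, g ≫ l = k) :
    (ShortComplex.mk f g w).ShortExact where
  exact := (ShortComplex.mk f g w).exact_of_g_is_cokernel (CokernelCofork.IsColimit.ofπ' g w
    (fun k hk => ⟨(h k hk).choose, (h k hk).choose_spec⟩))

theorem of_lift (w : f ≫ g = 0) [Mono f] [Epi g]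
    (h : ∀ {D : 𝒜} (k : D ⟶ Y), k ≫ g = 0 → ∃ l : D ⟶ X, l ≫ f = k) :
    (ShortComplex.mk f g w).ShortExact where
  exact := (ShortComplex.mk f g w).exact_of_f_is_kernel (KernelFork.IsLimit.ofι' f w
    (fun k hk => ⟨(h k hk).choose, (h k hk).choose_spec⟩))

theorem exists_desc {w : f ≫ g = 0} (hS : (ShortComplex.mk f g w).ShortExact) {D : 𝒜}
    (k : Y ⟶ D) (hk : f ≫ k = 0) : ∃ l, g ≫ l = k :=
  ⟨hS.gIsCokernel.desc (CokernelCofork.ofπ k hk),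
    hS.gIsCokernel.fac (CokernelCofork.ofπ k hk) WalkingParallelPair.one⟩

theorem exists_lift {w : f ≫ g = 0} (hS : (ShortComplex.mk f g w).ShortExact) {D : 𝒜}
    (k : D ⟶ Y) (hk : k ≫ g = 0) : ∃ l, l ≫ f = k :=
  ⟨hS.fIsKernel.lift (KernelFork.ofι k hk),
    hS.fIsKernel.fac (KernelFork.ofι k hk) WalkingParallelPair.zero⟩

theorem of_mono {X Y : 𝒜} (f : X ⟶ Y) [Mono f] :
    (ShortComplex.mk f (cokernel.π f) (cokernel.condition f)).ShortExact where
  exact := ShortComplex.exact_cokernel f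

theorem of_epi {X Y : 𝒜} (f : X ⟶ Y) [Epi f] :
    (ShortComplex.mk (kernel.ι f) f (kernel.condition f)).ShortExact where
  exact := ShortComplex.exact_kernel f

end CategoryTheory.ShortComplex.ShortExact

variable {P : ObjectProperty 𝒜}

/-! ## Conflations -/

namespace IsConflation

variable {S S' : ShortComplex P.FullSubcategory} (hS : IsConflation S) (hS' : IsConflation S')

include hS

theorem mono : Mono S.f.hom := hS.mono_f

theorem epi : Epi S.g.hom := hS.epi_g

theorem mono_f : Mono S.f := have : Mono (P.ι.map S.f) := hS.mono; P.ι.mono_of_mono_map this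

theorem epi_g : Epi S.g := have : Epi (P.ι.map S.g) := hS.epi; P.ι.epi_of_epi_map this

theorem exists_desc {D : P.FullSubcategory} (k : S.X₂ ⟶ D) (hk : S.f ≫ k = 0) :
    ∃ l, S.g ≫ l = k := by
  obtain ⟨l, hl⟩ := ShortComplex.ShortExact.exists_desc (w := congr_arg (·.hom) S.zero) hS k.hom (congr_arg (·.hom) hk)
  exact ⟨ObjectProperty.homMk l, by ext; exact hl⟩

theorem exists_lift {D : P.FullSubcategory} (k : D ⟶ S.X₂) (hk : k ≫ S.g = 0) :
    ∃ l, l ≫ S.f = k := by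
  obtain ⟨l, hl⟩ := ShortComplex.ShortExact.exists_lift (w := congr_arg (·.hom) S.zero) hS k.hom (congr_arg (·.hom) hk)
  exact ⟨ObjectProperty.homMk l, by ext; exact hl⟩

theorem exists_extension {I : P.FullSubcategory} (hI : relInjective P I.obj) (a : S.X₁ ⟶ I) :
    ∃ b, S.f ≫ b = a := by
  obtain ⟨b, hb⟩ := hI.2 _ hS S.X₁.property S.X₂.property S.X₃.property a.hom
  exact ⟨ObjectProperty.homMk b, by ext; exact hb⟩

theorem exists_lifting {Q : P.FullSubcategory} (hQ : relProjective P Q.obj) (a : Q ⟶ S.X₃) :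
    ∃ b, b ≫ S.g = a := by
  obtain ⟨b, hb⟩ := hQ.2 _ hS S.X₁.property S.X₂.property S.X₃.property a.hom
  exact ⟨ObjectProperty.homMk b, by ext; exact hb⟩

/-- A commutative square extends to a morphism of conflations. -/
theorem exists_hom_of_left (a : S.X₁ ⟶ S'.X₁) (b : S.X₂ ⟶ S'.X₂) (h : S.f ≫ b = a ≫ S'.f) :
    ∃ φ : S ⟶ S', φ.τ₁ = a ∧ φ.τ₂ = b := by
  obtain ⟨c, hc⟩ := hS.exists_desc (b ≫ S'.g) (by rw [reassoc_of% h, S'.zero, comp_zero])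
  exact ⟨{ τ₁ := a, τ₂ := b, τ₃ := c, comm₁₂ := h.symm, comm₂₃ := hc.symm }, rfl, rfl⟩

omit hS in
include hS' in
theorem exists_hom_of_right (b : S.X₂ ⟶ S'.X₂) (c : S.X₃ ⟶ S'.X₃) (h : S.g ≫ c = b ≫ S'.g) :
    ∃ φ : S ⟶ S', φ.τ₂ = b ∧ φ.τ₃ = c := by
  obtain ⟨a, ha⟩ := hS'.exists_lift (S.f ≫ b) (by rw [Category.assoc, ← h, ← Category.assoc, S.zero, zero_comp])
  exact ⟨{ τ₁ := a, τ₂ := b, τ₃ := c, comm₁₂ := ha, comm₂₃ := h.symm }, rfl, rfl⟩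

theorem exists_hom_extending (hI : relInjective P S'.X₂.obj) (a : S.X₁ ⟶ S'.X₁) :
    ∃ φ : S ⟶ S', φ.τ₁ = a := by
  obtain ⟨b, hb⟩ := hS.exists_extension hI (a ≫ S'.f)
  obtain ⟨φ, h, -⟩ := hS.exists_hom_of_left a b hb
  exact ⟨φ, h⟩

omit hS in
include hS' in
theorem exists_hom_lifting (hQ : relProjective P S.X₂.obj) (c : S.X₃ ⟶ S'.X₃) :
    ∃ φ : S ⟶ S', φ.τ₃ = c := by
  obtain ⟨b, hb⟩ := hS'.exists_lifting hQ (S.g ≫ c)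
  obtain ⟨φ, -, h⟩ := hS'.exists_hom_of_right b c hb.symm
  exact ⟨φ, h⟩

end IsConflation

/-! ## Morphisms in the stable category -/

theorem toStable_map_eq_zero_of_left {X Y : P.FullSubcategory} (hX : relProjective P X.obj)
    (f : X ⟶ Y) : (toStable P).map f = 0 := by
  rw [← (toStable P).map_zero, CategoryTheory.Quotient.functor_map_eq_iff]
  have : f ∈ stableIdeal P X Y := AddSubgroup.subset_closure ⟨X, 𝟙 X, f, hX, Category.id_comp f⟩
  simpa [stableRel] using this

theorem toStable_map_eq_zero_of_right {X Y : P.FullSubcategory} (hY : relProjective P Y.obj)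
    (f : X ⟶ Y) : (toStable P).map f = 0 := by
  rw [← (toStable P).map_zero, CategoryTheory.Quotient.functor_map_eq_iff]
  have : f ∈ stableIdeal P X Y := AddSubgroup.subset_closure ⟨Y, f, 𝟙 Y, hY, Category.comp_id f⟩
  simpa [stableRel] using this

variable [P.IsClosedUnderExtensions] [P.ContainsZero]

theorem toStable_map_eq_iff {X Y : P.FullSubcategory} (f g : X ⟶ Y) :
    (toStable P).map f = (toStable P).map g ↔ ∃ (Q : P.FullSubcategory) (a : X ⟶ Q) (b : Q ⟶ Y),
      relProjective P Q.obj ∧ a ≫ b = f - g := by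
  rw [CategoryTheory.Quotient.functor_map_eq_iff, stableRel, mem_stableIdeal_iff]

theorem isZero_toStable_obj_of_relProjective {X : P.FullSubcategory}
    (hX : relProjective P X.obj) : IsZero ((toStable P).obj X) := by
  rw [IsZero.iff_id_eq_zero, ← (toStable P).map_id]
  exact toStable_map_eq_zero_of_left hX _

/-- The object `X ⊞ Y` of `P`. -/
noncomputable def ObjectProperty.biprodObj (X Y : P.FullSubcategory) : P.FullSubcategory :=
  ⟨X.obj ⊞ Y.obj, P.prop_biprod X.property Y.property⟩

/-! ## The suspension -/

namespace IsFrobenius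

variable (hP : IsFrobenius P) {S S' : ShortComplex P.FullSubcategory}

include hP

theorem relInjective_of_relProjective {X : 𝒜} (hX : relProjective P X) : relInjective P X :=
  (hP.injective_iff_projective X).2 hX

theorem relProjective_of_relInjective {X : 𝒜} (hX : relInjective P X) : relProjective P X :=
  (hP.injective_iff_projective X).1 hX

theorem exists_injective_conflation (X : P.FullSubcategory) :
    ∃ (I T : P.FullSubcategory) (i : X ⟶ I) (p : I ⟶ T) (w : i ≫ p = 0),
      IsConflation (ShortComplex.mk i p w) ∧ relInjective P I.obj := by
  obtain ⟨I, T, i, p, w, h, hI, hT⟩ := hP.enoughInjectives X.obj X.property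
  exact ⟨⟨I, hI.1⟩, ⟨T, hT⟩, ObjectProperty.homMk i, ObjectProperty.homMk p, by ext; exact w, h, hI⟩

theorem exists_projective_conflation (X : P.FullSubcategory) :
    ∃ (K Q : P.FullSubcategory) (i : K ⟶ Q) (p : Q ⟶ X) (w : i ≫ p = 0),
      IsConflation (ShortComplex.mk i p w) ∧ relProjective P Q.obj := by
  obtain ⟨K, Q, i, p, w, h, hK, hQ⟩ := hP.enoughProjectives X.obj X.property
  exact ⟨⟨K, hK⟩, ⟨Q, hQ.1⟩, ObjectProperty.homMk i, ObjectProperty.homMk p, by ext; exact w, h, hQ⟩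

theorem toStable_map_τ₃_eq (hS : IsConflation S)
    (hI : relInjective P S'.X₂.obj) {φ ψ : S ⟶ S'}
    (h : (toStable P).map φ.τ₁ = (toStable P).map ψ.τ₁) :
    (toStable P).map φ.τ₃ = (toStable P).map ψ.τ₃ := by
  obtain ⟨Q, a, b, hQ, hab⟩ := (toStable_map_eq_iff _ _).1 h
  obtain ⟨c, hc⟩ := hS.exists_extension (hP.relInjective_of_relProjective hQ) a
  obtain ⟨k, hk⟩ := hS.exists_desc (φ.τ₂ - ψ.τ₂ - c ≫ b ≫ S'.f) (by
    rw [Preadditive.comp_sub, Preadditive.comp_sub, reassoc_of% hc, reassoc_of% hab,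
      ← φ.comm₁₂, ← ψ.comm₁₂, Preadditive.sub_comp, sub_self])
  have := hS.epi_g
  refine (toStable_map_eq_iff _ _).2
    ⟨S'.X₂, k, S'.g, hP.relProjective_of_relInjective hI, ?_⟩
  rw [← cancel_epi S.g, reassoc_of% hk]
  simp [Preadditive.comp_sub, φ.comm₂₃, ψ.comm₂₃]

theorem toStable_map_τ₁_eq (hS' : IsConflation S')
    (hQ : relProjective P S.X₂.obj) {φ ψ : S ⟶ S'}
    (h : (toStable P).map φ.τ₃ = (toStable P).map ψ.τ₃) :
    (toStable P).map φ.τ₁ = (toStable P).map ψ.τ₁ := by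
  obtain ⟨Q, a, b, hQ', hab⟩ := (toStable_map_eq_iff _ _).1 h
  obtain ⟨c, hc⟩ := hS'.exists_lifting hQ' b
  obtain ⟨k, hk⟩ := hS'.exists_lift (φ.τ₂ - ψ.τ₂ - S.g ≫ a ≫ c) (by
    rw [Preadditive.sub_comp, Preadditive.sub_comp, Category.assoc, Category.assoc, hc, hab,
      φ.comm₂₃, ψ.comm₂₃, Preadditive.comp_sub, sub_self])
  have := hS'.mono_f
  refine (toStable_map_eq_iff _ _).2 ⟨S.X₂, S.f, k, hQ, ?_⟩
  rw [← cancel_mono S'.f, Category.assoc, hk]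
  simp [Preadditive.comp_sub, φ.comm₁₂, ψ.comm₁₂]

end IsFrobenius
end

namespace IsFrobenius

variable {𝒜 : Type u} [Category.{v} 𝒜] [Abelian 𝒜] {P : ObjectProperty 𝒜}
  [P.IsClosedUnderExtensions] [P.ContainsZero] (hP : IsFrobenius P)

/-- A chosen object `T` in a conflation `0 ⟶ X ⟶ I ⟶ T ⟶ 0` with `I` injective. -/
noncomputable def cosyzygy (X : P.FullSubcategory) : P.FullSubcategory :=
  (hP.exists_injective_conflation X).choose_spec.choose

/-- A chosen conflation `0 ⟶ X ⟶ I ⟶ T ⟶ 0` with `I` injective. -/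
noncomputable abbrev hull (X : P.FullSubcategory) : ShortComplex P.FullSubcategory where
  X₁ := X
  X₂ := (hP.exists_injective_conflation X).choose
  X₃ := hP.cosyzygy X
  f := (hP.exists_injective_conflation X).choose_spec.choose_spec.choose
  g := (hP.exists_injective_conflation X).choose_spec.choose_spec.choose_spec.choose
  zero := (hP.exists_injective_conflation X).choose_spec.choose_spec.choose_spec.choose_spec.choose

theorem hull_isConflation (X : P.FullSubcategory) : IsConflation (hP.hull X) :=
  (hP.exists_injective_conflation X).choose_spec.choose_spec.choose_spec.choose_spec.choose_spec.1

theorem hull_injective (X : P.FullSubcategory) : relInjective P (hP.hull X).X₂.obj :=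
  (hP.exists_injective_conflation X).choose_spec.choose_spec.choose_spec.choose_spec.choose_spec.2

theorem exists_hom_hull {S : ShortComplex P.FullSubcategory} (hS : IsConflation S)
    {Y : P.FullSubcategory} (a : S.X₁ ⟶ Y) : ∃ φ : S ⟶ hP.hull Y, φ.τ₁ = a :=
  hS.exists_hom_extending (hP.hull_injective Y) a

/-- A morphism of conflations from `S` to the chosen conflation starting with `Y`. -/
noncomputable def toHull {S : ShortComplex P.FullSubcategory} (hS : IsConflation S)
    {Y : P.FullSubcategory} (a : S.X₁ ⟶ Y) : S ⟶ hP.hull Y :=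
  (hP.exists_hom_hull hS a).choose

@[simp]
theorem toHull_τ₁ {S : ShortComplex P.FullSubcategory} (hS : IsConflation S)
    {Y : P.FullSubcategory} (a : S.X₁ ⟶ Y) : (hP.toHull hS a).τ₁ = a :=
  (hP.exists_hom_hull hS a).choose_spec

theorem toStable_map_toHull_τ₃ {S : ShortComplex P.FullSubcategory} (hS : IsConflation S)
    {Y : P.FullSubcategory} (a : S.X₁ ⟶ Y) (φ : S ⟶ hP.hull Y)
    (h : (toStable P).map φ.τ₁ = (toStable P).map a) :
    (toStable P).map (hP.toHull hS a).τ₃ = (toStable P).map φ.τ₃ :=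
  hP.toStable_map_τ₃_eq hS (hP.hull_injective Y) (by rw [h, toHull_τ₁])

/-- The functor `P ⥤ St P` given by the suspension. -/
noncomputable abbrev preSuspension : P.FullSubcategory ⥤ StableCategory P where
  obj X := (toStable P).obj (hP.cosyzygy X)
  map {X _} f := (toStable P).map (hP.toHull (hP.hull_isConflation X) f).τ₃
  map_id X := by
    rw [hP.toStable_map_toHull_τ₃ (hP.hull_isConflation X) (𝟙 X) (𝟙 (hP.hull X)) rfl]
    exact (toStable P).map_id _
  map_comp {X Y Z} f g := by
    rw [← Functor.map_comp]
    exact hP.toStable_map_toHull_τ₃ (hP.hull_isConflation X) (f ≫ g)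
      (hP.toHull (hP.hull_isConflation X) f ≫ hP.toHull (hP.hull_isConflation Y) g) (by simp)

/-- The suspension functor of the stable category. -/
noncomputable abbrev suspension : StableCategory P ⥤ StableCategory P :=
  CategoryTheory.Quotient.lift _ hP.preSuspension (fun X Y f g h => by
    refine hP.toStable_map_toHull_τ₃ (hP.hull_isConflation X) f _ ?_
    rw [toHull_τ₁]
    exact (CategoryTheory.Quotient.sound _ h).symm)

theorem suspension_map {X Y : P.FullSubcategory} (φ : hP.hull X ⟶ hP.hull Y) :
    hP.suspension.map ((toStable P).map φ.τ₁) = (toStable P).map φ.τ₃ :=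
  hP.toStable_map_toHull_τ₃ (hP.hull_isConflation X) φ.τ₁ φ rfl

/-- The morphism `S.X₃ ⟶ Σ S.X₁` attached to a conflation `S`. -/
noncomputable def connecting {S : ShortComplex P.FullSubcategory} (hS : IsConflation S) :
    (toStable P).obj S.X₃ ⟶ hP.suspension.obj ((toStable P).obj S.X₁) :=
  (toStable P).map (hP.toHull hS (𝟙 S.X₁)).τ₃

theorem connecting_naturality {S S' : ShortComplex P.FullSubcategory} (hS : IsConflation S)
    (hS' : IsConflation S') (φ : S ⟶ S') :
    (toStable P).map φ.τ₃ ≫ hP.connecting hS' =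
      hP.connecting hS ≫ hP.suspension.map ((toStable P).map φ.τ₁) := by
  have h : hP.suspension.map ((toStable P).map φ.τ₁) =
    (toStable P).map (hP.toHull (hP.hull_isConflation S.X₁) φ.τ₁).τ₃ := rfl
  rw [h]
  simp only [connecting]
  rw [← Functor.map_comp]
  erw [← Functor.map_comp]
  exact hP.toStable_map_τ₃_eq hS (hP.hull_injective _)
    (φ := φ ≫ hP.toHull hS' (𝟙 _))
    (ψ := hP.toHull hS (𝟙 _) ≫ hP.toHull (hP.hull_isConflation S.X₁) φ.τ₁) (by simp)

theorem connecting_hull (X : P.FullSubcategory) : 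
    hP.connecting (hP.hull_isConflation X) = 𝟙 _ := by
  refine (hP.toStable_map_toHull_τ₃ (hP.hull_isConflation X) (𝟙 X) (𝟙 (hP.hull X)) rfl).trans ?_
  exact (toStable P).map_id _

theorem isIso_connecting {S : ShortComplex P.FullSubcategory} (hS : IsConflation S)
    (hI : relInjective P S.X₂.obj) : IsIso (hP.connecting hS) := by
  obtain ⟨φ, hφ⟩ := (hP.hull_isConflation S.X₁).exists_hom_extending hI (𝟙 _)
  refine ⟨(toStable P).map φ.τ₃, ?_, ?_⟩
  · simp only [connecting]
    rw [← Functor.map_comp, ← CategoryTheory.Functor.map_id]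
    exact hP.toStable_map_τ₃_eq hS hI (φ := hP.toHull hS (𝟙 _) ≫ φ) (ψ := 𝟙 S) (by simp [hφ])
  · rw [connecting_naturality (hS := hP.hull_isConflation S.X₁), connecting_hull, hφ]
    rw [CategoryTheory.Functor.map_id, CategoryTheory.Functor.map_id]
    exact Category.id_comp _

instance suspension_additive : hP.suspension.Additive where
  map_add {X Y f g} := by
    obtain ⟨f, rfl⟩ := (toStable P).map_surjective f
    obtain ⟨g, rfl⟩ := (toStable P).map_surjective g
    let φ := hP.toHull (hP.hull_isConflation X.as) f
    let ψ := hP.toHull (hP.hull_isConflation X.as) g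
    have := hP.suspension_map (φ + ψ)
    simp only [ShortComplex.add_τ₁, ShortComplex.add_τ₃, Functor.map_add, φ, ψ, toHull_τ₁] at this
    exact this

instance suspension_faithful : hP.suspension.Faithful where
  map_injective {X Y f g} h := by
    obtain ⟨f, rfl⟩ := (toStable P).map_surjective f
    obtain ⟨g, rfl⟩ := (toStable P).map_surjective g
    have := hP.toStable_map_τ₁_eq (hP.hull_isConflation Y.as)
      (hP.relProjective_of_relInjective (hP.hull_injective X.as))
      (φ := hP.toHull (hP.hull_isConflation X.as) f) (ψ := hP.toHull (hP.hull_isConflation X.as) g) h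
    simpa using this

instance suspension_full : hP.suspension.Full where
  map_surjective {X Y} f := by
    obtain ⟨f, rfl⟩ := (toStable P).map_surjective f
    obtain ⟨φ, hφ⟩ := (hP.hull_isConflation Y.as).exists_hom_lifting
      (S := hP.hull X.as) (hP.relProjective_of_relInjective (hP.hull_injective X.as)) f
    exact ⟨(toStable P).map φ.τ₁, by rw [← hφ]; exact hP.suspension_map φ⟩

instance suspension_essSurj : hP.suspension.EssSurj where
  mem_essImage X := by
    obtain ⟨K, Q, i, p, w, h, hQ⟩ := hP.exists_projective_conflation X.as
    have := hP.isIso_connecting h (hP.relInjective_of_relProjective hQ)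
    exact ⟨(toStable P).obj K, ⟨(asIso (hP.connecting h)).symm⟩⟩

instance suspension_isEquivalence : hP.suspension.IsEquivalence where

end IsFrobenius

section Shift

variable {𝒜 : Type u} [Category.{v} 𝒜] [Abelian 𝒜] (P : ObjectProperty 𝒜)
  [P.IsClosedUnderExtensions] [P.ContainsZero] [hP : Fact (IsFrobenius P)]

/-- The shift on the stable category. -/
@[reducible]
noncomputable def stableHasShift : HasShift (StableCategory P) ℤ :=
  hasShiftMk _ _ hP.out.suspension.asEquivalence.shiftMkCore

attribute [local instance] stableHasShift

theorem stable_shift_additive (n : ℤ) : (shiftFunctor (StableCategory P) n).Additive :=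
  have : hP.out.suspension.asEquivalence.functor.Additive := hP.out.suspension_additive
  hP.out.suspension.asEquivalence.zpow_additive n

theorem stable_hasZeroObject : HasZeroObject (StableCategory P) := by
  obtain ⟨Z, hZ, hPZ⟩ := P.exists_prop_of_containsZero
  exact ⟨(toStable P).obj ⟨Z, hPZ⟩, isZero_toStable_obj_of_relProjective
    ⟨hPZ, fun S _ _ _ _ g => ⟨0, hZ.eq_of_src _ _⟩⟩⟩

attribute [local instance] stable_shift_additive stable_hasZeroObject

/-- The shift by `1` is the suspension. -/
noncomputable def shiftOneIso : hP.out.suspension ≅ shiftFunctor (StableCategory P) (1 : ℤ) :=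
  Iso.refl _

variable {P}

/-- The morphism `S.X₃ ⟶ S.X₁⟦1⟧` attached to a conflation `S`. -/
noncomputable def conn {S : ShortComplex P.FullSubcategory} (hS : IsConflation S) :
    (toStable P).obj S.X₃ ⟶ ((toStable P).obj S.X₁)⟦(1 : ℤ)⟧ :=
  hP.out.connecting hS ≫ (shiftOneIso P).hom.app _

theorem conn_naturality {S S' : ShortComplex P.FullSubcategory} (hS : IsConflation S)
    (hS' : IsConflation S') (φ : S ⟶ S') :
    (toStable P).map φ.τ₃ ≫ conn hS' = conn hS ≫ ((toStable P).map φ.τ₁)⟦(1 : ℤ)⟧' := by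
  simp only [conn]
  rw [reassoc_of% hP.out.connecting_naturality hS hS' φ, Category.assoc]
  congr 1
  exact (shiftOneIso P).hom.naturality _

theorem isIso_conn {S : ShortComplex P.FullSubcategory} (hS : IsConflation S)
    (hI : relInjective P S.X₂.obj) : IsIso (conn hS) := by
  have := hP.out.isIso_connecting hS hI
  exact IsIso.comp_isIso' this inferInstance

end Shift

section Triangles

variable {𝒜 : Type u} [Category.{v} 𝒜] [Abelian 𝒜] {P : ObjectProperty 𝒜}
  [P.IsClosedUnderExtensions] [P.ContainsZero] [hP : Fact (IsFrobenius P)]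

attribute [local instance] stableHasShift stable_shift_additive stable_hasZeroObject

/-- The standard triangle attached to a conflation. -/
noncomputable abbrev stdTriangle {S : ShortComplex P.FullSubcategory} (hS : IsConflation S) :
    Triangle (StableCategory P) :=
  Triangle.mk ((toStable P).map S.f) ((toStable P).map S.g) (conn hS)

variable (P) in
/-- The triangles isomorphic to a standard triangle. -/
def stableDistinguished : Set (Triangle (StableCategory P)) := fun T =>
  ∃ (S : ShortComplex P.FullSubcategory) (hS : IsConflation S), Nonempty (T ≅ stdTriangle hS)

theorem stdTriangle_mem {S : ShortComplex P.FullSubcategory} (hS : IsConflation S) :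
    stdTriangle hS ∈ stableDistinguished P := ⟨S, hS, ⟨Iso.refl _⟩⟩

theorem stableDistinguished_of_iso (T₁ : Triangle (StableCategory P))
    (h : T₁ ∈ stableDistinguished P) (T₂ : Triangle (StableCategory P)) (e : T₂ ≅ T₁) :
    T₂ ∈ stableDistinguished P := by
  obtain ⟨S, hS, ⟨e'⟩⟩ := h
  exact ⟨S, hS, ⟨e ≪≫ e'⟩⟩

theorem stable_contractible (X : StableCategory P) :
    contractibleTriangle X ∈ stableDistinguished P := by
  obtain ⟨Z, hZ, hPZ⟩ := P.exists_prop_of_containsZero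
  have hQ : relProjective P Z := ⟨hPZ, fun S _ _ _ _ g => ⟨0, hZ.eq_of_src _ _⟩⟩
  let Z' : P.FullSubcategory := ⟨Z, hPZ⟩
  let S : ShortComplex P.FullSubcategory := ShortComplex.mk (𝟙 X.as) (0 : _ ⟶ Z') (by simp)
  have hS : IsConflation S := by
    have : Epi (0 : X.as.obj ⟶ Z) := ⟨fun _ _ _ => hZ.eq_of_src _ _⟩
    exact ShortComplex.ShortExact.of_lift (f := 𝟙 X.as.obj) (g := (0 : X.as.obj ⟶ Z)) (by simp)
      (fun k _ => ⟨k, Category.comp_id k⟩)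
  have hz : IsZero ((toStable P).obj Z') := isZero_toStable_obj_of_relProjective hQ
  refine ⟨S, hS, ⟨Triangle.isoMk _ _ (Iso.refl _) (Iso.refl _) ((isZero_zero _).iso hz)
    ?_ ?_ ?_⟩⟩
  · simp [S]; rfl
  · exact hz.eq_of_tgt _ _
  · exact (isZero_zero _).eq_of_src _ _

theorem mem_stableDistinguished {S : ShortComplex P.FullSubcategory} (hS : IsConflation S)
    {X Y Z : StableCategory P} {f : X ⟶ Y} {g : Y ⟶ Z} {h : Z ⟶ X⟦(1 : ℤ)⟧}
    (e₁ : X ≅ (toStable P).obj S.X₁) (e₂ : Y ≅ (toStable P).obj S.X₂)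
    (e₃ : Z ≅ (toStable P).obj S.X₃) (comm₁ : f ≫ e₂.hom = e₁.hom ≫ (toStable P).map S.f)
    (comm₂ : g ≫ e₃.hom = e₂.hom ≫ (toStable P).map S.g)
    (comm₃ : h ≫ e₁.hom⟦(1 : ℤ)⟧' = e₃.hom ≫ conn hS) :
    Triangle.mk f g h ∈ stableDistinguished P :=
  ⟨S, hS, ⟨Triangle.isoMk _ _ e₁ e₂ e₃ comm₁ comm₂ comm₃⟩⟩

omit [P.ContainsZero] hP in
theorem prop_cokernel_biprod_lift {X Y I T : 𝒜} (f : X ⟶ Y) {i : X ⟶ I} {p : I ⟶ T}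
    {w : i ≫ p = 0} (hE : (ShortComplex.mk i p w).ShortExact) (hY : P Y) (hT : P T) :
    P (cokernel (biprod.lift f i)) := by
  have hi : Mono i := hE.mono_f
  have hp : Epi p := hE.epi_g
  have : Mono (biprod.lift f i) := mono_of_mono_fac (biprod.lift_snd f i)
  have w₁ : biprod.lift f i ≫ biprod.snd ≫ p = 0 := by simp [w]
  let q := cokernel.π (biprod.lift f i)
  let r : cokernel (biprod.lift f i) ⟶ T := cokernel.desc _ (biprod.snd ≫ p) w₁
  have hr : q ≫ r = biprod.snd ≫ p := cokernel.π_desc _ _ _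
  have : Mono (biprod.inl ≫ q) := by
    refine Preadditive.mono_of_cancel_zero _ (fun k hk => ?_)
    have hk' : (k ≫ biprod.inl) ≫ q = 0 := by simpa using hk
    obtain ⟨l, hl⟩ := (ShortComplex.ShortExact.of_mono (biprod.lift f i)).exists_lift _ hk'
    have h₂ : l ≫ i = 0 := by simpa using hl =≫ biprod.snd
    have hl₀ : l = 0 := by rwa [← cancel_mono i, zero_comp]
    simpa [hl₀] using (hl =≫ biprod.fst).symm
  have : Epi (q ≫ r) := by
    rw [hr]
    exact epi_comp _ _
  have : Epi r := epi_of_epi q _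
  refine P.prop_X₂_of_shortExact (ShortComplex.ShortExact.of_desc (f := biprod.inl ≫ q) (g := r)
    (by simp [hr]) (fun {D} k hk => ?_)) hY hT
  have h₁ : q ≫ k = biprod.snd ≫ biprod.inr ≫ q ≫ k := by
    ext <;> simp [← hk]
  obtain ⟨l, hl⟩ := hE.exists_desc (biprod.inr ≫ q ≫ k) (by
    have := cokernel.condition (biprod.lift f i) =≫ k
    rw [Category.assoc, h₁] at this
    simpa using this)
  refine ⟨l, ?_⟩
  rw [← cancel_epi q, h₁, ← hl, reassoc_of% hr]

/-- Every morphism of `P` becomes an inflation after adding an injective object to its target. -/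
theorem exists_inflation {X Y : P.FullSubcategory} (f : X ⟶ Y) :
    ∃ (W C : P.FullSubcategory) (j : X ⟶ W) (q : W ⟶ C) (w : j ≫ q = 0)
      (_ : IsConflation (ShortComplex.mk j q w))
      (e : (toStable P).obj Y ≅ (toStable P).obj W),
      (toStable P).map f ≫ e.hom = (toStable P).map j := by
  obtain ⟨I, T, i, p, w, hE, hI⟩ := hP.out.exists_injective_conflation X
  let W : P.FullSubcategory := ObjectProperty.biprodObj Y I
  have hi : Mono i.hom := hE.mono
  have : Mono (biprod.lift f.hom i.hom) := mono_of_mono_fac (biprod.lift_snd f.hom i.hom)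
  have hC : P (cokernel (biprod.lift f.hom i.hom)) :=
    prop_cokernel_biprod_lift f.hom hE Y.property T.property
  let j : X ⟶ W := ObjectProperty.homMk (biprod.lift f.hom i.hom)
  let C : P.FullSubcategory := ⟨_, hC⟩
  let q : W ⟶ C := ObjectProperty.homMk (cokernel.π (biprod.lift f.hom i.hom))
  have hI' := hP.out.relProjective_of_relInjective hI
  let fst : W ⟶ Y := ObjectProperty.homMk biprod.fst
  let snd : W ⟶ I := ObjectProperty.homMk biprod.snd
  let inl : Y ⟶ W := ObjectProperty.homMk biprod.inl
  let inr : I ⟶ W := ObjectProperty.homMk biprod.inr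
  have h₁ : fst ≫ inl + snd ≫ inr = 𝟙 W := by ext; exact biprod.total
  have h₂ : inl ≫ fst = 𝟙 Y := by ext; exact biprod.inl_fst
  have h₃ : f = j ≫ fst := by ext; exact (biprod.lift_fst _ _).symm
  have h₄ : (toStable P).map fst ≫ (toStable P).map inl = 𝟙 _ := by
    rw [← CategoryTheory.Functor.map_id, ← h₁, Functor.map_add, Functor.map_comp, Functor.map_comp,
      toStable_map_eq_zero_of_right hI' snd, zero_comp, add_zero]
  refine ⟨W, C, j, q, by ext; exact cokernel.condition _,
    ShortComplex.ShortExact.of_mono (biprod.lift f.hom i.hom),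
    ⟨(toStable P).map inl, (toStable P).map fst, ?_, h₄⟩, ?_⟩
  · rw [← Functor.map_comp, h₂, CategoryTheory.Functor.map_id]
  · dsimp only
    rw [h₃, Functor.map_comp, Category.assoc, h₄, Category.comp_id]

theorem stable_cocone {X Y : StableCategory P} (f : X ⟶ Y) :
    ∃ (Z : StableCategory P) (g : Y ⟶ Z) (h : Z ⟶ X⟦(1 : ℤ)⟧),
      Triangle.mk f g h ∈ stableDistinguished P := by
  obtain ⟨f, rfl⟩ := (toStable P).map_surjective f
  obtain ⟨W, C, j, q, w, hS, e, he⟩ := exists_inflation f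
  exact ⟨(toStable P).obj C, e.hom ≫ (toStable P).map q, conn hS,
    mem_stableDistinguished hS (Iso.refl _) e (Iso.refl _) (by simpa using he) (by simp)
      (by simp)⟩

/-- The rotated conflation `0 ⟶ Y ⟶ Z ⊞ I ⟶ T ⟶ 0` attached to a morphism from a conflation
`0 ⟶ X ⟶ Y ⟶ Z ⟶ 0` to a conflation `0 ⟶ X ⟶ I ⟶ T ⟶ 0`. -/
theorem rotate_shortExact {X Y Z I T : 𝒜} {f : X ⟶ Y} {g : Y ⟶ Z} {w : f ≫ g = 0}
    (hS : (ShortComplex.mk f g w).ShortExact) {i : X ⟶ I} {p : I ⟶ T} {w' : i ≫ p = 0}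
    (hE : (ShortComplex.mk i p w').ShortExact) (a : Y ⟶ I) (h : Z ⟶ T) (ha : f ≫ a = i)
    (hh : g ≫ h = a ≫ p) :
    (ShortComplex.mk (biprod.lift g a) (biprod.desc h (-p)) (by simp [hh])).ShortExact := by
  have : Mono i := hE.mono_f
  have : Epi p := hE.epi_g
  have : Epi g := hS.epi_g
  have : Mono (biprod.lift g a) := by
    refine Preadditive.mono_of_cancel_zero _ (fun k hk => ?_)
    have h₁ : k ≫ g = 0 := by simpa using hk =≫ biprod.fst
    have h₂ : k ≫ a = 0 := by simpa using hk =≫ biprod.snd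
    obtain ⟨l, rfl⟩ : ∃ l, l ≫ f = k := hS.exists_lift k h₁
    rw [Category.assoc, ha] at h₂
    have : l = 0 := by rwa [← cancel_mono i, zero_comp]
    rw [this, zero_comp]
  have : Epi (biprod.desc h (-p)) := by
    have : Epi (biprod.inr ≫ biprod.desc h (-p)) := by
      rw [biprod.inr_desc]
      infer_instance
    exact epi_of_epi biprod.inr _
  refine ShortComplex.ShortExact.of_desc _ (fun {D} k hk => ?_)
  have hk' : g ≫ biprod.inl ≫ k + a ≫ biprod.inr ≫ k = 0 := by
    rw [biprod.lift_eq, Preadditive.add_comp] at hk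
    simpa using hk
  obtain ⟨v, hv⟩ : ∃ v, p ≫ v = biprod.inr ≫ k := hE.exists_desc _ (by
    have := f ≫= hk'
    rw [Preadditive.comp_add, reassoc_of% w, zero_comp, zero_add, reassoc_of% ha] at this
    simpa using this)
  have h₁ : biprod.inl ≫ k = - h ≫ v := by
    rw [← cancel_epi g, Preadditive.comp_neg, reassoc_of% hh, hv]
    exact eq_neg_of_add_eq_zero_left hk'
  refine ⟨-v, ?_⟩
  ext <;> simp [h₁, hv]

/-- The conflation `0 ⟶ K ⟶ U ⊞ Q ⟶ V ⟶ 0` attached to a morphism from a conflation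
`0 ⟶ K ⟶ Q ⟶ W ⟶ 0` to a conflation `0 ⟶ U ⟶ V ⟶ W ⟶ 0`. -/
theorem invRotate_shortExact {U V W K Q : 𝒜} {f : U ⟶ V} {g : V ⟶ W} {w : f ≫ g = 0}
    (hS : (ShortComplex.mk f g w).ShortExact) {i : K ⟶ Q} {p : Q ⟶ W} {w' : i ≫ p = 0}
    (hE : (ShortComplex.mk i p w').ShortExact) (k : K ⟶ U) (l : Q ⟶ V) (hl : l ≫ g = p)
    (hk : i ≫ l = k ≫ f) :
    (ShortComplex.mk (biprod.lift k (-i)) (biprod.desc f l) (by simp [hk])).ShortExact := by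
  have : Mono i := hE.mono_f
  have : Epi p := hE.epi_g
  have : Mono f := hS.mono_f
  have : Mono (biprod.lift k (-i)) := mono_of_mono_fac (biprod.lift_snd k (-i))
  have : Epi (biprod.desc f l) := by
    refine Preadditive.epi_of_cancel_zero _ (fun t ht => ?_)
    have h₁ : f ≫ t = 0 := by simpa using biprod.inl ≫= ht
    have h₂ : l ≫ t = 0 := by simpa using biprod.inr ≫= ht
    obtain ⟨s, rfl⟩ : ∃ s, g ≫ s = t := hS.exists_desc t h₁
    rw [reassoc_of% hl] at h₂
    have : s = 0 := by rwa [← cancel_epi p, comp_zero]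
    rw [this, comp_zero]
  refine ShortComplex.ShortExact.of_lift _ (fun {D} t ht => ?_)
  have ht' : (t ≫ biprod.fst) ≫ f + (t ≫ biprod.snd) ≫ l = 0 := by
    rw [biprod.desc_eq, Preadditive.comp_add] at ht
    simpa using ht
  obtain ⟨z, hz⟩ : ∃ z, z ≫ i = t ≫ biprod.snd := hE.exists_lift _ (by
    have := ht' =≫ g
    simp only [Preadditive.add_comp, Category.assoc, w, comp_zero, zero_add, hl] at this
    simpa using this)
  have h₁ : t ≫ biprod.fst = - z ≫ k := by
    rw [← cancel_mono f, Preadditive.neg_comp, Category.assoc, Category.assoc, ← hk,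
      reassoc_of% hz]
    simpa using eq_neg_of_add_eq_zero_left ht'
  refine ⟨-z, ?_⟩
  ext <;> simp [h₁, hz]

end Triangles

section Triangles

variable {𝒜 : Type u} [Category.{v} 𝒜] [Abelian 𝒜] {P : ObjectProperty 𝒜}
  [P.IsClosedUnderExtensions] [P.ContainsZero] [hP : Fact (IsFrobenius P)]

attribute [local instance] stableHasShift stable_shift_additive stable_hasZeroObject

theorem stable_complete_std {S S' : ShortComplex P.FullSubcategory} (hS : IsConflation S)
    (hS' : IsConflation S') (a : (toStable P).obj S.X₁ ⟶ (toStable P).obj S'.X₁)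
    (b : (toStable P).obj S.X₂ ⟶ (toStable P).obj S'.X₂)
    (comm : (toStable P).map S.f ≫ b = a ≫ (toStable P).map S'.f) :
    ∃ c : (toStable P).obj S.X₃ ⟶ (toStable P).obj S'.X₃,
      (toStable P).map S.g ≫ c = b ≫ (toStable P).map S'.g ∧
      conn hS ≫ a⟦(1 : ℤ)⟧' = c ≫ conn hS' := by
  obtain ⟨a, rfl⟩ := (toStable P).map_surjective a
  obtain ⟨b, rfl⟩ := (toStable P).map_surjective b
  rw [← Functor.map_comp, ← Functor.map_comp, toStable_map_eq_iff] at comm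
  obtain ⟨Q, s, t, hQ, hst⟩ := comm
  obtain ⟨r, hr⟩ := hS.exists_extension (hP.out.relInjective_of_relProjective hQ) s
  obtain ⟨φ, h₁, h₂⟩ := hS.exists_hom_of_left (S' := S') a (b - r ≫ t) (by
    rw [Preadditive.comp_sub, reassoc_of% hr, hst, sub_sub_cancel])
  refine ⟨(toStable P).map φ.τ₃, ?_, ?_⟩
  · rw [← Functor.map_comp, ← φ.comm₂₃, h₂, Functor.map_comp, Functor.map_sub, Functor.map_comp,
      toStable_map_eq_zero_of_right hQ r, zero_comp, sub_zero]
  · rw [conn_naturality hS hS' φ, h₁]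

theorem exists_of_mem_stableDistinguished {T : Triangle (StableCategory P)}
    (h : T ∈ stableDistinguished P) :
    ∃ (S : ShortComplex P.FullSubcategory) (hS : IsConflation S)
      (e₁ : T.obj₁ ≅ (toStable P).obj S.X₁) (e₂ : T.obj₂ ≅ (toStable P).obj S.X₂)
      (e₃ : T.obj₃ ≅ (toStable P).obj S.X₃),
      T.mor₁ ≫ e₂.hom = e₁.hom ≫ (toStable P).map S.f ∧
      T.mor₂ ≫ e₃.hom = e₂.hom ≫ (toStable P).map S.g ∧
      T.mor₃ ≫ e₁.hom⟦(1 : ℤ)⟧' = e₃.hom ≫ conn hS := by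
  obtain ⟨S, hS, ⟨e⟩⟩ := h
  exact ⟨S, hS, Triangle.π₁.mapIso e, Triangle.π₂.mapIso e, Triangle.π₃.mapIso e,
    e.hom.comm₁, e.hom.comm₂, e.hom.comm₃⟩

theorem stable_complete (T₁ T₂ : Triangle (StableCategory P))
    (h₁ : T₁ ∈ stableDistinguished P) (h₂ : T₂ ∈ stableDistinguished P)
    (a : T₁.obj₁ ⟶ T₂.obj₁) (b : T₁.obj₂ ⟶ T₂.obj₂) (comm : T₁.mor₁ ≫ b = a ≫ T₂.mor₁) :
    ∃ c : T₁.obj₃ ⟶ T₂.obj₃, T₁.mor₂ ≫ c = b ≫ T₂.mor₂ ∧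
      T₁.mor₃ ≫ a⟦(1 : ℤ)⟧' = c ≫ T₂.mor₃ := by
  obtain ⟨S, hS, e₁, e₂, e₃, c₁, c₂, c₃⟩ := exists_of_mem_stableDistinguished h₁
  obtain ⟨S', hS', e₁', e₂', e₃', c₁', c₂', c₃'⟩ := exists_of_mem_stableDistinguished h₂
  obtain ⟨c, hc, hc'⟩ := stable_complete_std hS hS' (e₁.inv ≫ a ≫ e₁'.hom)
    (e₂.inv ≫ b ≫ e₂'.hom) (by
      rw [← cancel_epi e₁.hom, ← reassoc_of% c₁, Iso.hom_inv_id_assoc, reassoc_of% comm, c₁',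
        Category.assoc, Category.assoc, Iso.hom_inv_id_assoc])
  refine ⟨e₃.hom ≫ c ≫ e₃'.inv, ?_, ?_⟩
  · rw [← cancel_mono e₃'.hom, Category.assoc, Category.assoc, Category.assoc, Category.assoc,
      e₃'.inv_hom_id, Category.comp_id, reassoc_of% c₂, hc, c₂', Category.assoc, Category.assoc,
      Iso.hom_inv_id_assoc]
  · rw [← cancel_mono (e₁'.hom⟦(1 : ℤ)⟧'), Category.assoc, Category.assoc, Category.assoc,
      Category.assoc, c₃', Iso.inv_hom_id_assoc, ← hc', ← reassoc_of% c₃, ← Functor.map_comp,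
      ← Functor.map_comp, Iso.hom_inv_id_assoc]

/-- The projection from `X ⊞ I` to `X` is an isomorphism in the stable category for `I`
projective. -/
theorem exists_biprodObj_iso (X I : P.FullSubcategory) (hI : relProjective P I.obj) :
    ∃ e : (toStable P).obj X ≅ (toStable P).obj (ObjectProperty.biprodObj X I),
      e.hom = (toStable P).map (ObjectProperty.homMk biprod.inl) ∧
      e.inv = (toStable P).map (ObjectProperty.homMk biprod.fst) := by
  let W := ObjectProperty.biprodObj X I
  let fst : W ⟶ X := ObjectProperty.homMk biprod.fst
  let snd : W ⟶ I := ObjectProperty.homMk biprod.snd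
  let inl : X ⟶ W := ObjectProperty.homMk biprod.inl
  let inr : I ⟶ W := ObjectProperty.homMk biprod.inr
  have h₁ : fst ≫ inl + snd ≫ inr = 𝟙 W := by ext; exact biprod.total
  have h₂ : inl ≫ fst = 𝟙 _ := by ext; exact biprod.inl_fst
  refine ⟨⟨(toStable P).map inl, (toStable P).map fst, ?_, ?_⟩, rfl, rfl⟩
  · rw [← Functor.map_comp, h₂, CategoryTheory.Functor.map_id]
  · rw [← CategoryTheory.Functor.map_id, ← h₁, Functor.map_add, Functor.map_comp, Functor.map_comp,
      toStable_map_eq_zero_of_right hI snd, zero_comp, add_zero]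

omit [P.ContainsZero] [P.IsClosedUnderExtensions] hP in
theorem CategoryTheory.ShortComplex.ShortExact.comp_eq_zero {X Y Z : 𝒜} {f : X ⟶ Y} {g : Y ⟶ Z}
    {w : f ≫ g = 0} (_ : (ShortComplex.mk f g w).ShortExact) : f ≫ g = 0 := w

theorem stable_rotate_std {S : ShortComplex P.FullSubcategory} (hS : IsConflation S) :
    Triangle.mk ((toStable P).map S.g) (conn hS) (-((toStable P).map S.f)⟦(1 : ℤ)⟧') ∈
      stableDistinguished P := by
  obtain ⟨I, T, i, p, w, hE, hI⟩ := hP.out.exists_injective_conflation S.X₁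
  obtain ⟨φ, h₁⟩ := hS.exists_hom_extending (S' := ShortComplex.mk i p w) hI (𝟙 _)
  have hφ₁ : S.f ≫ φ.τ₂ = i := by rw [← φ.comm₁₂, h₁]; exact Category.id_comp _
  have hφ₃ : S.g ≫ φ.τ₃ = φ.τ₂ ≫ p := φ.comm₂₃.symm
  let W : P.FullSubcategory := ObjectProperty.biprodObj S.X₃ I
  have := isIso_conn hE hI
  obtain ⟨e, he, he'⟩ := exists_biprodObj_iso S.X₃ I (hP.out.relProjective_of_relInjective hI)
  let j : S.X₂ ⟶ W := ObjectProperty.homMk (biprod.lift S.g.hom φ.τ₂.hom)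
  let q : W ⟶ T := ObjectProperty.homMk (biprod.desc φ.τ₃.hom (-p.hom))
  have hR := rotate_shortExact (w := congr_arg (·.hom) S.zero) hS (w' := congr_arg (·.hom) w) hE
      φ.τ₂.hom φ.τ₃.hom (congr_arg (·.hom) hφ₁) (congr_arg (·.hom) hφ₃)
  have hjq : j ≫ q = 0 := by ext; exact hR.comp_eq_zero
  replace hR : IsConflation (ShortComplex.mk j q hjq) := hR
  obtain ⟨ψ, hψ₁, hψ₂⟩ := hE.exists_hom_of_left (S' := ShortComplex.mk j q hjq) S.f
    (ObjectProperty.homMk biprod.inr : I ⟶ W) (by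
      ext
      have := congr_arg (·.hom) hφ₁
      have h₀ := congr_arg (·.hom) S.zero
      dsimp at this h₀
      change i.hom ≫ (biprod.inr : I.obj ⟶ S.X₃.obj ⊞ I.obj) =
        S.f.hom ≫ biprod.lift S.g.hom φ.τ₂.hom
      ext <;> simp [this, h₀])
  have hψ₃ : ψ.τ₃ = -𝟙 _ := by
    have := hE.epi_g
    rw [← cancel_epi p]
    have := ψ.comm₂₃
    rw [hψ₂] at this
    dsimp at this
    rw [← this, Preadditive.comp_neg, Category.comp_id]
    ext
    exact biprod.inr_desc _ _
  have n₁ := conn_naturality hS hE φ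
  have n₂ := conn_naturality hE hR ψ
  rw [h₁, CategoryTheory.Functor.map_id, CategoryTheory.Functor.map_id, Category.comp_id] at n₁
  rw [hψ₁, hψ₃, Functor.map_neg, CategoryTheory.Functor.map_id, Preadditive.neg_comp,
    Category.id_comp] at n₂
  refine mem_stableDistinguished hR (Iso.refl _) e (asIso (conn hE)).symm ?_ ?_ ?_
  · have : (toStable P).map j ≫ e.inv = (toStable P).map S.g := by
      rw [he', ← Functor.map_comp]
      congr 1
      ext
      exact biprod.lift_fst _ _
    rw [Iso.refl_hom, Category.id_comp, ← this, Category.assoc, e.inv_hom_id, Category.comp_id]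
  · have : (ObjectProperty.homMk biprod.inl : S.X₃ ⟶ W) ≫ q = φ.τ₃ := by
      ext
      exact biprod.inl_desc _ _
    rw [he, ← Functor.map_comp, this, ← n₁]
    simp
  · rw [Iso.refl_hom, CategoryTheory.Functor.map_id, Category.comp_id, Iso.symm_hom, asIso_inv,
      IsIso.eq_inv_comp, Preadditive.comp_neg, ← n₂, neg_neg]

theorem stable_invRotate_std {S : ShortComplex P.FullSubcategory} (hS : IsConflation S)
    {X : StableCategory P} (f : X ⟶ (toStable P).obj S.X₁)
    (e₀ : X⟦(1 : ℤ)⟧ ≅ (toStable P).obj S.X₃)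
    (comm : -f⟦(1 : ℤ)⟧' = e₀.hom ≫ conn hS) :
    Triangle.mk f ((toStable P).map S.f) ((toStable P).map S.g ≫ e₀.inv) ∈
      stableDistinguished P := by
  obtain ⟨K, Q, i, p, w, hE, hQ⟩ := hP.out.exists_projective_conflation S.X₃
  obtain ⟨φ, h₁⟩ := hS.exists_hom_lifting (S := ShortComplex.mk i p w) hQ (𝟙 _)
  have hφ₁ : φ.τ₂ ≫ S.g = p := by rw [φ.comm₂₃, h₁]; exact Category.comp_id _
  have hφ₃ : i ≫ φ.τ₂ = φ.τ₁ ≫ S.f := φ.comm₁₂.symm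
  let W : P.FullSubcategory := ObjectProperty.biprodObj S.X₁ Q
  have := isIso_conn hE (hP.out.relInjective_of_relProjective hQ)
  obtain ⟨e, he, he'⟩ := exists_biprodObj_iso S.X₁ Q hQ
  let j : K ⟶ W := ObjectProperty.homMk (biprod.lift φ.τ₁.hom (-i.hom))
  let q : W ⟶ S.X₂ := ObjectProperty.homMk (biprod.desc S.f.hom φ.τ₂.hom)
  have hR := invRotate_shortExact (w := congr_arg (·.hom) S.zero) hS (w' := congr_arg (·.hom) w) hE
      φ.τ₁.hom φ.τ₂.hom (congr_arg (·.hom) hφ₁) (congr_arg (·.hom) hφ₃)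
  have hjq : j ≫ q = 0 := by ext; exact hR.comp_eq_zero
  replace hR : IsConflation (ShortComplex.mk j q hjq) := hR
  obtain ⟨ψ, hψ₂, hψ₃⟩ := hE.exists_hom_of_right (S := ShortComplex.mk j q hjq)
    (ObjectProperty.homMk biprod.snd : W ⟶ Q) S.g (by
      ext
      have := congr_arg (·.hom) hφ₁
      have h₀ := congr_arg (·.hom) S.zero
      dsimp at this h₀
      change biprod.desc S.f.hom φ.τ₂.hom ≫ S.g.hom =
        (biprod.snd : S.X₁.obj ⊞ Q.obj ⟶ Q.obj) ≫ p.hom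
      ext <;> simp [this, h₀])
  have hψ₁ : ψ.τ₁ = -𝟙 _ := by
    have := hE.mono_f
    rw [← cancel_mono i]
    have := ψ.comm₁₂
    rw [hψ₂] at this
    dsimp at this
    rw [this, Preadditive.neg_comp, Category.id_comp]
    ext
    exact biprod.lift_snd _ _
  have n₁ := conn_naturality hE hS φ
  have n₂ := conn_naturality hR hE ψ
  rw [h₁, CategoryTheory.Functor.map_id, Category.id_comp] at n₁
  rw [hψ₁, hψ₃, Functor.map_neg, Functor.map_neg, CategoryTheory.Functor.map_id,
    CategoryTheory.Functor.map_id, Preadditive.comp_neg] at n₂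
  let γ : (toStable P).obj S.X₃ ≅ ((toStable P).obj K)⟦(1 : ℤ)⟧ := asIso (conn hE)
  have hγ : γ.hom = conn hE := rfl
  let x : X ≅ (toStable P).obj K :=
    (shiftFunctor (StableCategory P) (1 : ℤ)).preimageIso (e₀ ≪≫ γ)
  have hx : x.hom⟦(1 : ℤ)⟧' = e₀.hom ≫ γ.hom := by simp [x]
  let x' : X ≅ (toStable P).obj K := ⟨-x.hom, -x.inv, by simp, by simp⟩
  refine mem_stableDistinguished hR x' e (Iso.refl _) ?_ ?_ ?_
  · have h₂ : (toStable P).map j ≫ e.inv = (toStable P).map φ.τ₁ := by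
      rw [he', ← Functor.map_comp]
      congr 1
      ext
      exact biprod.lift_fst _ _
    have h₃ : f = -(x.hom ≫ (toStable P).map φ.τ₁) := by
      apply (shiftFunctor (StableCategory P) (1 : ℤ)).map_injective
      rw [Functor.map_neg, Functor.map_comp, hx, Category.assoc, hγ]
      dsimp only at n₁
      rw [← n₁, ← comm, neg_neg]
    rw [← cancel_mono e.inv, Category.assoc, Category.assoc, e.hom_inv_id, Category.comp_id, h₂, h₃]
    simp [x']
  · have : (ObjectProperty.homMk biprod.inl : S.X₁ ⟶ W) ≫ q = S.f := by
      ext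
      exact biprod.inl_desc _ _
    rw [he, ← Functor.map_comp, this]
    simp
  · simp only [x', Functor.map_neg, hx, Preadditive.comp_neg, Category.assoc, Iso.refl_hom,
      Iso.inv_hom_id_assoc, hγ]
    rw [n₂, neg_neg, Category.comp_id, Category.id_comp]

end Triangles

section Triangles

variable {𝒜 : Type u} [Category.{v} 𝒜] [Abelian 𝒜] {P : ObjectProperty 𝒜}
  [P.IsClosedUnderExtensions] [P.ContainsZero] [hP : Fact (IsFrobenius P)]

attribute [local instance] stableHasShift stable_shift_additive stable_hasZeroObject

theorem stable_rotate (T : Triangle (StableCategory P)) :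
    T ∈ stableDistinguished P ↔ T.rotate ∈ stableDistinguished P := by
  constructor
  · intro h
    obtain ⟨S, hS, e₁, e₂, e₃, c₁, c₂, c₃⟩ := exists_of_mem_stableDistinguished h
    refine stableDistinguished_of_iso _ (stable_rotate_std hS) _
      (Triangle.isoMk _ _ e₂ e₃ ((shiftFunctor (StableCategory P) (1 : ℤ)).mapIso e₁) c₂ c₃ ?_)
    change (-T.mor₁⟦(1 : ℤ)⟧') ≫ e₂.hom⟦(1 : ℤ)⟧' = e₁.hom⟦(1 : ℤ)⟧' ≫ (-_)
    rw [Preadditive.neg_comp, Preadditive.comp_neg, ← Functor.map_comp, ← Functor.map_comp, c₁]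
  · intro h
    obtain ⟨S, hS, (e₁ : T.obj₂ ≅ _), (e₂ : T.obj₃ ≅ _), (e₃ : T.obj₁⟦(1 : ℤ)⟧ ≅ _),
      (c₁ : T.mor₂ ≫ e₂.hom = _), (c₂ : T.mor₃ ≫ e₃.hom = e₂.hom ≫ _),
      (c₃ : (-T.mor₁⟦(1 : ℤ)⟧') ≫ e₁.hom⟦(1 : ℤ)⟧' = _)⟩ :=
        exists_of_mem_stableDistinguished h
    have h := stable_invRotate_std hS (T.mor₁ ≫ e₁.hom) e₃ (by
      rw [Functor.map_comp, ← Preadditive.neg_comp]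
      exact c₃)
    refine stableDistinguished_of_iso _ h _
      (Triangle.isoMk _ _ (Iso.refl _) e₁ e₂ (Category.id_comp _).symm c₁ ?_)
    change T.mor₃ ≫ (𝟙 _)⟦(1 : ℤ)⟧' = e₂.hom ≫ (toStable P).map S.g ≫ e₃.inv
    rw [CategoryTheory.Functor.map_id, Category.comp_id, ← cancel_mono e₃.hom, Category.assoc,
      Category.assoc, e₃.inv_hom_id, Category.comp_id]
    exact c₂

variable (P) in
/-- The stable category of a Frobenius category is pretriangulated. -/
@[reducible]
noncomputable def stablePretriangulated : Pretriangulated (StableCategory P) where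
  distinguishedTriangles := stableDistinguished P
  isomorphic_distinguished := stableDistinguished_of_iso
  contractible_distinguished := stable_contractible
  distinguished_cocone_triangle := stable_cocone
  rotate_distinguished_triangle := stable_rotate
  complete_distinguished_triangle_morphism := stable_complete

attribute [local instance] stablePretriangulated

omit [P.IsClosedUnderExtensions] [P.ContainsZero] hP in
/-- The composite of two admissible monomorphisms. -/
theorem comp_shortExact {X Y Z C D : 𝒜} {f : X ⟶ Y} {p : Y ⟶ C} {w : f ≫ p = 0}
    (h : (ShortComplex.mk f p w).ShortExact) {g : Y ⟶ Z} {q : Z ⟶ D} {w' : g ≫ q = 0}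
    (h' : (ShortComplex.mk g q w').ShortExact) :
    ∃ (a : C ⟶ cokernel (f ≫ g)) (b : cokernel (f ≫ g) ⟶ D) (w'' : a ≫ b = 0),
      p ≫ a = g ≫ cokernel.π (f ≫ g) ∧ cokernel.π (f ≫ g) ≫ b = q ∧
      (ShortComplex.mk a b w'').ShortExact := by
  have : Mono f := h.mono_f
  have : Epi p := h.epi_g
  have : Mono g := h'.mono_f
  have : Epi q := h'.epi_g
  have hfg := ShortComplex.ShortExact.of_mono (f ≫ g)
  obtain ⟨a, ha⟩ := h.exists_desc (g ≫ cokernel.π (f ≫ g)) (by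
    rw [← Category.assoc, cokernel.condition])
  obtain ⟨b, hb⟩ := hfg.exists_desc q (by rw [Category.assoc, w', comp_zero])
  have hab : a ≫ b = 0 := by
    rw [← cancel_epi p, reassoc_of% ha, hb, w', comp_zero]
  have : Epi b := by
    have : Epi (cokernel.π (f ≫ g) ≫ b) := by rwa [hb]
    exact epi_of_epi (cokernel.π (f ≫ g)) b
  have : Mono a := by
    rw [Preadditive.mono_iff_cancel_zero]
    intro T t ht
    obtain ⟨T', π, _, y, hy⟩ := surjective_up_to_refinements_of_epi p t
    have h₁ : (y ≫ g) ≫ cokernel.π (f ≫ g) = 0 := by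
      rw [Category.assoc, ← ha, ← reassoc_of% hy, ht, comp_zero]
    obtain ⟨x, hx⟩ := hfg.exists_lift _ h₁
    rw [← Category.assoc, cancel_mono] at hx
    rw [← cancel_epi π, hy, ← hx, Category.assoc, w, comp_zero, comp_zero]
  refine ⟨a, b, hab, ha, hb, ShortComplex.ShortExact.of_desc hab (fun {D} k hk => ?_)⟩
  obtain ⟨l, hl⟩ := h'.exists_desc (cokernel.π (f ≫ g) ≫ k) (by
    rw [← reassoc_of% ha, hk, comp_zero])
  refine ⟨l, ?_⟩
  rw [← cancel_epi (cokernel.π (f ≫ g)), reassoc_of% hb, hl]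

variable (P) in
theorem stable_isTriangulated : IsTriangulated (StableCategory P) := by
  refine IsTriangulated.mk' (fun X Y Z f g => ?_)
  obtain ⟨f, rfl⟩ := (toStable P).map_surjective f
  obtain ⟨Y', C, j, p, w, hS, e, he⟩ := exists_inflation f
  obtain ⟨g', hg'⟩ := (toStable P).map_surjective (e.inv ≫ g)
  obtain ⟨Z', D, k, q, w', hS', e', he'⟩ := exists_inflation g'
  obtain ⟨a, b, w'', ha, hb, hab⟩ := comp_shortExact (w := congr_arg (·.hom) w) hS
    (w' := congr_arg (·.hom) w') hS'
  have hmono : Mono (j.hom ≫ k.hom) :=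
    have := hS.mono
    have := hS'.mono
    mono_comp _ _
  let E : P.FullSubcategory :=
    ⟨cokernel (j.hom ≫ k.hom), P.prop_X₂_of_shortExact hab C.property D.property⟩
  let r : Z' ⟶ E := ObjectProperty.homMk (cokernel.π (j.hom ≫ k.hom))
  let a' : C ⟶ E := ObjectProperty.homMk a
  let b' : E ⟶ D := ObjectProperty.homMk b
  have w₀ : (j ≫ k) ≫ r = 0 := by ext; exact cokernel.condition (j.hom ≫ k.hom)
  have h₀ : IsConflation (ShortComplex.mk (j ≫ k) r w₀) :=
    ShortComplex.ShortExact.of_mono (j.hom ≫ k.hom)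
  have w₁ : a' ≫ b' = 0 := by ext; exact w''
  have h₁ : IsConflation (ShortComplex.mk a' b' w₁) := hab
  have hpa : p ≫ a' = k ≫ r := by ext; exact ha
  have hrb : r ≫ b' = q := by ext; exact hb
  let φ₁ : ShortComplex.mk j p w ⟶ ShortComplex.mk (j ≫ k) r w₀ :=
    { τ₁ := 𝟙 _, τ₂ := k, τ₃ := a', comm₁₂ := Category.id_comp _, comm₂₃ := hpa.symm }
  let φ₂ : ShortComplex.mk (j ≫ k) r w₀ ⟶ ShortComplex.mk k q w' :=
    { τ₁ := j, τ₂ := 𝟙 _, τ₃ := b', comm₁₂ := (Category.comp_id _).symm,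
      comm₂₃ := (Category.id_comp _).trans hrb.symm }
  let φ₃ : ShortComplex.mk k q w' ⟶ ShortComplex.mk a' b' w₁ :=
    { τ₁ := p, τ₂ := r, τ₃ := 𝟙 _, comm₁₂ := hpa, comm₂₃ := hrb.trans (Category.comp_id _).symm }
  have n₁ := conn_naturality hS h₀ φ₁
  have n₂ := conn_naturality h₀ hS' φ₂
  have n₃ := conn_naturality hS' h₁ φ₃
  dsimp only [φ₁, φ₂, φ₃] at n₁ n₂ n₃
  rw [CategoryTheory.Functor.map_id, CategoryTheory.Functor.map_id, Category.comp_id] at n₁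
  rw [CategoryTheory.Functor.map_id, Category.id_comp] at n₃
  refine ⟨_, _, _, _, _, _, (toStable P).map j, (toStable P).map k, Iso.refl _, e, e', ?_, ?_,
    (toStable P).map p, conn hS, stdTriangle_mem hS, (toStable P).map q, conn hS',
    stdTriangle_mem hS', (toStable P).map r, conn h₀, ?_, ⟨(toStable P).map a', (toStable P).map b',
      ?_, n₁, ?_, n₂.symm, ?_⟩⟩
  · rw [he]
    exact (Category.id_comp _).symm
  · rw [← he', hg', Category.assoc]
    exact (e.hom_inv_id_assoc (g ≫ e'.hom)).symm
  · rw [← Functor.map_comp]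
    exact stdTriangle_mem h₀
  · rw [← Functor.map_comp, hpa, Functor.map_comp]
  · rw [← Functor.map_comp, hrb]
  · rw [← n₃]
    exact stdTriangle_mem h₁

/-- The standard triangulated structure on the stable category of a Frobenius category. -/
theorem IsFrobenius.nonempty_stableTriangulation {P : ObjectProperty 𝒜} (h : IsFrobenius P)
    [P.ContainsZero] : Nonempty (StableTriangulation P) := by
  have := h.closedUnderExtensions
  have : Fact (IsFrobenius P) := ⟨h⟩
  exact ⟨{
    hasShift := stableHasShift P
    hasZeroObject := stable_hasZeroObject P
    shift_additive := stable_shift_additive P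
    pretriangulated := stablePretriangulated P
    isTriangulated := stable_isTriangulated P
    suspensionIso S hS hI :=
      have := isIso_conn hS hI
      asIso (conn hS)
    suspensionIso_naturality φ hS hI hS' hI' := conn_naturality hS hS' φ
    distinguished_iff Δ := by
      constructor
      · rintro ⟨S, hS, ⟨e⟩⟩
        obtain ⟨I, T, i, p, w, hE, hI⟩ := h.exists_injective_conflation S.X₁
        obtain ⟨φ, hφ⟩ := hS.exists_hom_extending (S' := ShortComplex.mk i p w) hI (𝟙 _)
        have n := conn_naturality hS hE φ
        rw [hφ, CategoryTheory.Functor.map_id, CategoryTheory.Functor.map_id,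
          Category.comp_id] at n
        refine ⟨S.X₁, S.X₂, S.X₃, S.f, S.g, S.zero, hS, I, T, i, p, w, hE, hI, φ.τ₂, φ.τ₃,
          ?_, φ.comm₂₃.symm, ⟨e ≪≫ eqToIso ?_⟩⟩
        · rw [← φ.comm₁₂, hφ]
          exact Category.id_comp _
        · rw [asIso_hom, n]
      · rintro ⟨X, Y, Z, f, g, w, hS, I, T, i, p, w', hE, hI, a, b, ha, hb, ⟨e⟩⟩
        let φ : ShortComplex.mk f g w ⟶ ShortComplex.mk i p w' :=
          { τ₁ := 𝟙 _, τ₂ := a, τ₃ := b, comm₁₂ := (Category.id_comp _).trans ha.symm,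
            comm₂₃ := hb.symm }
        have n := conn_naturality hS hE φ
        dsimp only [φ] at n
        rw [CategoryTheory.Functor.map_id, CategoryTheory.Functor.map_id,
          Category.comp_id] at n
        refine ⟨_, hS, ⟨e ≪≫ eqToIso ?_⟩⟩
        rw [asIso_hom, n] }⟩

end Triangles

/-! ## Functors between stable categories -/

section StableFunctor

variable {𝒜 : Type u₁} [Category.{v₁} 𝒜] [Preadditive 𝒜] {ℬ : Type u₂} [Category.{v₂} ℬ]
  [Preadditive ℬ] {P : ObjectProperty 𝒜} {Q : ObjectProperty ℬ}

/-- The functor between stable categories induced by an additive functor that preserves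
projective objects. -/
def stableFunctor (F : P.FullSubcategory ⥤ Q.FullSubcategory) [F.Additive]
    (hF : ∀ X : P.FullSubcategory, relProjective P X.obj → relProjective Q (F.obj X).obj) :
    StableCategory P ⥤ StableCategory Q :=
  CategoryTheory.Quotient.lift _ (F ⋙ toStable Q) (fun X Y f g h => by
    refine CategoryTheory.Quotient.sound _ ?_
    have : stableIdeal P X Y ≤ (stableIdeal Q (F.obj X) (F.obj Y)).comap F.mapAddHom := by
      rw [stableIdeal, AddSubgroup.closure_le]
      rintro _ ⟨R, a, b, hR, rfl⟩
      exact AddSubgroup.subset_closure ⟨F.obj R, F.map a, F.map b, hF R hR, (F.map_comp a b).symm⟩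
    have h' := this h
    rwa [AddSubgroup.mem_comap, Functor.coe_mapAddHom, F.map_sub] at h')

variable {F : P.FullSubcategory ⥤ Q.FullSubcategory} [F.Additive]
  (hF : ∀ X : P.FullSubcategory, relProjective P X.obj → relProjective Q (F.obj X).obj)

theorem stableFunctor_isInducedBy : IsInducedBy (stableFunctor F hF) F :=
  CategoryTheory.Quotient.lift_spec _ _ _

instance stableFunctor_additive : (stableFunctor F hF).Additive where
  map_add {X Y f g} := by
    obtain ⟨f, rfl⟩ := (toStable P).map_surjective f
    obtain ⟨g, rfl⟩ := (toStable P).map_surjective g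
    exact (congr_arg (toStable Q).map (F.map_add (f := f) (g := g))).trans (toStable Q).map_add

variable {G : Q.FullSubcategory ⥤ P.FullSubcategory} [G.Additive]
  (hG : ∀ X : Q.FullSubcategory, relProjective Q X.obj → relProjective P (G.obj X).obj)

/-- An adjunction induces an adjunction between stable categories. -/
def stableAdjunction (adj : F ⊣ G) : stableFunctor F hF ⊣ stableFunctor G hG where
  unit :=
    { app := fun X => (toStable P).map (adj.unit.app X.as)
      naturality := fun X Y f => by
        obtain ⟨f, rfl⟩ := (toStable P).map_surjective f
        exact (((toStable P).map_comp _ _).symm.trans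
          (congr_arg (toStable P).map (adj.unit.naturality f))).trans ((toStable P).map_comp _ _) }
  counit :=
    { app := fun X => (toStable Q).map (adj.counit.app X.as)
      naturality := fun X Y f => by
        obtain ⟨f, rfl⟩ := (toStable Q).map_surjective f
        exact (((toStable Q).map_comp _ _).symm.trans
          (congr_arg (toStable Q).map (adj.counit.naturality f))).trans
            ((toStable Q).map_comp _ _) }
  left_triangle_components X :=
    (((toStable Q).map_comp _ _).symm.trans
      (congr_arg (toStable Q).map (adj.left_triangle_components X.as))).trans
        ((toStable Q).map_id _)
  right_triangle_components X :=
    (((toStable P).map_comp _ _).symm.trans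
      (congr_arg (toStable P).map (adj.right_triangle_components X.as))).trans
        ((toStable P).map_id _)

end StableFunctor

section TriangleFunctor

variable {𝒜 : Type u₁} [Category.{v₁} 𝒜] [Abelian 𝒜] {ℬ : Type u₂} [Category.{v₂} ℬ]
  [Abelian ℬ] {P : ObjectProperty 𝒜} {Q : ObjectProperty ℬ}
  [StableTriangulation P] [StableTriangulation Q]

theorem isTriangleFunctor_stableFunctor [P.ContainsZero]
    (hP : IsFrobenius P) (hQ : IsFrobenius Q)
    {F : P.FullSubcategory ⥤ Q.FullSubcategory} [F.Additive]
    (hF : ∀ X : P.FullSubcategory, relProjective P X.obj → relProjective Q (F.obj X).obj)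
    (hF' : ∀ S : ShortComplex P.FullSubcategory, IsConflation S → IsConflation (S.map F)) :
    IsTriangleFunctor (stableFunctor F hF) := by
  have := hP.closedUnderExtensions
  have hI : ∀ X : P.FullSubcategory, relInjective P X.obj → relInjective Q (F.obj X).obj :=
    fun X hX => (hQ.injective_iff_projective _).2 (hF X ((hP.injective_iff_projective _).1 hX))
  let σ (S : ShortComplex P.FullSubcategory) (hS : IsConflation S) (h : relInjective P S.X₂.obj) :
      (toStable P).obj S.X₃ ≅ ((toStable P).obj S.X₁)⟦(1 : ℤ)⟧ :=
    StableTriangulation.suspensionIso S hS h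
  let τ (S : ShortComplex P.FullSubcategory) (hS : IsConflation S) (h : relInjective P S.X₂.obj) :
      (stableFunctor F hF).obj ((toStable P).obj S.X₃) ≅
        ((stableFunctor F hF).obj ((toStable P).obj S.X₁))⟦(1 : ℤ)⟧ :=
    StableTriangulation.suspensionIso (S.map F) (hF' S hS) (hI _ h)
  let α (S : ShortComplex P.FullSubcategory) (hS : IsConflation S) (h : relInjective P S.X₂.obj) :
      (stableFunctor F hF).obj (((toStable P).obj S.X₁)⟦(1 : ℤ)⟧) ≅
        ((stableFunctor F hF).obj ((toStable P).obj S.X₁))⟦(1 : ℤ)⟧ :=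
    (stableFunctor F hF).mapIso (σ S hS h).symm ≪≫ τ S hS h
  have hα {S S' : ShortComplex P.FullSubcategory} (φ : S ⟶ S') (hS h hS' h') :
      (stableFunctor F hF).map (((toStable P).map φ.τ₁)⟦(1 : ℤ)⟧') ≫ (α S' hS' h').hom =
        (α S hS h).hom ≫ ((stableFunctor F hF).map ((toStable P).map φ.τ₁))⟦(1 : ℤ)⟧' := by
    have h₁ : (toStable P).map φ.τ₃ ≫ (σ S' hS' h').hom = (σ S hS h).hom ≫ _ :=
      StableTriangulation.suspensionIso_naturality φ hS h hS' h'
    have h₂ : (stableFunctor F hF).map ((toStable P).map φ.τ₃) ≫ (τ S' hS' h').hom =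
        (τ S hS h).hom ≫ ((stableFunctor F hF).map ((toStable P).map φ.τ₁))⟦(1 : ℤ)⟧' :=
      StableTriangulation.suspensionIso_naturality (F.mapShortComplex.map φ) (hF' S hS) (hI _ h)
        (hF' S' hS') (hI _ h')
    have h₃ : ((toStable P).map φ.τ₁)⟦(1 : ℤ)⟧' ≫ (σ S' hS' h').inv =
        (σ S hS h).inv ≫ (toStable P).map φ.τ₃ := by
      rw [Iso.comp_inv_eq, Category.assoc, h₁, Iso.inv_hom_id_assoc]
    have h₄ := congr_arg (stableFunctor F hF).map h₃
    rw [Functor.map_comp, Functor.map_comp] at h₄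
    simp only [α, Iso.trans_hom, Functor.mapIso_hom, Iso.symm_hom, Category.assoc]
    rw [reassoc_of% h₄, h₂]
  let e : shiftFunctor (StableCategory P) (1 : ℤ) ⋙ stableFunctor F hF ≅
      stableFunctor F hF ⋙ shiftFunctor (StableCategory Q) (1 : ℤ) :=
    NatIso.ofComponents
      (fun X => α (hP.hull X.as) (hP.hull_isConflation X.as) (hP.hull_injective X.as))
      (fun {X Y} f => by
        obtain ⟨f, rfl⟩ := (toStable P).map_surjective f
        obtain ⟨φ, rfl⟩ := hP.exists_hom_hull (hP.hull_isConflation X.as) f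
        exact hα φ _ _ _ _)
  have he (S : ShortComplex P.FullSubcategory) (hS h) :
      e.hom.app ((toStable P).obj S.X₁) = (α S hS h).hom := by
    obtain ⟨φ, hφ⟩ := hP.exists_hom_hull hS (𝟙 S.X₁)
    have := hα φ hS h (hP.hull_isConflation S.X₁) (hP.hull_injective S.X₁)
    rw [hφ] at this
    simp only [CategoryTheory.Functor.map_id] at this
    exact (Category.id_comp _).symm.trans (this.trans (Category.comp_id _))
  obtain ⟨hc, hc₁⟩ := Functor.CommShift.exists_of_one (stableFunctor F hF) e
  refine ⟨hc, ⟨fun T hT => ?_⟩⟩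
  rw [StableTriangulation.distinguished_iff] at hT ⊢
  obtain ⟨X, Y, Z, f, g, w, hS, I, J, i, p, w', hE, hJ, a, h, ha, hh, ⟨d⟩⟩ := hT
  refine ⟨F.obj X, F.obj Y, F.obj Z, F.map f, F.map g, by rw [← F.map_comp, w, F.map_zero],
    hF' _ hS, F.obj I, F.obj J, F.map i, F.map p, by rw [← F.map_comp, w', F.map_zero],
    hF' _ hE, hI _ hJ, F.map a, F.map h, by rw [← F.map_comp, ha],
    by rw [← F.map_comp, hh, F.map_comp], ⟨(stableFunctor F hF).mapTriangle.mapIso d ≪≫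
      Triangle.isoMk _ _ (Iso.refl _) (Iso.refl _) (Iso.refl _) ?_ ?_ ?_⟩⟩
  · exact (Category.comp_id _).trans (Category.id_comp _).symm
  · exact (Category.comp_id _).trans (Category.id_comp _).symm
  · have h₁ := he (ShortComplex.mk i p w') hE hJ
    dsimp only at h₁
    change ((stableFunctor F hF).map ((toStable P).map h ≫ (σ _ hE hJ).hom) ≫
      (hc.commShiftIso (1 : ℤ)).hom.app ((toStable P).obj X)) ≫ (𝟙 _)⟦(1 : ℤ)⟧' =
        𝟙 _ ≫ (stableFunctor F hF).map ((toStable P).map h) ≫ (τ _ hE hJ).hom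
    rw [CategoryTheory.Functor.map_id]
    refine (Category.comp_id _).trans (Eq.trans ?_ (Category.id_comp _).symm)
    rw [hc₁, h₁, Functor.map_comp, Category.assoc]
    simp only [α, Iso.trans_hom, Functor.mapIso_hom, Iso.symm_hom, ← Functor.map_comp_assoc,
      Iso.hom_inv_id, CategoryTheory.Functor.map_id, Category.id_comp]

end TriangleFunctor

/-! ## Comma categories of abelian categories -/

namespace CategoryTheory.Comma

section Limits

variable {𝒞 : Type u₁} [Category.{v₁} 𝒞] {𝒟 : Type u₂} [Category.{v₂} 𝒟] {ℰ : Type u₃}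
  [Category.{v₃} ℰ] (L : 𝒞 ⥤ ℰ) (R : 𝒟 ⥤ ℰ) {J : Type u} [Category.{v} J]

instance preservesLimitsOfShape_fst [HasLimitsOfShape J 𝒞] [HasLimitsOfShape J 𝒟]
    [PreservesLimitsOfShape J R] : PreservesLimitsOfShape J (fst L R) where
  preservesLimit {F} := preservesLimit_of_preserves_limit_cone
    (coneOfPreservesIsLimit F (limit.isLimit (F ⋙ fst L R)) (limit.isLimit (F ⋙ snd L R)))
    (limit.isLimit (F ⋙ fst L R))

instance preservesLimitsOfShape_snd [HasLimitsOfShape J 𝒞] [HasLimitsOfShape J 𝒟]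
    [PreservesLimitsOfShape J R] : PreservesLimitsOfShape J (snd L R) where
  preservesLimit {F} := preservesLimit_of_preserves_limit_cone
    (coneOfPreservesIsLimit F (limit.isLimit (F ⋙ fst L R)) (limit.isLimit (F ⋙ snd L R)))
    (limit.isLimit (F ⋙ snd L R))

end Limits

variable {𝒞 : Type u₁} [Category.{v₁} 𝒞] [Abelian 𝒞] {𝒟 : Type u₂} [Category.{v₂} 𝒟] [Abelian 𝒟]
  {ℰ : Type u₃} [Category.{v₃} ℰ] [Preadditive ℰ] (L : 𝒞 ⥤ ℰ) (R : 𝒟 ⥤ ℰ) [L.Additive]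
  [R.Additive] [PreservesFiniteColimits L] [PreservesFiniteLimits R]

noncomputable instance abelian : Abelian (Comma L R) := by
  have h {X Y : Comma L R} (f : X ⟶ Y) : IsIso (Abelian.coimageImageComparison f) := by
    have h₁ : IsIso ((fst L R).map (Abelian.coimageImageComparison f)) :=
      (Arrow.isIso_iff_isIso_of_isIso
        (Abelian.PreservesCoimageImageComparison.iso (fst L R) f).hom).2
          (inferInstanceAs (IsIso (Abelian.coimageImageComparison _)))
    have h₂ : IsIso ((snd L R).map (Abelian.coimageImageComparison f)) :=
      (Arrow.isIso_iff_isIso_of_isIso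
        (Abelian.PreservesCoimageImageComparison.iso (snd L R) f).hom).2
          (inferInstanceAs (IsIso (Abelian.coimageImageComparison _)))
    let g := Abelian.coimageImageComparison f
    have h₁' : IsIso g.left := h₁
    have h₂' : IsIso g.right := h₂
    exact (Comma.isoMk (asIso g.left) (asIso g.right) g.w).isIso_hom
  exact Abelian.ofCoimageImageComparisonIsIso


instance preservesFiniteLimits_fst : PreservesFiniteLimits (fst L R) where
  preservesFiniteLimits J _ _ :=
    have : PreservesLimitsOfShape J R := PreservesFiniteLimits.preservesFiniteLimits J
    inferInstance

instance preservesFiniteLimits_snd : PreservesFiniteLimits (snd L R) where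
  preservesFiniteLimits J _ _ :=
    have : PreservesLimitsOfShape J R := PreservesFiniteLimits.preservesFiniteLimits J
    inferInstance

instance preservesFiniteColimits_fst : PreservesFiniteColimits (fst L R) where
  preservesFiniteColimits J _ _ :=
    have : PreservesColimitsOfShape J L := PreservesFiniteColimits.preservesFiniteColimits J
    inferInstance

instance preservesFiniteColimits_snd : PreservesFiniteColimits (snd L R) where
  preservesFiniteColimits J _ _ :=
    have : PreservesColimitsOfShape J L := PreservesFiniteColimits.preservesFiniteColimits J
    inferInstance

omit [L.Additive] [R.Additive] [PreservesFiniteColimits L] [PreservesFiniteLimits R]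
  [Preadditive ℰ] in
variable {L R} in
theorem mono_of_left_right {X Y : Comma L R} (f : X ⟶ Y) [Mono f.left] [Mono f.right] :
    Mono f :=
  ⟨fun a b hab => by
    ext
    · exact (cancel_mono f.left).1 (congr_arg (·.left) hab)
    · exact (cancel_mono f.right).1 (congr_arg (·.right) hab)⟩

omit [L.Additive] [R.Additive] [PreservesFiniteColimits L] [PreservesFiniteLimits R]
  [Preadditive ℰ] in
variable {L R} in
theorem epi_of_left_right {X Y : Comma L R} (f : X ⟶ Y) [Epi f.left] [Epi f.right] :
    Epi f :=
  ⟨fun a b hab => by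
    ext
    · exact (cancel_epi f.left).1 (congr_arg (·.left) hab)
    · exact (cancel_epi f.right).1 (congr_arg (·.right) hab)⟩

theorem shortExact_iff (S : ShortComplex (Comma L R)) :
    S.ShortExact ↔ (S.map (fst L R)).ShortExact ∧ (S.map (snd L R)).ShortExact := by
  refine ⟨fun h => ⟨h.map_of_exact _, h.map_of_exact _⟩, fun ⟨h₁, h₂⟩ => ?_⟩
  have hf₁ : Mono S.f.left := h₁.mono_f
  have hf₂ : Mono S.f.right := h₂.mono_f
  have hg₁ : Epi S.g.left := h₁.epi_g
  have hg₂ : Epi S.g.right := h₂.epi_g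
  have := mono_of_left_right S.f
  have := epi_of_left_right S.g
  refine ShortComplex.ShortExact.of_lift S.zero fun {D} k hk => ?_
  obtain ⟨a, ha⟩ := ShortComplex.ShortExact.exists_lift (w := congr_arg (·.left) S.zero) h₁ k.left
    (congr_arg (·.left) hk)
  obtain ⟨b, hb⟩ := ShortComplex.ShortExact.exists_lift (w := congr_arg (·.right) S.zero) h₂ k.right
    (congr_arg (·.right) hk)
  have hR : Mono (R.map S.f.right) := inferInstance
  refine ⟨⟨a, b, ?_⟩, by ext; exacts [ha, hb]⟩
  have ha : a ≫ S.f.left = k.left := ha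
  have hb : b ≫ S.f.right = k.right := hb
  rw [← cancel_mono (R.map S.f.right), Category.assoc, Category.assoc, ← R.map_comp, hb,
    ← S.f.w, ← L.map_comp_assoc, ha, k.w]

end CategoryTheory.Comma

/-! ## The tensor product is right exact -/

section Tensor

variable (A B : Type u) [Ring A] [Ring B] (M : Type u) [AddCommGroup M] [Module A M]
  [Module Bᵐᵒᵖ M] [SMulCommClass A Bᵐᵒᵖ M]

/-- The group `Hom_A(M, X)` as a left `B`-module. -/
def BimoduleHom (X : Type u) [AddCommGroup X] [Module A X] : Type u := M →ₗ[A] X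

namespace BimoduleHom

variable (X : Type u) [AddCommGroup X] [Module A X]

instance : AddCommGroup (BimoduleHom A M X) := inferInstanceAs (AddCommGroup (M →ₗ[A] X))

/-- The endomorphism `m ↦ m b` of `M`. -/
def rightMul (b : B) : M →ₗ[A] M where
  toFun m := MulOpposite.op b • m
  map_add' := smul_add _
  map_smul' a m := (smul_comm a (MulOpposite.op b) m).symm

instance : Module B (BimoduleHom A M X) where
  smul b h := LinearMap.comp (M₂ := M) h (rightMul A B M b)
  one_smul h := LinearMap.ext fun m => congr_arg (DFunLike.coe (F := M →ₗ[A] X) h) (one_smul Bᵐᵒᵖ m)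
  mul_smul b b' h := LinearMap.ext fun m =>
    congr_arg (DFunLike.coe (F := M →ₗ[A] X) h) (mul_smul (MulOpposite.op b') (MulOpposite.op b) m)
  smul_zero _ := LinearMap.zero_comp _
  smul_add _ _ _ := LinearMap.add_comp _ _ _
  zero_smul h := LinearMap.ext fun m =>
    (congr_arg (DFunLike.coe (F := M →ₗ[A] X) h) (zero_smul Bᵐᵒᵖ m)).trans (LinearMap.map_zero _)
  add_smul b b' h := LinearMap.ext fun m => (congr_arg (DFunLike.coe (F := M →ₗ[A] X) h)
    (add_smul (MulOpposite.op b) (MulOpposite.op b') m)).trans (LinearMap.map_add _ _ _)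

/-- The underlying homomorphism `M ⟶ X`. -/
def toHom : BimoduleHom A M X →+ M →ₗ[A] X := AddMonoidHom.id _

variable {A B M X} {Y : Type u} [AddCommGroup Y] [Module B Y]

theorem toHom_smul (b : B) (h : BimoduleHom A M X) (m : M) :
    toHom A M X (b • h) m = toHom A M X h (MulOpposite.op b • m) := rfl

/-- The `B`-homomorphism `Y ⟶ Hom_A(M, X)` attached to `f : M ⊗_B Y ⟶ X`. -/
def curry (f : BimoduleTensor A B M Y →ₗ[A] X) : Y →ₗ[B] BimoduleHom A M X where
  toFun y :=
    { toFun m := f (Submodule.Quotient.mk (m ⊗ₜ[ℤ] y))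
      map_add' m m' := by rw [TensorProduct.add_tmul, Submodule.Quotient.mk_add, map_add]
      map_smul' a m := by
        rw [← TensorProduct.smul_tmul', Submodule.Quotient.mk_smul, map_smul, RingHom.id_apply] }
  map_add' y y' := LinearMap.ext fun m => by
    refine (congr_arg f ?_).trans (map_add f _ _)
    rw [TensorProduct.tmul_add, Submodule.Quotient.mk_add]
  map_smul' b y := LinearMap.ext fun m => congr_arg f (((Submodule.Quotient.eq
    (balancedRelations A B M Y)).2 (Submodule.subset_span ⟨m, b, y, rfl⟩)).symm)

/-- The homomorphism `M ⊗_B Y ⟶ X` attached to `g : Y ⟶ Hom_A(M, X)`. -/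
def uncurry (g : Y →ₗ[B] BimoduleHom A M X) : BimoduleTensor A B M Y →ₗ[A] X :=
  (balancedRelations A B M Y).liftQ
    (TensorProduct.AlgebraTensorModule.lift
      { toFun m := (((LinearMap.toAddMonoidHom'.flip m).comp
            (toHom A M X)).comp g.toAddMonoidHom).toIntLinearMap
        map_add' m m' := LinearMap.ext fun y => map_add (toHom A M X (g y)) m m'
        map_smul' a m := LinearMap.ext fun y => map_smul (toHom A M X (g y)) a m }) (by
    rw [balancedRelations, Submodule.span_le]
    rintro _ ⟨m, b, y, rfl⟩
    have : toHom A M X (g (b • y)) m = toHom A M X (g y) (MulOpposite.op b • m) := by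
      rw [g.map_smul, toHom_smul]
    rw [SetLike.mem_coe, LinearMap.mem_ker, map_sub, sub_eq_zero]
    exact this.symm)

end BimoduleHom

/-- The functor `Hom_A(M, -) : A-Mod ⥤ B-Mod`. -/
def bimoduleHomFunctor : ModuleCat.{u} A ⥤ ModuleCat.{u} B where
  obj X := ModuleCat.of B (BimoduleHom A M X)
  map {X X'} f := ModuleCat.ofHom
    { toFun h := LinearMap.comp (M₂ := X) f.hom h
      map_add' h h' := LinearMap.comp_add (M₂ := X) _ _ _
      map_smul' _ _ := rfl }

/-- The adjunction between `M ⊗_B -` and `Hom_A(M, -)`. -/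
def tensorHomAdjunction : tensorFunctor A B M ⊣ bimoduleHomFunctor A B M :=
  Adjunction.mkOfHomEquiv
    { homEquiv _ _ :=
        { toFun f := ModuleCat.ofHom (BimoduleHom.curry f.hom)
          invFun g := ModuleCat.ofHom (BimoduleHom.uncurry g.hom)
          left_inv _ := ModuleCat.hom_ext (BimoduleTensor.hom_ext A B M fun _ _ => rfl)
          right_inv _ := rfl }
      homEquiv_naturality_left_symm _ _ :=
        ModuleCat.hom_ext (BimoduleTensor.hom_ext A B M fun _ _ => rfl)
      homEquiv_naturality_right _ _ := rfl }

instance tensorFunctor_preservesColimits : PreservesColimitsOfSize.{v, v} (tensorFunctor A B M) :=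
  (tensorHomAdjunction A B M).leftAdjoint_preservesColimits

instance tensorFunctor_preservesFiniteColimits : PreservesFiniteColimits (tensorFunctor A B M) :=
  PreservesColimits.preservesFiniteColimits _

end Tensor

/-! ## Resolving subcategories -/

section Resolving

variable {𝒜 : Type u} [Category.{v} 𝒜] [Abelian 𝒜]

namespace CategoryTheory.ShortComplex.ShortExact

theorem of_isIso {X Y Z : 𝒜} {f : X ⟶ Y} {g : Y ⟶ Z} (w : f ≫ g = 0) [IsIso f] (hZ : IsZero Z) :
    (ShortComplex.mk f g w).ShortExact := by
  have : Epi g := ⟨fun _ _ _ => hZ.eq_of_src _ _⟩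
  exact of_lift w fun k _ => ⟨k ≫ inv f, by simp⟩

/-- A morphism of short exact sequences that is the identity on the cokernels gives a pushout
square. -/
theorem isPushout {K Q X Y Z : 𝒜} {k : K ⟶ Q} {p : Q ⟶ Z} {w : k ≫ p = 0}
    (h : (ShortComplex.mk k p w).ShortExact) {f : X ⟶ Y} {g : Y ⟶ Z} {w' : f ≫ g = 0}
    (h' : (ShortComplex.mk f g w').ShortExact) (a : K ⟶ X) (b : Q ⟶ Y) (ha : k ≫ b = a ≫ f)
    (hb : b ≫ g = p) : IsPushout k a b f := by
  have : Mono k := h.mono_f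
  have : Mono f := h'.mono_f
  have : Epi p := h.epi_g
  have : Mono (biprod.lift k (-a)) := mono_of_mono_fac (biprod.lift_fst k (-a))
  have : Epi (biprod.desc b f) := by
    refine Preadditive.epi_of_cancel_zero _ fun z hz => ?_
    have h₁ : b ≫ z = 0 := by simpa using biprod.inl ≫= hz
    have h₂ : f ≫ z = 0 := by simpa using biprod.inr ≫= hz
    obtain ⟨l, rfl⟩ := h'.exists_desc z h₂
    rw [← Category.assoc, hb] at h₁
    rw [(cancel_epi p).1 (h₁.trans comp_zero.symm), comp_zero]
  have hS : (ShortComplex.mk (biprod.lift k (-a)) (biprod.desc b f) (by simp [ha])).ShortExact := by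
    refine of_lift _ fun {D} m hm => ?_
    have hm' : (m ≫ biprod.fst) ≫ b = -((m ≫ biprod.snd) ≫ f) := by
      rw [biprod.desc_eq, Preadditive.comp_add] at hm
      simpa using eq_neg_of_add_eq_zero_left hm
    obtain ⟨l, hl⟩ := h.exists_lift (m ≫ biprod.fst) (by
      rw [← hb, ← Category.assoc, hm', Preadditive.neg_comp, Category.assoc, w', comp_zero,
        neg_zero])
    refine ⟨l, ?_⟩
    ext
    · simpa using hl
    · rw [← cancel_mono f]
      rw [← hl, Category.assoc, ha] at hm'
      simp [hm']
  have sq : CommSq k a b f := ⟨ha⟩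
  exact ⟨sq, ⟨sq.isColimitEquivIsColimitCokernelCofork.symm hS.gIsCokernel⟩⟩

end CategoryTheory.ShortComplex.ShortExact

variable {P : ObjectProperty 𝒜} (hP : IsResolving P)

theorem relProjective_of_projective {X : 𝒜} (hX : P X) [Projective X] : relProjective P X :=
  ⟨hX, fun S hS _ _ _ f => have := hS.epi_g; ⟨Projective.factorThru f S.g, by simp⟩⟩

theorem relInjective.exists_extension {I : 𝒜} (hI : relInjective P I) {X Y Z : 𝒜} {f : X ⟶ Y}
    {g : Y ⟶ Z} {w : f ≫ g = 0} (hS : (ShortComplex.mk f g w).ShortExact) (hX : P X) (hY : P Y)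
    (hZ : P Z) (a : X ⟶ I) : ∃ b : Y ⟶ I, f ≫ b = a := hI.2 _ hS hX hY hZ a

/-- The relative injective objects are closed under retracts. -/
theorem relInjective_of_retract {X Y : 𝒜} (r : Retract X Y) (hX : P X) (hY : relInjective P Y) :
    relInjective P X :=
  ⟨hX, fun S hS h₁ h₂ h₃ f => by
    obtain ⟨g, hg⟩ := hY.2 S hS h₁ h₂ h₃ (f ≫ r.i)
    exact ⟨g ≫ r.r, by dsimp only at hg ⊢; rw [reassoc_of% hg, r.retract, Category.comp_id]⟩⟩

theorem relInjective_biprod [P.IsClosedUnderExtensions] {X Y : 𝒜} (hX : relInjective P X)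
    (hY : relInjective P Y) : relInjective P (X ⊞ Y) :=
  ⟨P.prop_biprod hX.1 hY.1, fun S hS h₁ h₂ h₃ f => by
    obtain ⟨g, hg⟩ := hX.2 S hS h₁ h₂ h₃ (f ≫ biprod.fst)
    obtain ⟨g', hg'⟩ := hY.2 S hS h₁ h₂ h₃ (f ≫ biprod.snd)
    refine ⟨biprod.lift g g', ?_⟩
    dsimp only at hg hg' ⊢
    ext <;> simp [hg, hg']⟩

namespace IsResolving

include hP

theorem relProjective_iff [EnoughProjectives 𝒜] (X : 𝒜) : relProjective P X ↔ Projective X := by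
  refine ⟨fun hX => ?_, fun hX => relProjective_of_projective (hP.projective X hX)⟩
  have hS := ShortComplex.ShortExact.of_epi (Projective.π X)
  have hQ : P (Projective.over X) := hP.projective _ inferInstance
  obtain ⟨s, hs⟩ := hX.2 _ hS (hP.kernels _ hS hQ hX.1) hQ hX.1 (𝟙 X)
  exact Retract.projective ⟨s, Projective.π X, hs⟩

/-- A resolving subcategory is a Frobenius category as soon as its projective objects are
injective and all its objects embed into projective objects. -/
theorem isFrobenius [EnoughProjectives 𝒜] (h : ∀ X, Projective X → relInjective P X)
    (h' : ∀ X, P X → ∃ (Q C : 𝒜) (i : X ⟶ Q) (p : Q ⟶ C) (w : i ≫ p = 0),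
      (ShortComplex.mk i p w).ShortExact ∧ Projective Q ∧ P C) : IsFrobenius P where
  closedUnderExtensions := hP.extensions
  enoughProjectives X hX := by
    have hS := ShortComplex.ShortExact.of_epi (Projective.π X)
    have hQ : P (Projective.over X) := hP.projective _ inferInstance
    exact ⟨_, _, _, _, _, hS, hP.kernels _ hS hQ hX, relProjective_of_projective hQ⟩
  enoughInjectives X hX := by
    obtain ⟨Q, C, i, p, w, hS, hQ, hC⟩ := h' X hX
    exact ⟨Q, C, i, p, w, hS, h Q hQ, hC⟩
  injective_iff_projective X := by
    rw [hP.relProjective_iff]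
    refine ⟨fun hX => ?_, h X⟩
    obtain ⟨Q, C, i, p, w, hS, hQ, hC⟩ := h' X hX.1
    obtain ⟨r, hr⟩ := hX.2 _ hS hX.1 (hP.projective Q hQ) hC (𝟙 X)
    exact Retract.projective ⟨i, r, hr⟩

/-- Embeddings of the outer terms of an extension into projective objects give an embedding of
the middle term. -/
theorem exists_embedding_of_shortExact (h : ∀ X, Projective X → relInjective P X)
    {S : ShortComplex 𝒜} (hS : S.ShortExact) (h₁ : P S.X₁) (h₂ : P S.X₂) (h₃ : P S.X₃)
    {Q C : 𝒜} {i : S.X₁ ⟶ Q} {p : Q ⟶ C} {w : i ≫ p = 0}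
    (hE : (ShortComplex.mk i p w).ShortExact) (hQ : Projective Q) (hC : P C)
    {Q' C' : 𝒜} {i' : S.X₃ ⟶ Q'} {p' : Q' ⟶ C'} {w' : i' ≫ p' = 0}
    (hE' : (ShortComplex.mk i' p' w').ShortExact) (hQ' : Projective Q') (hC' : P C') :
    ∃ (Q C : 𝒜) (i : S.X₂ ⟶ Q) (p : Q ⟶ C) (w : i ≫ p = 0),
      (ShortComplex.mk i p w).ShortExact ∧ Projective Q ∧ P C := by
  have := hP.extensions
  obtain ⟨a, ha⟩ := (h Q hQ).2 S hS h₁ h₂ h₃ i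
  obtain ⟨b, hb⟩ := ShortComplex.ShortExact.exists_desc (w := S.zero) hS (a ≫ p) (by
    rw [← Category.assoc]; exact (congr_arg (· ≫ p) ha).trans w)
  have hR := rotate_shortExact (w := S.zero) hS hE a b ha hb
  have hR' : (ShortComplex.mk (biprod.map i' (𝟙 Q)) (biprod.fst ≫ p') (by simp [w'])).ShortExact := by
    have : Mono i' := hE'.mono_f
    have : Epi p' := hE'.epi_g
    have : Epi (biprod.fst ≫ p' : Q' ⊞ Q ⟶ C') := epi_comp _ _
    refine ShortComplex.ShortExact.of_lift _ fun k hk => ?_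
    obtain ⟨l, hl⟩ := hE'.exists_lift (k ≫ biprod.fst) (by rw [Category.assoc, hk])
    exact ⟨biprod.lift l (k ≫ biprod.snd), by ext <;> simp [hl]⟩
  obtain ⟨c, d, w'', -, -, hT⟩ := comp_shortExact hR hR'
  have : Mono (biprod.lift S.g a) := hR.mono_f
  have : Mono (biprod.map i' (𝟙 Q)) := hR'.mono_f
  exact ⟨_, _, _, _, _, ShortComplex.ShortExact.of_mono (biprod.lift S.g a ≫ biprod.map i' (𝟙 Q)),
    inferInstance, P.prop_X₂_of_shortExact hT hC hC'⟩

end IsResolving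

end Resolving

section Triple

variable {A B : Type u} [Ring A] [Ring B] (M : Type u) [AddCommGroup M] [Module A M]
  [Module Bᵐᵒᵖ M] [SMulCommClass A Bᵐᵒᵖ M]

/-! ## Triples -/

theorem isZero_left_tripleZero (X : ModuleCat.{u} A) : IsZero ((tripleZero A B M).obj X).left :=
  ModuleCat.isZero_of_subsingleton (ModuleCat.of B PUnit)

instance tripleZero_additive : (tripleZero A B M).Additive where
  map_add {X Y f g} := by
    ext : 1
    · exact (isZero_left_tripleZero M X).eq_of_src _ _
    · rfl

instance tripleTensor_additive : (tripleTensor A B M).Additive where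
  map_add {X Y f g} := by
    ext : 1
    · rfl
    · exact (tensorFunctor A B M).map_add

namespace TripleRep

variable {M}

/-- The structure map of a triple. -/
def φ (U : TripleRep A B M) : (tensorFunctor A B M).obj U.left ⟶ U.right := U.hom

/-- The projection onto the cokernel of the structure map. -/
noncomputable def π (U : TripleRep A B M) : U.right ⟶ (tripleCoker A B M).obj U :=
  cokernel.π U.hom

instance (U : TripleRep A B M) : Epi U.π := inferInstanceAs (Epi (cokernel.π U.hom))

variable (U : TripleRep A B M) {V : TripleRep A B M} (f : U ⟶ V)

theorem φ_π : U.φ ≫ U.π = 0 := cokernel.condition U.hom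

variable {U}

theorem map_φ : (tensorFunctor A B M).map f.left ≫ V.φ = U.φ ≫ f.right := f.w

theorem map_π : U.π ≫ (tripleCoker A B M).map f = f.right ≫ V.π := cokernel.π_desc _ _ _

theorem exists_π_comp {D : ModuleCat.{u} A} (k : U.right ⟶ D) (hk : U.φ ≫ k = 0) :
    ∃ l, U.π ≫ l = k := ⟨cokernel.desc U.hom k hk, cokernel.π_desc _ _ _⟩

/-- The short exact sequence `0 ⟶ M ⊗_B Y ⟶ X ⟶ Coker φ ⟶ 0`. -/
theorem shortExact (hU : Mono U.φ) : (ShortComplex.mk U.φ U.π U.φ_π).ShortExact :=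
  ShortComplex.ShortExact.of_mono U.φ

end TripleRep

instance tripleCoker_additive : (tripleCoker A B M).Additive where
  map_add {U V f g} := by
    rw [← cancel_epi U.π, Preadditive.comp_add, TripleRep.map_π, TripleRep.map_π, TripleRep.map_π]
    exact Preadditive.add_comp _ _ _ f.right g.right V.π

theorem tripleZero_shortExact {S : ShortComplex (ModuleCat.{u} A)} (hS : S.ShortExact) :
    (S.map (tripleZero A B M)).ShortExact :=
  (Comma.shortExact_iff _ _ _).2 ⟨ShortComplex.ShortExact.of_isIso (f := 𝟙 (ModuleCat.of B PUnit))
    ((isZero_left_tripleZero M S.X₁).eq_of_src _ _) (isZero_left_tripleZero M S.X₃), hS⟩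

theorem tripleTensor_shortExact {S : ShortComplex (ModuleCat.{u} B)} (hS : S.ShortExact)
    (hS' : (S.map (tensorFunctor A B M)).ShortExact) : (S.map (tripleTensor A B M)).ShortExact :=
  (Comma.shortExact_iff _ _ _).2 ⟨hS, hS'⟩

variable {M} in
/-- The cokernels of a short exact sequence of triples whose structure maps are injective form a
short exact sequence. -/
theorem tripleCoker_shortExact {S : ShortComplex (TripleRep A B M)} (hS : S.ShortExact)
    (hT : (S.map (Comma.fst _ _ ⋙ tensorFunctor A B M)).ShortExact)
    (h₃ : Mono S.X₃.φ) :
    (S.map (tripleCoker A B M)).ShortExact := by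
  have hR : (ShortComplex.mk S.f.right S.g.right (congr_arg (·.right) S.zero)).ShortExact :=
    ((Comma.shortExact_iff _ _ _).1 hS).2
  have wT : (tensorFunctor A B M).map S.f.left ≫ (tensorFunctor A B M).map S.g.left = 0 :=
    ShortComplex.zero (S.map (Comma.fst _ _ ⋙ tensorFunctor A B M))
  replace hT : (ShortComplex.mk _ _ wT).ShortExact := hT
  have := hR.mono_f
  have : Epi S.g.right := hR.epi_g
  have := hT.mono_f
  have : Epi ((tensorFunctor A B M).map S.g.left) := hT.epi_g
  have key {D : ModuleCat.{u} A} (u : D ⟶ S.X₁.right) (v : D ⟶ (tensorFunctor A B M).obj S.X₂.left)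
      (h : u ≫ S.f.right = v ≫ S.X₂.φ) :
      ∃ l, l ≫ S.X₁.φ = u ∧ l ≫ (tensorFunctor A B M).map S.f.left = v := by
    obtain ⟨l, hl⟩ := hT.exists_lift v (by
      rw [← cancel_mono S.X₃.φ, Category.assoc, TripleRep.map_φ, ← reassoc_of% h,
        ← Comma.comp_right, S.zero]
      exact comp_zero.trans zero_comp.symm)
    refine ⟨l, ?_, hl⟩
    rw [← cancel_mono S.f.right, Category.assoc, ← TripleRep.map_φ, ← Category.assoc, hl, h]
  have sq : IsPullback S.X₁.φ ((tensorFunctor A B M).map S.f.left) S.f.right S.X₂.φ :=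
    ⟨⟨(TripleRep.map_φ S.f).symm⟩, ⟨PullbackCone.IsLimit.mk _
      (fun s => (key s.fst s.snd s.condition).choose)
      (fun s => (key s.fst s.snd s.condition).choose_spec.1)
      (fun s => (key s.fst s.snd s.condition).choose_spec.2) (fun s m _ hm => by
        rw [← cancel_mono ((tensorFunctor A B M).map S.f.left), hm,
          (key s.fst s.snd s.condition).choose_spec.2])⟩⟩
  have : Mono ((tripleCoker A B M).map S.f) := Abelian.mono_cokernel_map_of_isPullback sq
  have : Epi ((tripleCoker A B M).map S.g) := by
    have : Epi (S.X₂.π ≫ (tripleCoker A B M).map S.g) := by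
      rw [TripleRep.map_π]
      exact epi_comp _ _
    exact epi_of_epi S.X₂.π _
  refine ShortComplex.ShortExact.of_desc _ fun {D} k hk => ?_
  obtain ⟨l, hl⟩ := hR.exists_desc (S.X₂.π ≫ k) (by
    rw [← Category.assoc, ← TripleRep.map_π, Category.assoc, hk, comp_zero])
  obtain ⟨m, hm⟩ := TripleRep.exists_π_comp l (by
    rw [← cancel_epi ((tensorFunctor A B M).map S.g.left), ← Category.assoc, TripleRep.map_φ,
      Category.assoc, hl, ← Category.assoc, TripleRep.φ_π, zero_comp, comp_zero])
  refine ⟨m, ?_⟩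
  rw [← cancel_epi S.X₂.π, ← Category.assoc, TripleRep.map_π, Category.assoc, hm, hl]

variable {M}

/-- The morphism of triples `(M ⊗_B Y, Y) ⟶ U` attached to `Y ⟶ U.left`. -/
def tripleTensorDesc {Y : ModuleCat.{u} B} {U : TripleRep A B M} (f : Y ⟶ U.left) :
    (tripleTensor A B M).obj Y ⟶ U where
  left := f
  right := (tensorFunctor A B M).map f ≫ U.φ
  w := (Category.id_comp _).symm

theorem tripleTensor_hom_ext {Y : ModuleCat.{u} B} {U : TripleRep A B M}
    {f g : (tripleTensor A B M).obj Y ⟶ U} (h : f.left = g.left) : f = g := by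
  ext : 1
  · exact h
  · have hf := (Category.id_comp _).symm.trans (TripleRep.map_φ f).symm
    have hg := (Category.id_comp _).symm.trans (TripleRep.map_φ g).symm
    exact hf.trans ((congr_arg (fun k => (tensorFunctor A B M).map k ≫ U.φ) h).trans hg.symm)

/-- The morphism of triples `(X, 0) ⟶ U` attached to `X ⟶ U.right`. -/
def tripleZeroDesc {X : ModuleCat.{u} A} {U : TripleRep A B M} (f : X ⟶ U.right) :
    (tripleZero A B M).obj X ⟶ U where
  left := 0
  right := f
  w := by
    rw [(tensorFunctor A B M).map_zero, zero_comp]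
    exact zero_comp.symm

theorem tripleZero_hom_ext {X : ModuleCat.{u} A} {U : TripleRep A B M}
    {f g : (tripleZero A B M).obj X ⟶ U} (h : f.right = g.right) : f = g := by
  ext : 1
  · exact (isZero_left_tripleZero M X).eq_of_src _ _
  · exact h

/-- The morphism of triples `U ⟶ (X, 0)` attached to `U.right ⟶ X`. -/
def tripleZeroLift {X : ModuleCat.{u} A} {U : TripleRep A B M} (f : U.right ⟶ X)
    (hf : U.φ ≫ f = 0) : U ⟶ (tripleZero A B M).obj X where
  left := 0
  right := f
  w := comp_zero.trans hf.symm

theorem hom_tripleZero_ext {X : ModuleCat.{u} A} {U : TripleRep A B M}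
    {f g : U ⟶ (tripleZero A B M).obj X} (h : f.right = g.right) : f = g := by
  ext : 1
  · exact (isZero_left_tripleZero M X).eq_of_tgt _ _
  · exact h

theorem φ_comp_right {X : ModuleCat.{u} A} {U : TripleRep A B M}
    (f : U ⟶ (tripleZero A B M).obj X) : U.φ ≫ f.right = 0 :=
  (TripleRep.map_φ f).symm.trans comp_zero

/-- The short exact sequence `0 ⟶ (M ⊗_B Y, Y) ⟶ (X, Y) ⟶ (Coker φ, 0) ⟶ 0`. -/
theorem TripleRep.shortExact_tripleTensor {U : TripleRep A B M} (hU : Mono U.φ) :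
    (ShortComplex.mk (tripleTensorDesc (U := U) (𝟙 U.left)) (tripleZeroLift U.π U.φ_π)
      (tripleTensor_hom_ext (comp_zero (f := 𝟙 U.left)) : _ = (0 : _ ⟶ _))).ShortExact := by
  refine (Comma.shortExact_iff _ _ _).2 ⟨ShortComplex.ShortExact.of_isIso (f := 𝟙 U.left)
    comp_zero (isZero_left_tripleZero M ((tripleCoker A B M).obj U)), ?_⟩
  refine ShortComplex.shortExact_of_iso ?_ (TripleRep.shortExact hU)
  exact ShortComplex.isoMk (Iso.refl _) (Iso.refl _) (Iso.refl _) (by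
    refine (Category.id_comp _).trans (Eq.trans ?_ (Category.comp_id _).symm)
    change (tensorFunctor A B M).map (𝟙 U.left) ≫ U.φ = U.φ
    rw [CategoryTheory.Functor.map_id, Category.id_comp])
    ((Category.id_comp _).trans (Category.comp_id _).symm)

instance projective_tripleZero (X : ModuleCat.{u} A) [Projective X] :
    Projective ((tripleZero A B M).obj X) where
  factors {E V} f e he := by
    have : Epi e.right := inferInstanceAs (Epi ((Comma.snd _ _).map e))
    let f' : X ⟶ V.right := f.right
    exact ⟨tripleZeroDesc (Projective.factorThru f' e.right),
      tripleZero_hom_ext (Projective.factorThru_comp f' e.right)⟩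

instance projective_tripleTensor (Y : ModuleCat.{u} B) [Projective Y] :
    Projective ((tripleTensor A B M).obj Y) where
  factors {E V} f e he := by
    have : Epi e.left := inferInstanceAs (Epi ((Comma.fst _ _).map e))
    let f' : Y ⟶ V.left := f.left
    exact ⟨tripleTensorDesc (Projective.factorThru f' e.left),
      tripleTensor_hom_ext (Projective.factorThru_comp f' e.left)⟩

theorem projective_left (U : TripleRep A B M) [Projective U] : Projective U.left where
  factors {E Z} f e he := by
    let E' : TripleRep A B M := ⟨E, ModuleCat.of A PUnit, 0⟩
    let Z' : TripleRep A B M := ⟨Z, ModuleCat.of A PUnit, 0⟩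
    let e' : E' ⟶ Z' := { left := e, right := 𝟙 _, w := comp_zero.trans zero_comp.symm }
    let f' : U ⟶ Z' := { left := f, right := 0, w := comp_zero.trans comp_zero.symm }
    have : Epi e'.left := he
    have : Epi e'.right := inferInstanceAs (Epi (𝟙 _))
    have := Comma.epi_of_left_right e'
    exact ⟨(Projective.factorThru f' e').left,
      congr_arg (·.left) (Projective.factorThru_comp f' e')⟩

theorem projective_tripleCoker (U : TripleRep A B M) [Projective U] :
    Projective ((tripleCoker A B M).obj U) where
  factors {E Z} f e he := by
    let f' : U ⟶ (tripleZero A B M).obj Z :=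
      tripleZeroLift (U.π ≫ f) (by rw [← Category.assoc, TripleRep.φ_π, zero_comp])
    have : Epi ((tripleZero A B M).map e).left := inferInstanceAs (Epi (𝟙 _))
    have : Epi ((tripleZero A B M).map e).right := he
    have := Comma.epi_of_left_right ((tripleZero A B M).map e)
    let g := Projective.factorThru f' ((tripleZero A B M).map e)
    let g' : U.right ⟶ E := g.right
    have hg : g' ≫ e = U.π ≫ f :=
      congr_arg (·.right) (Projective.factorThru_comp f' ((tripleZero A B M).map e))
    obtain ⟨l, hl⟩ := TripleRep.exists_π_comp g' (φ_comp_right g)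
    exact ⟨l, by rw [← cancel_epi U.π, ← Category.assoc, hl, hg]⟩

theorem exists_projective_cover (U : TripleRep A B M) :
    ∃ (Q : ModuleCat.{u} B) (P : ModuleCat.{u} A)
      (p : ((tripleTensor A B M).obj Q ⊞ (tripleZero A B M).obj P) ⟶ U),
      Projective Q ∧ Projective P ∧ Epi p := by
  let p : Projective.over U.left ⟶ U.left := Projective.π U.left
  let q : Projective.over U.right ⟶ U.right := Projective.π U.right
  let r := biprod.desc (tripleTensorDesc p) (tripleZeroDesc q)
  have h₁ : biprod.inl ≫ r = _ := biprod.inl_desc _ _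
  have h₂ : biprod.inr ≫ r = _ := biprod.inr_desc _ _
  have : Epi (tripleTensorDesc p).left := inferInstanceAs (Epi p)
  have : Epi (tripleZeroDesc q).right := inferInstanceAs (Epi q)
  have : Epi r.left := epi_of_epi_fac (congr_arg (·.left) h₁)
  have : Epi r.right := epi_of_epi_fac (congr_arg (·.right) h₂)
  exact ⟨_, _, r, inferInstanceAs (Projective (Projective.over U.left)),
    inferInstanceAs (Projective (Projective.over U.right)), Comma.epi_of_left_right r⟩

instance enoughProjectives_tripleRep : EnoughProjectives (TripleRep A B M) where
  presentation U := by
    obtain ⟨Q, P, p, _, _, _⟩ := exists_projective_cover U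
    exact ⟨{ p := _, f := p }⟩

end Triple

/-! ## Consequences of resolution -/

section MonoRep

variable {A B : Type u} [Ring A] [Ring B] {M : Type u} [AddCommGroup M] [Module A M]
  [Module Bᵐᵒᵖ M] [SMulCommClass A Bᵐᵒᵖ M]
  {𝒳 : ObjectProperty (ModuleCat.{u} A)} [𝒳.IsClosedUnderIsomorphisms] [𝒳.ContainsZero]
  {𝒴 : ObjectProperty (ModuleCat.{u} B)} [𝒴.IsClosedUnderIsomorphisms] [𝒴.ContainsZero]

theorem monoRep.mono_φ {U : TripleRep A B M} (hU : monoRep M 𝒳 𝒴 U) : Mono U.φ :=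
  (ModuleCat.mono_iff_injective _).2 hU.2.2

theorem monoRep_tripleZero_iff (X : ModuleCat.{u} A) :
    monoRep M 𝒳 𝒴 ((tripleZero A B M).obj X) ↔ 𝒳 X :=
  ⟨fun h => 𝒳.prop_of_iso (cokernelZeroIsoTarget
    (X := (tensorFunctor A B M).obj (ModuleCat.of B PUnit)) (Y := X)) h.2.1,
    fun h => tripleZero_mem M 𝒳 𝒴 h⟩

theorem monoRep_tripleTensor_iff (Y : ModuleCat.{u} B) :
    monoRep M 𝒳 𝒴 ((tripleTensor A B M).obj Y) ↔ 𝒴 Y :=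
  ⟨fun h => h.1, fun h => tripleTensor_mem M 𝒳 𝒴 h⟩

instance monoRep_containsZero : (monoRep M 𝒳 𝒴).ContainsZero := by
  obtain ⟨Z, hZ, h⟩ := 𝒳.exists_prop_of_containsZero
  exact ⟨_, (tripleZero A B M).map_isZero hZ, tripleZero_mem M 𝒳 𝒴 h⟩

end MonoRep

section MonoRepFrobenius

variable {A B : Type u} [Ring A] [Ring B] {M : Type u} [AddCommGroup M] [Module A M]
  [Module Bᵐᵒᵖ M] [SMulCommClass A Bᵐᵒᵖ M]
  {𝒳 : ObjectProperty (ModuleCat.{u} A)} [𝒳.IsClosedUnderIsomorphisms] [𝒳.ContainsZero]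
  {𝒴 : ObjectProperty (ModuleCat.{u} B)} [𝒴.IsClosedUnderIsomorphisms] [𝒴.ContainsZero]
  (hres : IsResolving (monoRep M 𝒳 𝒴))

namespace IsResolving

include hres

/-- The functor `M ⊗_B -` is exact on short exact sequences with cokernel in `𝒴`. -/
theorem tensor_shortExact {S : ShortComplex (ModuleCat.{u} B)} (hS : S.ShortExact)
    (h₃ : 𝒴 S.X₃) : (S.map (tensorFunctor A B M)).ShortExact := by
  have := hS.epi_g
  let p : Projective.over S.X₃ ⟶ S.X₃ := Projective.π S.X₃
  let f := (tripleTensor A B M).map p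
  have : Epi f.left := inferInstanceAs (Epi p)
  have : Epi f.right := inferInstanceAs (Epi ((tensorFunctor A B M).map p))
  have : Epi f := Comma.epi_of_left_right f
  have hE := ShortComplex.ShortExact.of_epi f
  have hK : monoRep M 𝒳 𝒴 (kernel f) :=
    hres.kernels _ hE (hres.projective ((tripleTensor A B M).obj (Projective.over S.X₃))
      inferInstance) (tripleTensor_mem M 𝒳 𝒴 h₃)
  have hm : Mono (kernel.ι f).right := inferInstanceAs (Mono ((Comma.snd _ _).map (kernel.ι f)))
  let k : (kernel f).left ⟶ Projective.over S.X₃ := (kernel.ι f).left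
  have : Mono ((tensorFunctor A B M).map k) := by
    have h : (tensorFunctor A B M).map k = (kernel f).φ ≫ (kernel.ι f).right :=
      (Category.comp_id _).symm.trans (TripleRep.map_φ (kernel.ι f))
    rw [h]
    exact mono_comp' hK.mono_φ hm
  have hE' : (ShortComplex.mk k p (congr_arg (·.left) (kernel.condition f))).ShortExact :=
    ((Comma.shortExact_iff _ _ _).1 hE).1
  let b : Projective.over S.X₃ ⟶ S.X₂ := Projective.factorThru p S.g
  have hb : b ≫ S.g = p := Projective.factorThru_comp _ _
  obtain ⟨a, ha⟩ := ShortComplex.ShortExact.exists_lift (w := S.zero) hS (k ≫ b) (by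
    rw [Category.assoc, hb]
    exact congr_arg (·.left) (kernel.condition f))
  have sq := (ShortComplex.ShortExact.isPushout (w' := S.zero) hE' hS a b ha.symm hb).map
    (tensorFunctor A B M)
  exact
    { exact := hS.exact.map_of_epi_of_preservesCokernel _ inferInstance inferInstance
      mono_f := Abelian.mono_inr_of_isColimit _ _ sq.isColimit
      epi_g := inferInstanceAs (Epi ((tensorFunctor A B M).map S.g)) }

theorem isResolving_left : IsResolving 𝒴 where
  projective Q _ := (monoRep_tripleTensor_iff (𝒳 := 𝒳) (M := M) Q).1
    (hres.projective _ inferInstance)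
  retracts :=
    { of_retract {X Y} r h := by
        have := hres.retracts
        exact (monoRep_tripleTensor_iff (𝒳 := 𝒳) (M := M) X).1
          ((monoRep M 𝒳 𝒴).prop_of_retract (r.map (tripleTensor A B M))
            (tripleTensor_mem M 𝒳 𝒴 h)) }
  extensions :=
    { prop_X₂_of_shortExact {S} hS h₁ h₃ := by
        have := hres.extensions
        exact (monoRep_tripleTensor_iff (𝒳 := 𝒳) (M := M) S.X₂).1
          ((monoRep M 𝒳 𝒴).prop_X₂_of_shortExact
            (tripleTensor_shortExact M hS (hres.tensor_shortExact hS h₃))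
            (tripleTensor_mem M 𝒳 𝒴 h₁) (tripleTensor_mem M 𝒳 𝒴 h₃)) }
  kernels S hS h₂ h₃ := (monoRep_tripleTensor_iff (𝒳 := 𝒳) (M := M) S.X₁).1
    (hres.kernels _ (tripleTensor_shortExact M hS (hres.tensor_shortExact hS h₃))
      (tripleTensor_mem M 𝒳 𝒴 h₂) (tripleTensor_mem M 𝒳 𝒴 h₃))

theorem isResolving_right : IsResolving 𝒳 where
  projective P _ := (monoRep_tripleZero_iff (𝒴 := 𝒴) (M := M) P).1
    (hres.projective _ inferInstance)
  retracts :=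
    { of_retract {X Y} r h := by
        have := hres.retracts
        exact (monoRep_tripleZero_iff (𝒴 := 𝒴) (M := M) X).1
          ((monoRep M 𝒳 𝒴).prop_of_retract (r.map (tripleZero A B M))
            (tripleZero_mem M 𝒳 𝒴 h)) }
  extensions :=
    { prop_X₂_of_shortExact {S} hS h₁ h₃ := by
        have := hres.extensions
        exact (monoRep_tripleZero_iff (𝒴 := 𝒴) (M := M) S.X₂).1
          ((monoRep M 𝒳 𝒴).prop_X₂_of_shortExact (tripleZero_shortExact M hS)
            (tripleZero_mem M 𝒳 𝒴 h₁) (tripleZero_mem M 𝒳 𝒴 h₃)) }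
  kernels S hS h₂ h₃ := (monoRep_tripleZero_iff (𝒴 := 𝒴) (M := M) S.X₁).1
    (hres.kernels _ (tripleZero_shortExact M hS)
      (tripleZero_mem M 𝒳 𝒴 h₂) (tripleZero_mem M 𝒳 𝒴 h₃))

theorem prop_right (htensor : ∀ Y, 𝒴 Y → 𝒳 ((tensorFunctor A B M).obj Y)) (U : TripleRep A B M)
    (hU : monoRep M 𝒳 𝒴 U) : 𝒳 U.right := by
  have := hres.isResolving_right.extensions
  exact 𝒳.prop_X₂_of_shortExact (TripleRep.shortExact hU.mono_φ) (htensor _ hU.1) hU.2.1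

theorem coker_shortExact {S : ShortComplex (TripleRep A B M)} (hS : S.ShortExact)
    (h₃ : monoRep M 𝒳 𝒴 S.X₃) : (S.map (tripleCoker A B M)).ShortExact :=
  tripleCoker_shortExact hS
    (hres.tensor_shortExact ((Comma.shortExact_iff _ _ _).1 hS).1 h₃.1) h₃.mono_φ

/-- If `ℳ(𝒳, M, 𝒴)` is a Frobenius category, then so is `𝒳`. -/
theorem isFrobenius_right (h : IsFrobenius (monoRep M 𝒳 𝒴)) : IsFrobenius 𝒳 := by
  refine hres.isResolving_right.isFrobenius (fun X hX => ?_) (fun X hX => ?_)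
  · refine ⟨hres.isResolving_right.projective X hX, fun S hS h₁ h₂ h₃ f => ?_⟩
    have hX' := (h.injective_iff_projective ((tripleZero A B M).obj X)).2
      ((hres.relProjective_iff _).2 inferInstance)
    obtain ⟨g, hg⟩ := hX'.2 _ (tripleZero_shortExact M hS) (tripleZero_mem M 𝒳 𝒴 h₁)
      (tripleZero_mem M 𝒳 𝒴 h₂) (tripleZero_mem M 𝒳 𝒴 h₃) ((tripleZero A B M).map f)
    exact ⟨g.right, congr_arg (·.right) hg⟩
  · obtain ⟨J, C, i, p, w, hS, hJ, hC⟩ := h.enoughInjectives _ (tripleZero_mem M 𝒳 𝒴 hX)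
    have hS' := hres.coker_shortExact hS hC
    have := (hres.relProjective_iff _).1 ((h.injective_iff_projective _).1 hJ)
    let e : X ≅ (tripleCoker A B M).obj ((tripleZero A B M).obj X) :=
      (cokernelZeroIsoTarget
        (X := (tensorFunctor A B M).obj (ModuleCat.of B PUnit)) (Y := X)).symm
    have w' : (tripleCoker A B M).map i ≫ (tripleCoker A B M).map p = 0 := by
      rw [← Functor.map_comp, w, Functor.map_zero]
    refine ⟨_, _, e.hom ≫ (tripleCoker A B M).map i, (tripleCoker A B M).map p,
      by rw [Category.assoc, w', comp_zero], ?_, projective_tripleCoker J, hC.2.1⟩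
    refine ShortComplex.shortExact_of_iso ?_ hS'
    exact ShortComplex.isoMk e.symm (Iso.refl _) (Iso.refl _)
      ((e.inv_hom_id_assoc _).trans (Category.comp_id _).symm)
      ((Category.id_comp _).trans (Category.comp_id _).symm)

/-- If `ℳ(𝒳, M, 𝒴)` is a Frobenius category, then so is `𝒴`. -/
theorem isFrobenius_left (h : IsFrobenius (monoRep M 𝒳 𝒴)) : IsFrobenius 𝒴 := by
  refine hres.isResolving_left.isFrobenius (fun Y hY => ?_) (fun Y hY => ?_)
  · refine ⟨hres.isResolving_left.projective Y hY, fun S hS h₁ h₂ h₃ f => ?_⟩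
    have hY' := (h.injective_iff_projective ((tripleTensor A B M).obj Y)).2
      ((hres.relProjective_iff _).2 inferInstance)
    obtain ⟨g, hg⟩ := hY'.2 _ (tripleTensor_shortExact M hS (hres.tensor_shortExact hS h₃))
      (tripleTensor_mem M 𝒳 𝒴 h₁) (tripleTensor_mem M 𝒳 𝒴 h₂) (tripleTensor_mem M 𝒳 𝒴 h₃)
      ((tripleTensor A B M).map f)
    exact ⟨g.left, congr_arg (·.left) hg⟩
  · obtain ⟨J, C, i, p, w, hS, hJ, hC⟩ := h.enoughInjectives _ (tripleTensor_mem M 𝒳 𝒴 hY)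
    have := (hres.relProjective_iff _).1 ((h.injective_iff_projective _).1 hJ)
    exact ⟨_, _, _, _, _, ((Comma.shortExact_iff _ _ _).1 hS).1, projective_left J, hC.1⟩

/-- If `ℳ(𝒳, M, 𝒴)` is a Frobenius category, then `M ⊗_B -` maps projective modules to projective
modules. -/
theorem projective_tensor (h : IsFrobenius (monoRep M 𝒳 𝒴))
    (htensor : ∀ Y, 𝒴 Y → 𝒳 ((tensorFunctor A B M).obj Y)) (Q : ModuleCat.{u} B) [Projective Q] :
    Projective ((tensorFunctor A B M).obj Q) := by
  rw [← hres.isResolving_right.relProjective_iff,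
    ← (hres.isFrobenius_right h).injective_iff_projective]
  refine ⟨htensor Q (hres.isResolving_left.projective Q inferInstance),
    fun S hS h₁ h₂ h₃ f => ?_⟩
  have hQ := (h.injective_iff_projective ((tripleTensor A B M).obj Q)).2
      ((hres.relProjective_iff _).2 inferInstance)
  obtain ⟨g, hg⟩ := hQ.2 _ (tripleZero_shortExact M hS) (tripleZero_mem M 𝒳 𝒴 h₁)
    (tripleZero_mem M 𝒳 𝒴 h₂) (tripleZero_mem M 𝒳 𝒴 h₃) (tripleZeroDesc f)
  exact ⟨g.right, congr_arg (·.right) hg⟩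

/-- Injective objects `P` of `𝒳` give injective objects `(P, 0)` of `ℳ(𝒳, M, 𝒴)`. -/
theorem relInjective_tripleZero {P : ModuleCat.{u} A} (hP : relInjective 𝒳 P) :
    relInjective (monoRep M 𝒳 𝒴) ((tripleZero A B M).obj P) := by
  refine ⟨tripleZero_mem M 𝒳 𝒴 hP.1, fun S hS h₁ h₂ h₃ f => ?_⟩
  obtain ⟨f', hf'⟩ := TripleRep.exists_π_comp (D := P) f.right (φ_comp_right f)
  have hC : (ShortComplex.mk ((tripleCoker A B M).map S.f) ((tripleCoker A B M).map S.g) (by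
    rw [← Functor.map_comp, S.zero, Functor.map_zero])).ShortExact := hres.coker_shortExact hS h₃
  obtain ⟨g, hg⟩ := hP.exists_extension hC h₁.2.1 h₂.2.1 h₃.2.1 f'
  refine ⟨tripleZeroLift (S.X₂.π ≫ g) (by rw [← Category.assoc, TripleRep.φ_π, zero_comp]),
    hom_tripleZero_ext ?_⟩
  change S.f.right ≫ S.X₂.π ≫ g = f.right
  rw [← hf', ← Category.assoc, ← TripleRep.map_π, Category.assoc, hg]

/-- Injective objects `Q` of `𝒴` such that `M ⊗_B Q` is injective in `𝒳` give injective objects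
`(M ⊗_B Q, Q)` of `ℳ(𝒳, M, 𝒴)`. -/
theorem relInjective_tripleTensor (htensor : ∀ Y, 𝒴 Y → 𝒳 ((tensorFunctor A B M).obj Y))
    {Q : ModuleCat.{u} B} (hQ : relInjective 𝒴 Q)
    (hQ' : relInjective 𝒳 ((tensorFunctor A B M).obj Q)) :
    relInjective (monoRep M 𝒳 𝒴) ((tripleTensor A B M).obj Q) := by
  refine ⟨tripleTensor_mem M 𝒳 𝒴 hQ.1, fun S hS h₁ h₂ h₃ f => ?_⟩
  have hX := hres.prop_right htensor
  have wL : S.f.left ≫ S.g.left = 0 := congr_arg (·.left) S.zero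
  have wR : S.f.right ≫ S.g.right = 0 := congr_arg (·.right) S.zero
  have hL : (ShortComplex.mk _ _ wL).ShortExact := ((Comma.shortExact_iff _ _ _).1 hS).1
  have hR : (ShortComplex.mk _ _ wR).ShortExact := ((Comma.shortExact_iff _ _ _).1 hS).2
  have hT : (ShortComplex.mk ((tensorFunctor A B M).map S.f.left)
      ((tensorFunctor A B M).map S.g.left) (by
        rw [← Functor.map_comp, wL, Functor.map_zero])).ShortExact :=
    hres.tensor_shortExact hL h₃.1
  let fl : S.X₁.left ⟶ Q := f.left
  let fr : S.X₁.right ⟶ (tensorFunctor A B M).obj Q := f.right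
  have hf : S.X₁.φ ≫ fr = (tensorFunctor A B M).map fl :=
    (TripleRep.map_φ f).symm.trans (Category.comp_id _)
  obtain ⟨b, hb⟩ := hQ.exists_extension hL h₁.1 h₂.1 h₃.1 fl
  obtain ⟨c, hc⟩ := hQ'.exists_extension hR (hX _ h₁) (hX _ h₂) (hX _ h₃) fr
  obtain ⟨e, he⟩ := hT.exists_desc (S.X₂.φ ≫ c - (tensorFunctor A B M).map b) (by
    rw [Preadditive.comp_sub, ← Category.assoc, TripleRep.map_φ, Category.assoc, hc, hf,
      ← Functor.map_comp, hb, sub_self])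
  obtain ⟨e', he'⟩ := hQ'.exists_extension (TripleRep.shortExact h₃.mono_φ) (htensor _ h₃.1)
    (hX _ h₃) h₃.2.1 e
  let c' : S.X₂.right ⟶ (tensorFunctor A B M).obj Q := c - S.g.right ≫ e'
  have hc' : S.X₂.φ ≫ c' = (tensorFunctor A B M).map b := by
    rw [Preadditive.comp_sub, ← Category.assoc, ← TripleRep.map_φ, Category.assoc, he', he,
      sub_sub_cancel]
  have hc'' : S.f.right ≫ c' = fr := by
    rw [Preadditive.comp_sub, ← Category.assoc, wR, zero_comp, sub_zero, hc]
  refine ⟨{ left := b, right := c', w := (Category.comp_id _).trans hc'.symm }, ?_⟩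
  ext : 1
  · exact hb
  · exact hc''

/-- If `𝒳` and `𝒴` are Frobenius categories and `M ⊗_B -` maps projective modules to projective
modules, then `ℳ(𝒳, M, 𝒴)` is a Frobenius category. -/
theorem isFrobenius_monoRep (htensor : ∀ Y, 𝒴 Y → 𝒳 ((tensorFunctor A B M).obj Y))
    (h𝒳 : IsFrobenius 𝒳) (h𝒴 : IsFrobenius 𝒴)
    (hT : ∀ Q : ModuleCat.{u} B, Projective Q → Projective ((tensorFunctor A B M).obj Q)) :
    IsFrobenius (monoRep M 𝒳 𝒴) := by
  have := hres.extensions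
  have hX : ∀ P, Projective P → relInjective 𝒳 P := fun P hP =>
    (h𝒳.injective_iff_projective P).2 ((hres.isResolving_right.relProjective_iff P).2 hP)
  have hY : ∀ Q, Projective Q → relInjective 𝒴 Q := fun Q hQ =>
    (h𝒴.injective_iff_projective Q).2 ((hres.isResolving_left.relProjective_iff Q).2 hQ)
  have hI (U : TripleRep A B M) (hU : Projective U) : relInjective (monoRep M 𝒳 𝒴) U := by
    obtain ⟨Q, P, p, hQ, hP, hp⟩ := exists_projective_cover U
    refine relInjective_of_retract ⟨Projective.factorThru (𝟙 U) p, p,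
      Projective.factorThru_comp _ _⟩ (hres.projective U hU) (relInjective_biprod
        (hres.relInjective_tripleTensor htensor (hY Q hQ) (hX _ (hT Q hQ)))
        (hres.relInjective_tripleZero (hX P hP)))
  refine hres.isFrobenius hI fun U hU => ?_
  obtain ⟨Q, C, i, p, w, hS, hQ, hC⟩ := h𝒴.enoughInjectives U.left hU.1
  obtain ⟨P, D, j, q, w', hS', hP, hD⟩ := h𝒳.enoughInjectives _ hU.2.1
  have := (hres.isResolving_left.relProjective_iff _).1 ((h𝒴.injective_iff_projective _).1 hQ)
  have := (hres.isResolving_right.relProjective_iff _).1 ((h𝒳.injective_iff_projective _).1 hP)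
  have hQ₁ : Projective ((tripleTensor A B M).obj Q) := inferInstance
  have hP₁ : Projective ((tripleZero A B M).obj P) := inferInstance
  have hQ' := tripleTensor_shortExact M hS (hres.tensor_shortExact hS hC)
  have hP' := tripleZero_shortExact (B := B) M hS'
  exact hres.exists_embedding_of_shortExact hI (TripleRep.shortExact_tripleTensor hU.mono_φ)
    (tripleTensor_mem M 𝒳 𝒴 hU.1) hU (tripleZero_mem M 𝒳 𝒴 hU.2.1) hQ' hQ₁
    (tripleTensor_mem M 𝒳 𝒴 hC) hP' hP₁ (tripleZero_mem M 𝒳 𝒴 hD)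

end IsResolving

end MonoRepFrobenius

/-! ## The functors between `𝒳`, `ℳ(𝒳, M, 𝒴)` and `𝒴` -/

section MonoRepFunctors

variable {A B : Type u} [Ring A] [Ring B] (M : Type u) [AddCommGroup M] [Module A M]
  [Module Bᵐᵒᵖ M] [SMulCommClass A Bᵐᵒᵖ M]
  (𝒳 : ObjectProperty (ModuleCat.{u} A)) [𝒳.IsClosedUnderIsomorphisms] [𝒳.ContainsZero]
  (𝒴 : ObjectProperty (ModuleCat.{u} B)) [𝒴.IsClosedUnderIsomorphisms] [𝒴.ContainsZero]
  (hX : ∀ U, monoRep M 𝒳 𝒴 U → 𝒳 U.right)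

instance monoCoker_additive : (monoCoker M 𝒳 𝒴).Additive where
  map_add {U V f g} := by
    ext : 1
    exact (tripleCoker A B M).map_add (f := f.hom) (g := g.hom)

instance monoZero_additive : (monoZero M 𝒳 𝒴).Additive where
  map_add {U V f g} := by
    ext : 1
    exact (tripleZero A B M).map_add (f := f.hom) (g := g.hom)

instance monoFst_additive : (monoFst M 𝒳 𝒴 hX).Additive where
  map_add := rfl

instance monoSnd_additive : (monoSnd M 𝒳 𝒴).Additive where
  map_add := rfl

instance monoTensor_additive : (monoTensor M 𝒳 𝒴).Additive where
  map_add {U V f g} := by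
    ext : 1
    exact (tripleTensor A B M).map_add (f := f.hom) (g := g.hom)

/-- The projection of `X` onto `Coker (0 ⟶ X)`. -/
noncomputable def tripleZeroπ (X : ModuleCat.{u} A) :
    X ⟶ (tripleCoker A B M).obj ((tripleZero A B M).obj X) := ((tripleZero A B M).obj X).π

instance (X : ModuleCat.{u} A) : Epi (tripleZeroπ (B := B) M X) :=
  inferInstanceAs (Epi ((tripleZero A B M).obj X).π)

/-- The isomorphism `Coker (0 ⟶ X) ≅ X`. -/
noncomputable def tripleCokerZeroIso (X : ModuleCat.{u} A) :
    (tripleCoker A B M).obj ((tripleZero A B M).obj X) ≅ X :=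
  cokernelZeroIsoTarget (X := (tensorFunctor A B M).obj (ModuleCat.of B PUnit)) (Y := X)

theorem tripleZeroπ_iso_hom (X : ModuleCat.{u} A) :
    tripleZeroπ (B := B) M X ≫ (tripleCokerZeroIso M X).hom = 𝟙 X := by
  have h : (tripleCokerZeroIso (B := B) M X).hom = _ := cokernelZeroIsoTarget_hom
  rw [h]
  exact cokernel.π_desc (0 : (tensorFunctor A B M).obj (ModuleCat.of B PUnit) ⟶ X) (𝟙 X) zero_comp

theorem tripleCokerZeroIso_naturality {X X' : ModuleCat.{u} A} (f : X ⟶ X') :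
    (tripleCoker A B M).map ((tripleZero A B M).map f) ≫ (tripleCokerZeroIso M X').hom =
      (tripleCokerZeroIso M X).hom ≫ f := by
  have h : tripleZeroπ (B := B) M X ≫ (tripleCoker A B M).map ((tripleZero A B M).map f) =
    f ≫ tripleZeroπ M X' := TripleRep.map_π _
  rw [← cancel_epi (tripleZeroπ M X), reassoc_of% h, tripleZeroπ_iso_hom, Category.comp_id,
    ← Category.assoc, tripleZeroπ_iso_hom, Category.id_comp]

theorem tripleCoker_map_lift (U : TripleRep A B M) :
    (tripleCoker A B M).map (tripleZeroLift U.π U.φ_π) ≫ (tripleCokerZeroIso M _).hom = 𝟙 _ := by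
  have h : U.π ≫ (tripleCoker A B M).map (tripleZeroLift U.π U.φ_π) =
    U.π ≫ tripleZeroπ M _ := TripleRep.map_π _
  rw [← cancel_epi U.π, reassoc_of% h, tripleZeroπ_iso_hom]

/-- The functor `Coker` is left adjoint to `X ↦ (X, 0)`. -/
noncomputable def monoCokerAdjunction : monoCoker M 𝒳 𝒴 ⊣ monoZero M 𝒳 𝒴 where
  unit :=
    { app U := ObjectProperty.homMk (tripleZeroLift U.obj.π U.obj.φ_π)
      naturality U V f := by
        ext : 1
        exact hom_tripleZero_ext (TripleRep.map_π f.hom).symm }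
  counit :=
    { app X := ObjectProperty.homMk (tripleCokerZeroIso M X.obj).hom
      naturality X Y f := by
        ext : 1
        exact tripleCokerZeroIso_naturality M f.hom }
  left_triangle_components U := by
    ext : 1
    exact tripleCoker_map_lift M U.obj
  right_triangle_components X := by
    ext : 1
    exact hom_tripleZero_ext (tripleZeroπ_iso_hom M X.obj)

/-- The functor `X ↦ (X, 0)` is left adjoint to `(X, Y, φ) ↦ X`. -/
def monoZeroAdjunction : monoZero M 𝒳 𝒴 ⊣ monoFst M 𝒳 𝒴 hX where
  unit := { app X := 𝟙 X }
  counit :=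
    { app U := ObjectProperty.homMk (tripleZeroDesc (𝟙 U.obj.right))
      naturality U V f := by
        ext : 1
        exact tripleZero_hom_ext ((Category.comp_id f.hom.right).trans
          (Category.id_comp f.hom.right).symm) }
  left_triangle_components X := by
    ext : 1
    exact tripleZero_hom_ext (Category.id_comp (𝟙 X.obj))
  right_triangle_components U := by
    ext : 1
    exact Category.id_comp (𝟙 U.obj.right)

/-- The functor `Y ↦ (M ⊗_B Y, Y)` is left adjoint to `(X, Y, φ) ↦ Y`. -/
def monoTensorAdjunction : monoTensor M 𝒳 𝒴 ⊣ monoSnd M 𝒳 𝒴 where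
  unit := { app Y := 𝟙 Y }
  counit :=
    { app U := ObjectProperty.homMk (tripleTensorDesc (𝟙 U.obj.left))
      naturality U V f := by
        ext : 1
        exact tripleTensor_hom_ext ((Category.comp_id f.hom.left).trans
          (Category.id_comp f.hom.left).symm) }
  left_triangle_components X := by
    ext : 1
    exact tripleTensor_hom_ext (Category.id_comp (𝟙 X.obj))
  right_triangle_components U := by
    ext : 1
    exact Category.id_comp (𝟙 U.obj.left)

variable {M 𝒳 𝒴} (hres : IsResolving (monoRep M 𝒳 𝒴))

namespace IsResolving

include hres

theorem monoCoker_isConflation (S : ShortComplex (monoRep M 𝒳 𝒴).FullSubcategory)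
    (hS : IsConflation S) : IsConflation (S.map (monoCoker M 𝒳 𝒴)) :=
  hres.coker_shortExact (S := S.map (monoRep M 𝒳 𝒴).ι) hS S.X₃.property

omit hres in
theorem _root_.monoZero_isConflation (S : ShortComplex 𝒳.FullSubcategory) (hS : IsConflation S) :
    IsConflation (S.map (monoZero M 𝒳 𝒴)) :=
  tripleZero_shortExact M hS

omit hres in
theorem _root_.monoFst_isConflation (S : ShortComplex (monoRep M 𝒳 𝒴).FullSubcategory)
    (hS : IsConflation S) : IsConflation (S.map (monoFst M 𝒳 𝒴 hX)) :=
  ((Comma.shortExact_iff _ _ _).1 hS).2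

omit hres in
theorem _root_.monoSnd_isConflation (S : ShortComplex (monoRep M 𝒳 𝒴).FullSubcategory)
    (hS : IsConflation S) : IsConflation (S.map (monoSnd M 𝒳 𝒴)) :=
  ((Comma.shortExact_iff _ _ _).1 hS).1

theorem monoTensor_isConflation (S : ShortComplex 𝒴.FullSubcategory) (hS : IsConflation S) :
    IsConflation (S.map (monoTensor M 𝒳 𝒴)) :=
  tripleTensor_shortExact M hS (hres.tensor_shortExact hS S.X₃.property)

theorem monoCoker_relProjective (U : (monoRep M 𝒳 𝒴).FullSubcategory)
    (hU : relProjective (monoRep M 𝒳 𝒴) U.obj) :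
    relProjective 𝒳 ((monoCoker M 𝒳 𝒴).obj U).obj := by
  have := (hres.relProjective_iff _).1 hU
  exact (hres.isResolving_right.relProjective_iff _).2 (projective_tripleCoker U.obj)

theorem monoZero_relProjective (X : 𝒳.FullSubcategory) (hX : relProjective 𝒳 X.obj) :
    relProjective (monoRep M 𝒳 𝒴) ((monoZero M 𝒳 𝒴).obj X).obj := by
  have := (hres.isResolving_right.relProjective_iff _).1 hX
  exact (hres.relProjective_iff _).2 (projective_tripleZero X.obj)

theorem monoSnd_relProjective (U : (monoRep M 𝒳 𝒴).FullSubcategory)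
    (hU : relProjective (monoRep M 𝒳 𝒴) U.obj) :
    relProjective 𝒴 ((monoSnd M 𝒳 𝒴).obj U).obj := by
  have := (hres.relProjective_iff _).1 hU
  exact (hres.isResolving_left.relProjective_iff _).2 (projective_left U.obj)

theorem monoTensor_relProjective (Y : 𝒴.FullSubcategory) (hY : relProjective 𝒴 Y.obj) :
    relProjective (monoRep M 𝒳 𝒴) ((monoTensor M 𝒳 𝒴).obj Y).obj := by
  have := (hres.isResolving_left.relProjective_iff _).1 hY
  exact (hres.relProjective_iff _).2 (projective_tripleTensor Y.obj)

omit hres in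
theorem _root_.monoFst_relProjective (h : IsFrobenius (monoRep M 𝒳 𝒴)) (h' : IsFrobenius 𝒳)
    (U : (monoRep M 𝒳 𝒴).FullSubcategory) (hU : relProjective (monoRep M 𝒳 𝒴) U.obj) :
    relProjective 𝒳 ((monoFst M 𝒳 𝒴 hX).obj U).obj := by
  refine (h'.injective_iff_projective _).1 ⟨((monoFst M 𝒳 𝒴 hX).obj U).property,
    fun S hS h₁ h₂ h₃ f => ?_⟩
  obtain ⟨g, hg⟩ := ((h.injective_iff_projective _).2 hU).2 _ (tripleZero_shortExact M hS)
    (tripleZero_mem M 𝒳 𝒴 h₁) (tripleZero_mem M 𝒳 𝒴 h₂) (tripleZero_mem M 𝒳 𝒴 h₃)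
    (tripleZeroDesc f)
  exact ⟨g.right, congr_arg (·.right) hg⟩

end IsResolving

end MonoRepFunctors

/-! ## The right adjoint of the functor to the second component -/

namespace CategoryTheory.Adjunction

section RightAdjoint

variable {C : Type u₁} [Category.{v₁} C] {D : Type u₂} [Category.{v₂} D] {F : C ⥤ D} {G : D → C}
  (ε : ∀ Y, F.obj (G Y) ≅ Y)
  (h : ∀ X Y, Function.Bijective (fun f : X ⟶ G Y => F.map f))

/-- The bijection `Hom(F X, Y) ≃ Hom(X, G Y)` when `F` is fully faithful on morphisms to the
objects `G Y`. -/
noncomputable def localEquiv (X : C) (Y : D) : (F.obj X ⟶ Y) ≃ (X ⟶ G Y) :=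
  ((ε Y).symm.homToEquiv).trans (Equiv.ofBijective _ (h X Y)).symm

theorem map_localEquiv {X : C} {Y : D} (f : F.obj X ⟶ Y) :
    F.map (localEquiv ε h X Y f) = f ≫ (ε Y).inv :=
  (Equiv.ofBijective _ (h X Y)).apply_symm_apply _

theorem localEquiv_naturality (X' X : C) (Y : D) (f : X' ⟶ X) (g : F.obj X ⟶ Y) :
    localEquiv ε h X' Y (F.map f ≫ g) = f ≫ localEquiv ε h X Y g := by
  apply (h X' Y).1
  dsimp only
  rw [map_localEquiv, F.map_comp, map_localEquiv, Category.assoc]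

/-- A functor that is fully faithful on morphisms to the objects `G Y`, where `F (G Y) ≅ Y`, has
a right adjoint given by `G` on objects. -/
noncomputable def ofLocal : F ⊣ rightAdjointOfEquiv (localEquiv ε h) (localEquiv_naturality ε h) :=
  adjunctionOfEquivRight _ _

theorem ofLocal_unit_app (X : C) (η : X ⟶ G (F.obj X))
    (hη : F.map η ≫ (ε (F.obj X)).hom = 𝟙 (F.obj X)) : (ofLocal ε h).unit.app X = η := by
  have h₁ : (ofLocal ε h).unit.app X = localEquiv ε h X _ (𝟙 _) := by
    rw [← Adjunction.homEquiv_id, ofLocal, adjunctionOfEquivRight, mkOfHomEquiv_homEquiv]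
  rw [h₁]
  apply (h X _).1
  dsimp only
  rw [map_localEquiv, ← hη, Category.assoc, Iso.hom_inv_id, Category.comp_id]

theorem isIso_ofLocal_counit : IsIso (ofLocal ε h).counit := by
  rw [NatTrans.isIso_iff_isIso_app]
  intro Y
  have h₁ : (ofLocal ε h).counit.app Y = (localEquiv ε h _ Y).symm (𝟙 _) := by
    rw [← Adjunction.homEquiv_symm_id, ofLocal, adjunctionOfEquivRight, mkOfHomEquiv_homEquiv]
    rfl
  have h₂ : (localEquiv ε h (G Y) Y).symm (𝟙 _) = (ε Y).hom := by
    rw [Equiv.symm_apply_eq]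
    apply (h _ _).1
    dsimp only
    rw [map_localEquiv, Iso.hom_inv_id, F.map_id]
  rw [h₁]
  exact h₂ ▸ (ε Y).isIso_hom

end RightAdjoint

end CategoryTheory.Adjunction

theorem IsTriangleFunctor.rightAdjoint
    {𝒯₁ : Type u₁} [Category.{v₁} 𝒯₁] [Preadditive 𝒯₁] [HasZeroObject 𝒯₁] [HasShift 𝒯₁ ℤ]
    [∀ n : ℤ, (shiftFunctor 𝒯₁ n).Additive] [Pretriangulated 𝒯₁]
    {𝒯₂ : Type u₂} [Category.{v₂} 𝒯₂] [Preadditive 𝒯₂] [HasZeroObject 𝒯₂] [HasShift 𝒯₂ ℤ]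
    [∀ n : ℤ, (shiftFunctor 𝒯₂ n).Additive] [Pretriangulated 𝒯₂]
    {F : 𝒯₁ ⥤ 𝒯₂} {G : 𝒯₂ ⥤ 𝒯₁} (adj : F ⊣ G) (h : IsTriangleFunctor F) :
    IsTriangleFunctor G := by
  obtain ⟨_, _⟩ := h
  let := adj.rightAdjointCommShift ℤ
  have := adj.commShift_of_leftAdjoint ℤ
  exact ⟨inferInstance, adj.isTriangulated_rightAdjoint⟩

theorem IsFrobenius.exists_distinguished {𝒜 : Type u} [Category.{v} 𝒜] [Abelian 𝒜]
    {P : ObjectProperty 𝒜} [P.ContainsZero] [StableTriangulation P] (hP : IsFrobenius P)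
    (S : ShortComplex P.FullSubcategory) (hS : IsConflation S) :
    ∃ δ, Triangle.mk ((toStable P).map S.f) ((toStable P).map S.g) δ ∈
      distTriang (StableCategory P) := by
  have := hP.closedUnderExtensions
  obtain ⟨φ, hφ⟩ := hP.exists_hom_hull hS (𝟙 S.X₁)
  have h := φ.comm₁₂
  rw [hφ] at h
  refine ⟨_, (StableTriangulation.distinguished_iff _).2
    ⟨S.X₁, S.X₂, S.X₃, S.f, S.g, S.zero, hS, _, _, (hP.hull S.X₁).f, (hP.hull S.X₁).g, _,
      hP.hull_isConflation S.X₁, hP.hull_injective S.X₁, φ.τ₂, φ.τ₃,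
      h.symm.trans (Category.id_comp _), φ.comm₂₃.symm, ⟨Iso.refl _⟩⟩⟩

section Recollement

variable {A B : Type u} [Ring A] [Ring B] {M : Type u} [AddCommGroup M] [Module A M]
  [Module Bᵐᵒᵖ M] [SMulCommClass A Bᵐᵒᵖ M]
  {𝒳 : ObjectProperty (ModuleCat.{u} A)} [𝒳.IsClosedUnderIsomorphisms] [𝒳.ContainsZero]
  {𝒴 : ObjectProperty (ModuleCat.{u} B)} [𝒴.IsClosedUnderIsomorphisms] [𝒴.ContainsZero]
  (hres : IsResolving (monoRep M 𝒳 𝒴))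
  (htensor : ∀ Y, 𝒴 Y → 𝒳 ((tensorFunctor A B M).obj Y))
  (h𝒳 : IsFrobenius 𝒳) (h𝒴 : IsFrobenius 𝒴) (hℳ : IsFrobenius (monoRep M 𝒳 𝒴))
  (hT : ∀ Q : ModuleCat.{u} B, Projective Q → Projective ((tensorFunctor A B M).obj Q))

namespace IsResolving

theorem exists_hom_of_left {U V : TripleRep A B M} (hU : monoRep M 𝒳 𝒴 U)
    (htensor : ∀ Y, 𝒴 Y → 𝒳 ((tensorFunctor A B M).obj Y)) (hU' : 𝒳 U.right)
    (hV : relInjective 𝒳 V.right) (f : U.left ⟶ V.left) : ∃ g : U ⟶ V, g.left = f := by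
  obtain ⟨r, hr⟩ := hV.exists_extension (TripleRep.shortExact hU.mono_φ) (htensor _ hU.1) hU' hU.2.1
    ((tensorFunctor A B M).map f ≫ V.φ)
  exact ⟨{ left := f, right := r, w := hr.symm }, rfl⟩

include htensor h𝒳 hT in
/-- When `I` is injective, the stable morphisms from a triple `U` to `(I, Y)` are the stable
morphisms from the left component of `U` to `Y`. -/
theorem bijective_stableFunctor_monoSnd (U J : (monoRep M 𝒳 𝒴).FullSubcategory)
    (hJ : relInjective 𝒳 J.obj.right) :
    Function.Bijective (fun f : (toStable _).obj U ⟶ (toStable _).obj J =>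
      (stableFunctor (monoSnd M 𝒳 𝒴) hres.monoSnd_relProjective).map f) := by
  have := hres.isResolving_left.extensions
  have hX := hres.prop_right htensor
  refine ⟨(injective_iff_map_eq_zero (stableFunctor (monoSnd M 𝒳 𝒴)
    hres.monoSnd_relProjective).mapAddHom).2 fun f hf => ?_, fun g => ?_⟩
  · obtain ⟨f, rfl⟩ := (toStable _).map_surjective f
    have hf' : (toStable 𝒴).map ((monoSnd M 𝒳 𝒴).map f) = (toStable 𝒴).map 0 :=
      Eq.trans hf ((toStable 𝒴).map_zero _ _).symm
    obtain ⟨Q, a, b, hQ, hab⟩ := (toStable_map_eq_iff _ _).1 hf'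
    rw [sub_zero] at hab
    have hQ' : relInjective 𝒳 ((tensorFunctor A B M).obj Q.obj) :=
      (h𝒳.injective_iff_projective _).2 ((hres.isResolving_right.relProjective_iff _).2
        (hT _ ((hres.isResolving_left.relProjective_iff _).1 hQ)))
    obtain ⟨c, hc⟩ := exists_hom_of_left (V := (tripleTensor A B M).obj Q.obj) U.property htensor
      (hX _ U.property) hQ' a.hom
    let c' : U ⟶ (monoTensor M 𝒳 𝒴).obj Q := ObjectProperty.homMk c
    let d : (monoTensor M 𝒳 𝒴).obj Q ⟶ J := ObjectProperty.homMk (tripleTensorDesc b.hom)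
    let k : U.obj ⟶ J.obj := (f - c' ≫ d).hom
    have hk : k.left = 0 := by
      have h : c.left ≫ (show Q.obj ⟶ J.obj.left from b.hom) = f.hom.left := by
        rw [hc]
        exact congr_arg (·.hom) hab
      exact sub_eq_zero.2 h.symm
    have hk' : U.obj.φ ≫ k.right = 0 := by
      rw [← TripleRep.map_φ, hk, Functor.map_zero, zero_comp]
    let I : 𝒳.FullSubcategory := ⟨J.obj.right, hJ.1⟩
    let p : U ⟶ (monoZero M 𝒳 𝒴).obj I := ObjectProperty.homMk (tripleZeroLift k.right hk')
    let q : (monoZero M 𝒳 𝒴).obj I ⟶ J := ObjectProperty.homMk (tripleZeroDesc (𝟙 J.obj.right))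
    have hpq : p ≫ q = f - c' ≫ d := by
      ext : 1
      change tripleZeroLift k.right hk' ≫ tripleZeroDesc (𝟙 J.obj.right) = k
      ext : 1
      · rw [hk]
        exact comp_zero
      · exact Category.comp_id k.right
    have hI := hres.monoZero_relProjective I ((h𝒳.injective_iff_projective _).1 hJ)
    have hQ'' := hres.monoTensor_relProjective Q hQ
    rw [← sub_add_cancel f (c' ≫ d), ← hpq, (toStable _).map_add, (toStable _).map_comp,
      (toStable _).map_comp, toStable_map_eq_zero_of_right hI, toStable_map_eq_zero_of_right hQ'',
      zero_comp, zero_comp, add_zero]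
  · obtain ⟨g, rfl⟩ := (toStable 𝒴).map_surjective g
    obtain ⟨k, hk⟩ := exists_hom_of_left U.property htensor (hX _ U.property) hJ g.hom
    refine ⟨(toStable _).map (ObjectProperty.homMk k), congr_arg (toStable 𝒴).map ?_⟩
    ext : 1
    exact hk

theorem exists_monic_hull (h𝒳 : IsFrobenius 𝒳) {X : ModuleCat.{u} A} (hX : 𝒳 X) :
    ∃ (I : ModuleCat.{u} A) (i : X ⟶ I), Mono i ∧ relInjective 𝒳 I ∧ 𝒳 (cokernel i) := by
  obtain ⟨I, C, i, p, w, hS, hI, hC⟩ := h𝒳.enoughInjectives X hX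
  exact ⟨I, i, hS.mono_f, hI,
    𝒳.prop_of_iso ((cokernelIsCokernel i).coconePointUniqueUpToIso hS.gIsCokernel).symm hC⟩

/-- The triple `(I, Y)` given by an embedding of `M ⊗_B Y` into an injective object `I` of
`𝒳`. -/
noncomputable def injectiveTriple (h𝒳 : IsFrobenius 𝒳)
    (htensor : ∀ Y, 𝒴 Y → 𝒳 ((tensorFunctor A B M).obj Y)) (Y : 𝒴.FullSubcategory) :
    (monoRep M 𝒳 𝒴).FullSubcategory where
  obj :=
    { left := Y.obj
      right := (exists_monic_hull h𝒳 (htensor _ Y.property)).choose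
      hom := (exists_monic_hull h𝒳 (htensor _ Y.property)).choose_spec.choose }
  property := ⟨Y.property,
    (exists_monic_hull h𝒳 (htensor _ Y.property)).choose_spec.choose_spec.2.2,
    (ModuleCat.mono_iff_injective _).1
      (exists_monic_hull h𝒳 (htensor _ Y.property)).choose_spec.choose_spec.1⟩

theorem injectiveTriple_right (Y : 𝒴.FullSubcategory) :
    relInjective 𝒳 (injectiveTriple h𝒳 htensor Y).obj.right :=
  (exists_monic_hull h𝒳 (htensor _ Y.property)).choose_spec.choose_spec.2.1

end IsResolving

end Recollement

section Recollement

variable {A B : Type u} [Ring A] [Ring B] {M : Type u} [AddCommGroup M] [Module A M]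
  [Module Bᵐᵒᵖ M] [SMulCommClass A Bᵐᵒᵖ M]

/-- The short exact sequence `0 ⟶ (X, 0) ⟶ U ⊞ (I, 0) ⟶ (I, Y) ⟶ 0` attached to a morphism
`η : U = (X, Y) ⟶ (I, Y)` that is an isomorphism on the left components. -/
theorem shortExact_of_isIso_left {U J : TripleRep A B M} (η : U ⟶ J) [IsIso η.left] :
    (ShortComplex.mk
      (biprod.lift (tripleZeroDesc (𝟙 U.right)) (-(tripleZero A B M).map η.right))
      (biprod.desc η (tripleZeroDesc (U := J) (𝟙 J.right))) (by
        rw [biprod.lift_desc]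
        refine tripleZero_hom_ext ?_
        change 𝟙 U.right ≫ η.right + (-η.right) ≫ 𝟙 J.right = 0
        simp)).ShortExact := by
  have : Mono (tripleZeroDesc (U := U) (𝟙 U.right)) := by
    have : Mono (tripleZeroDesc (U := U) (𝟙 U.right)).left :=
      ⟨fun _ _ _ => (isZero_left_tripleZero M U.right).eq_of_tgt _ _⟩
    have : Mono (tripleZeroDesc (U := U) (𝟙 U.right)).right := inferInstanceAs (Mono (𝟙 U.right))
    exact Comma.mono_of_left_right _
  have : Mono (biprod.lift (tripleZeroDesc (𝟙 U.right)) (-(tripleZero A B M).map η.right)) :=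
    mono_of_mono_fac (biprod.lift_fst _ _)
  let g := biprod.desc η (tripleZeroDesc (U := J) (𝟙 J.right))
  have h₁ : biprod.inl ≫ g = _ := biprod.inl_desc _ _
  have h₂ : biprod.inr ≫ g = _ := biprod.inr_desc _ _
  have : Epi g := by
    have : Epi (tripleZeroDesc (U := J) (𝟙 J.right)).right := inferInstanceAs (Epi (𝟙 J.right))
    have : Epi g.left := epi_of_epi_fac (congr_arg (·.left) h₁)
    have : Epi g.right := epi_of_epi_fac (congr_arg (·.right) h₂)
    exact Comma.epi_of_left_right g
  refine ShortComplex.ShortExact.of_lift _ fun {D} k hk => ?_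
  let k₁ : D ⟶ U := k ≫ biprod.fst
  let k₂ : D ⟶ (tripleZero A B M).obj J.right := k ≫ biprod.snd
  have hk' : k₁ ≫ η + k₂ ≫ tripleZeroDesc (𝟙 J.right) = 0 := by
    rw [biprod.desc_eq, Preadditive.comp_add] at hk
    simpa [k₁, k₂] using hk
  have hl : k₁.left ≫ η.left + k₂.left ≫ 0 = 0 := congr_arg (·.left) hk'
  have hr : k₁.right ≫ η.right + k₂.right ≫ 𝟙 J.right = 0 := congr_arg (·.right) hk'
  rw [comp_zero, add_zero] at hl
  have hl' : k₁.left = 0 := by rw [← cancel_mono η.left, hl, zero_comp]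
  refine ⟨tripleZeroLift k₁.right (by
    rw [← TripleRep.map_φ, hl', Functor.map_zero, zero_comp]), biprod.hom_ext _ _ ?_ ?_⟩
  · rw [Category.assoc, biprod.lift_fst]
    change _ = k₁
    ext : 1
    · exact comp_zero.trans hl'.symm
    · exact Category.comp_id k₁.right
  · rw [Category.assoc, biprod.lift_snd]
    change _ = k₂
    refine hom_tripleZero_ext ?_
    let k₃ : D.right ⟶ J.right := k₂.right
    change k₁.right ≫ (-η.right) = k₃
    rw [Preadditive.comp_neg, neg_eq_iff_add_eq_zero, ← hr]
    exact congr_arg (k₁.right ≫ η.right + ·) (Category.comp_id k₃).symm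

variable {𝒳 : ObjectProperty (ModuleCat.{u} A)} [𝒳.IsClosedUnderIsomorphisms] [𝒳.ContainsZero]
  {𝒴 : ObjectProperty (ModuleCat.{u} B)} [𝒴.IsClosedUnderIsomorphisms] [𝒴.ContainsZero]
  (hres : IsResolving (monoRep M 𝒳 𝒴))
  (htensor : ∀ Y, 𝒴 Y → 𝒳 ((tensorFunctor A B M).obj Y))
  (h𝒳 : IsFrobenius 𝒳) (h𝒴 : IsFrobenius 𝒴) (hℳ : IsFrobenius (monoRep M 𝒳 𝒴))
  (hT : ∀ Q : ModuleCat.{u} B, Projective Q → Projective ((tensorFunctor A B M).obj Q))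

namespace IsResolving

/-- The adjunction between the functor `j^*` induced by `(X, Y, φ) ↦ Y` and `j_*`. -/
noncomputable def monoSndAdjunction :=
  Adjunction.ofLocal (F := stableFunctor (monoSnd M 𝒳 𝒴) hres.monoSnd_relProjective)
    (G := fun Y => (toStable _).obj (injectiveTriple h𝒳 htensor Y.as))
    (fun Y => Iso.refl Y)
    (fun X Y => hres.bijective_stableFunctor_monoSnd htensor h𝒳 hT X.as _
      (injectiveTriple_right htensor h𝒳 Y.as))

/-- The adjunction between `i_*` and `i^!`. -/
def stableMonoZeroAdjunction :=
  stableAdjunction hres.monoZero_relProjective (monoFst_relProjective _ hℳ h𝒳)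
    (monoZeroAdjunction M 𝒳 𝒴 (hres.prop_right htensor))

/-- The adjunction between `j_!` and `j^*`. -/
def stableMonoTensorAdjunction :=
  stableAdjunction hres.monoTensor_relProjective hres.monoSnd_relProjective
    (monoTensorAdjunction M 𝒳 𝒴)

instance isIso_stableMonoZeroAdjunction_unit :
    IsIso (hres.stableMonoZeroAdjunction htensor h𝒳 hℳ).unit := by
  rw [NatTrans.isIso_iff_isIso_app]
  intro X
  exact inferInstanceAs (IsIso ((toStable 𝒳).map (𝟙 X.as)))

instance isIso_stableMonoTensorAdjunction_unit : IsIso hres.stableMonoTensorAdjunction.unit := by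
  rw [NatTrans.isIso_iff_isIso_app]
  intro Y
  exact inferInstanceAs (IsIso ((toStable 𝒴).map (𝟙 Y.as)))

instance isIso_monoSndAdjunction_counit :
    IsIso (hres.monoSndAdjunction htensor h𝒳 hT).counit :=
  Adjunction.isIso_ofLocal_counit _ _

variable [StableTriangulation 𝒳] [StableTriangulation (monoRep M 𝒳 𝒴)] [StableTriangulation 𝒴]

include hres hℳ in
/-- The triangle `j_! j^* U ⟶ U ⟶ i_* i^* U ⟶`. -/
theorem exists_distinguished_monoTensor (U : (monoRep M 𝒳 𝒴).FullSubcategory) :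
    ∃ δ, Triangle.mk ((toStable _).map ((monoTensorAdjunction M 𝒳 𝒴).counit.app U))
      ((toStable _).map ((monoCokerAdjunction M 𝒳 𝒴).unit.app U)) δ ∈
        distTriang (StableCategory (monoRep M 𝒳 𝒴)) := by
  have h := TripleRep.shortExact_tripleTensor U.property.mono_φ
  exact hℳ.exists_distinguished (ShortComplex.mk ((monoTensorAdjunction M 𝒳 𝒴).counit.app U)
    ((monoCokerAdjunction M 𝒳 𝒴).unit.app U) (by
      ext : 1
      exact h.comp_eq_zero)) h

include hℳ in
/-- The triangle `i_* i^! U ⟶ U ⟶ j_* j^* U ⟶`. -/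
theorem exists_distinguished_injectiveTriple (U : (monoRep M 𝒳 𝒴).FullSubcategory) :
    ∃ δ, Triangle.mk
      ((toStable _).map ((monoZeroAdjunction M 𝒳 𝒴 (hres.prop_right htensor)).counit.app U))
      ((hres.monoSndAdjunction htensor h𝒳 hT).unit.app ((toStable _).obj U)) δ ∈
        distTriang (StableCategory (monoRep M 𝒳 𝒴)) := by
  have := hres.extensions
  have : Fact (IsFrobenius (monoRep M 𝒳 𝒴)) := ⟨hℳ⟩
  let J := injectiveTriple h𝒳 htensor ((monoSnd M 𝒳 𝒴).obj U)
  have hJ : relInjective 𝒳 J.obj.right := injectiveTriple_right htensor h𝒳 _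
  obtain ⟨η, hη⟩ := exists_hom_of_left (V := J.obj) U.property htensor
    (hres.prop_right htensor _ U.property) hJ (𝟙 U.obj.left)
  have hη' : IsIso η.left := hη ▸ inferInstanceAs (IsIso (𝟙 U.obj.left))
  let η' : U ⟶ J := ObjectProperty.homMk η
  have h₁ : (hres.monoSndAdjunction htensor h𝒳 hT).unit.app ((toStable _).obj U) =
      (toStable _).map η' := by
    refine Adjunction.ofLocal_unit_app _ _ _ _ ((Category.comp_id _).trans ?_)
    refine Eq.trans (congr_arg (toStable 𝒴).map (?_ : _ = 𝟙 ((monoSnd M 𝒳 𝒴).obj U)))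
      ((toStable 𝒴).map_id _)
    ext : 1
    exact hη
  rw [h₁]
  have hS := shortExact_of_isIso_left η
  let I : 𝒳.FullSubcategory := ⟨J.obj.right, hJ.1⟩
  have hI := hres.monoZero_relProjective I ((h𝒳.injective_iff_projective _).1 hJ)
  let Z := ObjectProperty.biprodObj U ((monoZero M 𝒳 𝒴).obj I)
  let X : (monoRep M 𝒳 𝒴).FullSubcategory :=
    (monoZero M 𝒳 𝒴).obj ((monoFst M 𝒳 𝒴 (hres.prop_right htensor)).obj U)
  let f : X ⟶ Z := ObjectProperty.homMk
    (biprod.lift (tripleZeroDesc (𝟙 U.obj.right)) (-(tripleZero A B M).map η.right))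
  let g : Z ⟶ J := ObjectProperty.homMk (biprod.desc η (tripleZeroDesc (𝟙 J.obj.right)))
  have w : f ≫ g = 0 := by
    ext : 1
    exact hS.comp_eq_zero
  obtain ⟨δ, hδ⟩ := hℳ.exists_distinguished (ShortComplex.mk f g w) hS
  obtain ⟨e, he, he'⟩ := exists_biprodObj_iso U _ hI
  let κ : X ⟶ U := (monoZeroAdjunction M 𝒳 𝒴 (hres.prop_right htensor)).counit.app U
  have hf : (toStable _).map f ≫ e.inv = (toStable _).map κ := by
    rw [he', ← (toStable _).map_comp]
    congr 1
    ext : 1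
    exact biprod.lift_fst _ _
  have hg : e.hom ≫ (toStable _).map g = (toStable _).map η' := by
    rw [he, ← (toStable _).map_comp]
    congr 1
    ext : 1
    exact biprod.inl_desc _ _
  refine ⟨δ, isomorphic_distinguished _ hδ _ (Triangle.isoMk _ _ (Iso.refl _) e (Iso.refl _)
    ?_ ?_ ?_)⟩
  · change (toStable _).map κ ≫ e.hom = 𝟙 _ ≫ (toStable _).map f
    rw [Category.id_comp, ← hf, Category.assoc, Iso.inv_hom_id, Category.comp_id]
  · change (toStable _).map η' ≫ 𝟙 _ = e.hom ≫ (toStable _).map g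
    rw [Category.comp_id, hg]
  · change δ ≫ (𝟙 _)⟦(1 : ℤ)⟧' = 𝟙 _ ≫ δ
    rw [CategoryTheory.Functor.map_id, Category.comp_id, Category.id_comp]

/-- The recollement of `St ℳ(𝒳, M, 𝒴)` relative to `St 𝒳` and `St 𝒴`. -/
noncomputable def recollement : Recollement (StableCategory 𝒳) (StableCategory (monoRep M 𝒳 𝒴))
    (StableCategory 𝒴) where
  iUpper := stableFunctor (monoCoker M 𝒳 𝒴) hres.monoCoker_relProjective
  iLower := stableFunctor (monoZero M 𝒳 𝒴) hres.monoZero_relProjective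
  iShriek := stableFunctor (monoFst M 𝒳 𝒴 (hres.prop_right htensor))
    (monoFst_relProjective _ hℳ h𝒳)
  jShriek := stableFunctor (monoTensor M 𝒳 𝒴) hres.monoTensor_relProjective
  jUpper := stableFunctor (monoSnd M 𝒳 𝒴) hres.monoSnd_relProjective
  jLower := _
  iUpper_triangle := isTriangleFunctor_stableFunctor hℳ h𝒳 _ hres.monoCoker_isConflation
  iLower_triangle := isTriangleFunctor_stableFunctor h𝒳 hℳ _ monoZero_isConflation
  iShriek_triangle := isTriangleFunctor_stableFunctor hℳ h𝒳 _ (monoFst_isConflation _)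
  jShriek_triangle := isTriangleFunctor_stableFunctor h𝒴 hℳ _ hres.monoTensor_isConflation
  jUpper_triangle := isTriangleFunctor_stableFunctor hℳ h𝒴 _ monoSnd_isConflation
  jLower_triangle := IsTriangleFunctor.rightAdjoint (hres.monoSndAdjunction htensor h𝒳 hT)
    (isTriangleFunctor_stableFunctor hℳ h𝒴 _ monoSnd_isConflation)
  adj_iUpper_iLower := stableAdjunction _ _ (monoCokerAdjunction M 𝒳 𝒴)
  adj_iLower_iShriek := hres.stableMonoZeroAdjunction htensor h𝒳 hℳ
  adj_jShriek_jUpper := hres.stableMonoTensorAdjunction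
  adj_jUpper_jLower := hres.monoSndAdjunction htensor h𝒳 hT
  iLower_full := (hres.stableMonoZeroAdjunction htensor h𝒳 hℳ).fullyFaithfulLOfIsIsoUnit.full
  iLower_faithful :=
    (hres.stableMonoZeroAdjunction htensor h𝒳 hℳ).fullyFaithfulLOfIsIsoUnit.faithful
  jShriek_full := hres.stableMonoTensorAdjunction.fullyFaithfulLOfIsIsoUnit.full
  jShriek_faithful := hres.stableMonoTensorAdjunction.fullyFaithfulLOfIsIsoUnit.faithful
  jLower_full := (hres.monoSndAdjunction htensor h𝒳 hT).fullyFaithfulROfIsIsoCounit.full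
  jLower_faithful := (hres.monoSndAdjunction htensor h𝒳 hT).fullyFaithfulROfIsIsoCounit.faithful
  isZero_jUpper_iLower X :=
    (toStable 𝒴).map_isZero (X := (monoSnd M 𝒳 𝒴).obj ((monoZero M 𝒳 𝒴).obj X.as)) (by
      rw [IsZero.iff_id_eq_zero]
      ext : 1
      exact (isZero_left_tripleZero M X.as.obj).eq_of_src _ _)
  triangle_iShriek_jUpper X := hres.exists_distinguished_injectiveTriple htensor h𝒳 hℳ hT X.as
  triangle_jUpper_iUpper X := hres.exists_distinguished_monoTensor hℳ X.as

end IsResolving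

end Recollement

theorem mainTheorem9 {A B : Type u} [Ring A] [Ring B]
    (M : Type u) [AddCommGroup M] [Module A M] [Module Bᵐᵒᵖ M] [SMulCommClass A Bᵐᵒᵖ M]
    (𝒳 : ObjectProperty (ModuleCat.{u} A)) [𝒳.IsClosedUnderIsomorphisms] [𝒳.ContainsZero]
    (𝒴 : ObjectProperty (ModuleCat.{u} B)) [𝒴.IsClosedUnderIsomorphisms] [𝒴.ContainsZero]
    (hres : IsResolving (monoRep M 𝒳 𝒴))
    (htensor : ∀ Y, 𝒴 Y → 𝒳 ((tensorFunctor A B M).obj Y))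
    (hfrob : IsFrobenius (monoRep M 𝒳 𝒴) ∨
      (IsFrobenius 𝒳 ∧ IsFrobenius 𝒴 ∧
        ∀ Y, relInjective 𝒴 Y → relInjective 𝒳 ((tensorFunctor A B M).obj Y)) ∨
      (IsFrobenius 𝒳 ∧ IsFrobenius 𝒴 ∧
        ∀ Y, relProjective 𝒴 Y → relProjective 𝒳 ((tensorFunctor A B M).obj Y))) :
    IsFrobenius 𝒳 ∧ IsFrobenius (monoRep M 𝒳 𝒴) ∧ IsFrobenius 𝒴 ∧
    ∃ (hX : ∀ U, monoRep M 𝒳 𝒴 U → 𝒳 U.right)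
      (_ : StableTriangulation 𝒳) (_ : StableTriangulation (monoRep M 𝒳 𝒴))
      (_ : StableTriangulation 𝒴)
      (R : Recollement (StableCategory 𝒳) (StableCategory (monoRep M 𝒳 𝒴)) (StableCategory 𝒴)),
      IsInducedBy R.iUpper (monoCoker M 𝒳 𝒴) ∧
      IsInducedBy R.iLower (monoZero M 𝒳 𝒴) ∧
      IsInducedBy R.iShriek (monoFst M 𝒳 𝒴 hX) ∧
      IsInducedBy R.jUpper (monoSnd M 𝒳 𝒴) ∧
      IsInducedBy R.jShriek (monoTensor M 𝒳 𝒴) := by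
  obtain ⟨h𝒳, h𝒴, hT⟩ : IsFrobenius 𝒳 ∧ IsFrobenius 𝒴 ∧ ∀ Q : ModuleCat.{u} B, Projective Q →
      Projective ((tensorFunctor A B M).obj Q) := by
    rcases hfrob with h | ⟨h𝒳, h𝒴, h⟩ | ⟨h𝒳, h𝒴, h⟩
    · exact ⟨hres.isFrobenius_right h, hres.isFrobenius_left h,
        fun Q _ => hres.projective_tensor h htensor Q⟩
    · refine ⟨h𝒳, h𝒴, fun Q hQ => ?_⟩
      rw [← hres.isResolving_right.relProjective_iff, ← h𝒳.injective_iff_projective]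
      refine h Q ?_
      rwa [h𝒴.injective_iff_projective, hres.isResolving_left.relProjective_iff]
    · refine ⟨h𝒳, h𝒴, fun Q hQ => ?_⟩
      rw [← hres.isResolving_right.relProjective_iff]
      refine h Q ?_
      rwa [hres.isResolving_left.relProjective_iff]
  have hℳ := hres.isFrobenius_monoRep htensor h𝒳 h𝒴 hT
  obtain ⟨t𝒳⟩ := h𝒳.nonempty_stableTriangulation
  obtain ⟨tℳ⟩ := hℳ.nonempty_stableTriangulation
  obtain ⟨t𝒴⟩ := h𝒴.nonempty_stableTriangulation
  exact ⟨h𝒳, hℳ, h𝒴, hres.prop_right htensor, t𝒳, tℳ, t𝒴,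
    hres.recollement htensor h𝒳 h𝒴 hℳ hT, stableFunctor_isInducedBy hres.monoCoker_relProjective,
    stableFunctor_isInducedBy hres.monoZero_relProjective,
    stableFunctor_isInducedBy (monoFst_relProjective _ hℳ h𝒳),
    stableFunctor_isInducedBy hres.monoSnd_relProjective,
    stableFunctor_isInducedBy hres.monoTensor_relProjective⟩
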